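/- Let $n\ge 1$, let $1\le k\le\infty$, and let $M$ be an $n$-dimensional real $C^k$ manifold (Hausdorff, second countable, without boundary, not necessarily connected). A map $T:\mathcal B\to\mathcal B$ on a class $\mathcal B$ of complex-valued functions that is closed under pointwise products is called multiplicative if $T(fg)=Tf\cdot Tg$ pointwise for all $f,g\in\mathcal B$. (a) Let $\mathcal B$ be either $C^k(M,\mathbb C)$, the space of all complex-valued $C^k$ functions on $M$, or $C^k_c(M,\mathbb C)$, the space of those with compact support, and let $T:\mathcal B\to\mathcal B$ be a multiplicative bijection. Then there exist a $C^k$-diffeomorphism $u:M\to M$ and an open and closed subset $U\subseteq M$ such that for every $f\in\mathcal B$ $$(Tf)(u(x))=f(x)\quad (x\in U),\qquad (Tf)(u(x))=\overline{f(x)}\quad (x\in M\setminus U).$$ Consequently, if $M$ is connected, then either $(Tf)(u(x))=f(x)$ for all $f\in\mathcal B$ and $x\in M$, or $(Tf)(u(x))=\overline{f(x)}$ for all $f\in\mathcal B$ and $x\in M$. In particular, $T$ is $\mathbb R$-linear (whether or not $M$ is connected). (b) Let $\mathcal S_{\mathbb C}(n)$ be the Schwartz space of rapidly decreasing $C^\infty$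 functions $\mathbb R^n\to\mathbb C$, and let $T:\mathcal S_{\mathbb C}(n)\to\mathcal S_{\mathbb C}(n)$ be a multiplicative bijection. Then there exists a $C^\infty$-diffeomorphism $u:\mathbb R^n\to\mathbb R^n$ such that either $(Tf)(u(x))=f(x)$ for all $f\in\mathcal S_{\mathbb C}(n)$ and $x\in\mathbb R^n$, or $(Tf)(u(x))=\overline{f(x)}$ for all $f\in\mathcal S_{\mathbb C}(n)$ and $x\in\mathbb R^n$. In particular, $T$ is $\mathbb R$-linear. -/

import Mathlib

open scoped Manifold ContDiff

/-- `C^k(M, ℂ)`: the complex-valued `C^k` functions on a manifold `M` modelled on `ℝⁿ`,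
with pointwise operations. -/
def ckFunctions (n : ℕ) (k : ℕ∞) (M : Type*) [TopologicalSpace M]
    [ChartedSpace (EuclideanSpace ℝ (Fin n)) M] : NonUnitalSubalgebra ℝ (M → ℂ) where
  carrier := {f | ContMDiff (𝓡 n) 𝓘(ℝ, ℂ) k f}
  add_mem' hf hg := ContMDiff.add hf hg
  zero_mem' := contMDiff_const
  mul_mem' hf hg :=
    (contDiff_mul (𝕜 := ℝ) (𝔸 := ℂ)).contMDiff.comp (ContMDiff.prodMk_space hf hg)
  smul_mem' c _ hf := (contDiff_const_smul (𝕜 := ℝ) (F := ℂ) c).contMDiff.comp hf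

/-- `C^k_c(M, ℂ)`: the compactly supported functions in `C^k(M, ℂ)`. -/
def compactCkFunctions (n : ℕ) (k : ℕ∞) (M : Type*) [TopologicalSpace M]
    [ChartedSpace (EuclideanSpace ℝ (Fin n)) M] : NonUnitalSubalgebra ℝ (M → ℂ) where
  carrier := {f | ContMDiff (𝓡 n) 𝓘(ℝ, ℂ) k f ∧ HasCompactSupport f}
  add_mem' hf hg := ⟨ContMDiff.add hf.1 hg.1, hf.2.add hg.2⟩
  zero_mem' := ⟨contMDiff_const, HasCompactSupport.zero⟩
  mul_mem' hf hg :=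
    ⟨(contDiff_mul (𝕜 := ℝ) (𝔸 := ℂ)).contMDiff.comp (ContMDiff.prodMk_space hf.1 hg.1), hf.2.mul_right⟩
  smul_mem' c _ hf :=
    ⟨(contDiff_const_smul (𝕜 := ℝ) (F := ℂ) c).contMDiff.comp hf.1, hf.2.smul_left (f := fun _ => c)⟩

/-- The complex Schwartz space of `ℝⁿ`, as an algebra of functions `ℝⁿ → ℂ`. -/
def schwartzFunctions (n : ℕ) : NonUnitalSubalgebra ℝ (EuclideanSpace ℝ (Fin n) → ℂ) where
  carrier := {f | ∃ φ : SchwartzMap (EuclideanSpace ℝ (Fin n)) ℂ, (φ : _ → ℂ) = f}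
  add_mem' := by
    rintro _ _ ⟨φ, rfl⟩ ⟨ψ, rfl⟩
    exact ⟨φ + ψ, rfl⟩
  zero_mem' := ⟨0, rfl⟩
  mul_mem' := by
    rintro _ _ ⟨φ, rfl⟩ ⟨ψ, rfl⟩
    exact ⟨SchwartzMap.bilinLeftCLM (ContinuousLinearMap.mul ℝ ℂ) ψ.hasTemperateGrowth φ, rfl⟩
  smul_mem' := by
    rintro c _ ⟨φ, rfl⟩
    exact ⟨c • φ, rfl⟩

/-! Points are visible multiplicatively: `h * g = h` says that `g = 1` on the support of `h`. With
this relation, shrinking sequences of bumps (`IsCharSeq`) encode the points of `M`, so `T` induces a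
homeomorphism `u` and acts on germs along it (`exists_homeomorph`). Hence `T` extends to all `C^k`
functions (`exists_ckIso`), where constants, exponentials and local inverses are available.

Modulus. If `‖f x‖ < 1`, high powers of `f`, cut off along a sequence tending to `x`, sum to a `C^k`
function; an image of modulus above `1` would make the image of that sum unbounded. So `T` is
monotone in the modulus, and `‖Tf (u x)‖ = ‖f x‖ ^ a(x)`. The exponent `a` is `C^k`, and `log ‖T
(exp (H / a))‖ = H ∘ u⁻¹` shows that `u` is a diffeomorphism. Differentiability of the image of a
coordinate forces `a ≥ 1`; the same holds for `T⁻¹`, so `a = 1`.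

Phase. On functions of one coordinate along a curve, `T` becomes a local, multiplicative,
modulus-preserving operator `S` (`IsModulusOperator`). Bad behaviour of `S` at points accumulating
at `0` could be collected in one smooth function whose image is not `C¹` at `0`. Hence just to the
right of `0` the phase of `S (exp φ)` is a real-linear functional `lam`, and `S` ignores factors `1
+ (t - y) ^ N * A`. Applied to `t - (y - is)` near `y`, a coefficient of `lam` of order `m ≥ 1`
turns the phase at rate `s⁻ᵐ`, against a uniform Lipschitz bound (`coeff_eq_zero`).
Differentiability excludes a spiral `exp (ib log s)` (`coeff_zero_one`), and what remains is an
integer winding number. Continuity carries this to `0`.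

Therefore `Tf (u x)` depends only on `f x` and equals `‖c‖ exp (iν arg c)` at `c = f x`. The inverse
has the same form, so `ν = ±1`, and the sign is locally constant. -/

section

open scoped Topology
open Filter Set

/-! ### Gluing smooth functions along a sequence decreasing to `0`. -/

/-- A series of smooth functions whose `j`-th term has its first `j` derivatives bounded by `2⁻ʲ`
is smooth. -/
theorem contDiff_tsum_of_iteratedFDeriv_le {E : Type*} [NormedAddCommGroup E] [NormedSpace ℝ E]
    {φ : ℕ → E → ℂ} (hφ : ∀ j, ContDiff ℝ ∞ (φ j))
    (hb : ∀ j i, i ≤ j → ∀ x, ‖iteratedFDeriv ℝ i (φ j) x‖ ≤ (1 / 2) ^ j) :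
    ContDiff ℝ ∞ fun x => ∑' j, φ j x := by
  refine contDiff_tsum_of_eventually (v := fun _ j => (1 / 2 : ℝ) ^ j) hφ
    (fun _ _ => summable_geometric_two) fun i _ => ?_
  rw [Nat.cofinite_eq_atTop]
  filter_upwards [eventually_ge_atTop i] with j hj x using hb j i hj x

/-- Iterating a frequent choice of points near `0⁺`, with prescribed gaps. -/
theorem exists_seq_of_frequently_nhdsGT {Q : ℕ → ℝ → Prop} (hQ : ∀ j, ∃ᶠ y in 𝓝[>] (0 : ℝ), Q j y)
    {e : ℝ} (he : 0 < e) :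
    ∃ y : ℕ → ℝ, (∀ j, 0 < y j ∧ y j < e / 4 ^ j ∧ y (j + 1) < y j / 4 ∧ Q j (y j)) := by
  have key : ∀ j (b : ℝ), 0 < b → ∃ y, 0 < y ∧ y < b ∧ Q j y := fun j b hb => by
    have := (hQ j).and_eventually (Ioo_mem_nhdsGT hb)
    obtain ⟨y, h1, h2⟩ := this.exists
    exact ⟨y, h2.1, h2.2, h1⟩
  choose! g g0 gb gQ using key
  let y : ℕ → ℝ := fun j => Nat.rec (g 0 e) (fun j b => g (j + 1) (min (b / 4) (e / 4 ^ (j + 1)))) j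
  have hs : ∀ j, y (j + 1) = g (j + 1) (min (y j / 4) (e / 4 ^ (j + 1))) := fun j => rfl
  have h0 : y 0 = g 0 e := rfl
  have hpos : ∀ j, 0 < y j := by
    intro j
    induction j with
    | zero => rw [h0]; exact g0 _ _ he
    | succ j ih => rw [hs]; exact g0 _ _ (by positivity)
  have hp : ∀ j, 0 < min (y j / 4) (e / 4 ^ (j + 1)) := fun j => by
    have := hpos j
    positivity
  refine ⟨y, fun j => ⟨hpos j, ?_, ?_, ?_⟩⟩
  · cases j with
    | zero => rw [h0]; simpa using gb 0 e he
    | succ j => rw [hs]; exact (gb _ _ (hp j)).trans_le (min_le_right _ _)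
  · rw [hs]; exact (gb _ _ (hp j)).trans_le (min_le_left _ _)
  · cases j with
    | zero => rw [h0]; exact gQ _ _ he
    | succ j => rw [hs]; exact gQ _ _ (hp j)

theorem le_div_four_pow {y : ℕ → ℝ} (hy : ∀ j, y (j + 1) < y j / 4) (hp : ∀ j, 0 < y j)
    {i j : ℕ} (hij : i < j) : y j < y i / 4 := by
  induction j, hij using Nat.le_induction with
  | base => exact hy i
  | succ j _ ih => have := hy j; have := hp j; linarith

theorem disjoint_Ioo_of_lt_div_four {y : ℕ → ℝ} (hy : ∀ j, y (j + 1) < y j / 4) (hp : ∀ j, 0 < y j)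
    {i j : ℕ} {t : ℝ} (hi : t ∈ Ioo (y i / 2) (3 * y i / 2)) (hj : t ∈ Ioo (y j / 2) (3 * y j / 2)) :
    i = j := by
  have h1 := hp i
  have h2 := hp j
  rcases lt_trichotomy i j with h | h | h
  · have := le_div_four_pow hy hp h
    have := hi.1
    have := hj.2
    linarith
  · exact h
  · have := le_div_four_pow hy hp h
    have := hj.1
    have := hi.2
    linarith

theorem tsum_eq_of_mem_Ioo {F : Type*} {y : ℕ → ℝ} (hy : ∀ j, y (j + 1) < y j / 4)
    (hp : ∀ j, 0 < y j) {τ : F → ℝ} {φ : ℕ → F → ℂ}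
    (hs : ∀ j x, τ x ∉ Ioo (y j / 2) (3 * y j / 2) → φ j x = 0) {j : ℕ} {x : F}
    (hx : τ x ∈ Ioo (y j / 2) (3 * y j / 2)) : ∑' i, φ i x = φ j x :=
  tsum_eq_single j fun i hij => hs i x fun h => hij (disjoint_Ioo_of_lt_div_four hy hp h hx)

/-! ### Unit complex numbers and one-parameter groups of phases. -/

/-- A unit complex number different from `1` has a power at distance at least `1` from `1`. -/
theorem exists_one_le_norm_pow_sub_one {w : ℂ} (hw : ‖w‖ = 1) (h1 : w ≠ 1) :
    ∃ q : ℕ, 1 ≤ ‖w ^ q - 1‖ := by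
  by_contra! H
  -- Squaring expands: `‖v + 1‖² = 4 - ‖v - 1‖² > 3` by the parallelogram law, so the distance to
  -- `1` grows by `3/2` at each squaring and cannot stay below `1`.
  have step : ∀ v : ℂ, ‖v‖ = 1 → ‖v - 1‖ < 1 → (3 / 2) * ‖v - 1‖ ≤ ‖v ^ 2 - 1‖ := by
    intro v hv h
    have e : v ^ 2 - 1 = (v - 1) * (v + 1) := by ring
    have p := parallelogram_law_with_norm ℝ v 1
    rw [hv, norm_one] at p
    have h2 : 3 / 2 ≤ ‖v + 1‖ := by nlinarith [norm_nonneg (v + 1), norm_nonneg (v - 1)]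
    rw [e, norm_mul, mul_comm]
    exact mul_le_mul_of_nonneg_left h2 (norm_nonneg _)
  have all : ∀ N : ℕ, (3 / 2) ^ N * ‖w - 1‖ ≤ ‖w ^ (2 ^ N) - 1‖ := by
    intro N
    induction N with
    | zero => simp
    | succ N ih =>
      have := step (w ^ 2 ^ N) (by simp [hw]) (H _)
      rw [← pow_mul, ← pow_succ] at this
      refine le_trans ?_ this
      rw [pow_succ]
      nlinarith
  have hpos : 0 < ‖w - 1‖ := norm_pos_iff.2 (sub_ne_zero.2 h1)
  obtain ⟨N, hN⟩ := pow_unbounded_of_one_lt (1 / ‖w - 1‖) (by norm_num : (1 : ℝ) < 3 / 2)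
  have := all N
  have h3 := H (2 ^ N)
  rw [div_lt_iff₀ hpos] at hN
  linarith

/-- A continuous one-parameter group of unit complex numbers is `s ↦ exp (iμs)`. -/
theorem exists_eq_exp_of_continuous {q : ℝ → ℂ} (hq : ∀ s t, q (s + t) = q s * q t)
    (hn : ∀ s, ‖q s‖ = 1) (hc : Continuous q) : ∃ μ : ℝ, ∀ s, q s = Complex.exp (μ * s * Complex.I) := by
  have hq0 : q 0 = 1 := by
    have h := hq 0 0
    rw [add_zero] at h
    have h0 : q 0 ≠ 0 := norm_pos_iff.1 (by rw [hn]; norm_num)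
    exact (mul_eq_left₀ h0).1 h.symm
  -- Otherwise the primitive of `q` would vanish to the right of `0` and have derivative `0 ≠ q 0`.
  -- With such a `δ`, `q` is a constant multiple of its own average over `[s, s + δ]`, hence
  -- differentiable.
  obtain ⟨δ, hδ, hne⟩ : ∃ δ : ℝ, 0 < δ ∧ ∫ x in (0 : ℝ)..δ, q x ≠ 0 := by
    by_contra! H
    have hd : HasDerivWithinAt (fun s => ∫ x in (0 : ℝ)..s, q x) (q 0) (Ici 0) 0 :=
      (intervalIntegral.integral_hasDerivAt_right (hc.intervalIntegrable _ _)
        (hc.stronglyMeasurableAtFilter _ _) hc.continuousAt).hasDerivWithinAt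
    have hz : HasDerivWithinAt (fun s => ∫ x in (0 : ℝ)..s, q x) 0 (Ici 0) 0 :=
      (hasDerivWithinAt_const (0 : ℝ) (Ici 0) (0 : ℂ)).congr (fun s (hs : 0 ≤ s) => by
        rcases hs.eq_or_lt with rfl | h
        · simp
        · exact H s h) (by simp)
    have := (uniqueDiffWithinAt_Ici (0 : ℝ)).eq_deriv _ hd hz
    rw [hq0] at this
    exact one_ne_zero this
  set c := ∫ x in (0 : ℝ)..δ, q x
  have hform : ∀ s, q s = (∫ x in s..(s + δ), q x) / c := by
    intro s
    rw [eq_div_iff hne, ← intervalIntegral.integral_const_mul]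
    simp_rw [← hq]
    rw [intervalIntegral.integral_comp_add_left (f := q)]
    simp
  have hdiff : Differentiable ℝ q := by
    have hF : ∀ s, HasDerivAt (fun s => ∫ x in (0 : ℝ)..s, q x) (q s) s := fun s =>
      intervalIntegral.integral_hasDerivAt_right (hc.intervalIntegrable _ _)
        (hc.stronglyMeasurableAtFilter _ _) hc.continuousAt
    have e : q = fun s => ((∫ x in (0 : ℝ)..(s + δ), q x) - ∫ x in (0 : ℝ)..s, q x) / c := by
      funext s
      rw [intervalIntegral.integral_interval_sub_left (hc.intervalIntegrable _ _)
        (hc.intervalIntegrable _ _)]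
      exact hform s
    rw [e]
    intro s
    exact (((hF (s + δ)).comp_add_const s δ).sub (hF s)).div_const c |>.differentiableAt
  set a := deriv q 0
  have hder : ∀ s, HasDerivAt q (a * q s) s := by
    intro s
    have h1 : HasDerivAt (fun t => q s * q t) (q s * a) 0 := (hdiff 0).hasDerivAt.const_mul _
    have h2 : HasDerivAt (fun t => q (s + t)) (q s * a) 0 := by simpa only [hq] using h1
    have h3 : HasDerivAt (fun t => q (s + (t - s))) (q s * a) s :=
      HasDerivAt.comp_sub_const (f := fun t => q (s + t)) s s (by simpa using h2)
    simpa [mul_comm] using h3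
  have hexp : ∀ s : ℝ, HasDerivAt (fun s : ℝ => Complex.exp (-(a * s))) (Complex.exp (-(a * s)) * (-a)) s := by
    intro s
    have : HasDerivAt (fun s : ℝ => -(a * (s : ℂ))) (-a) s := by
      simpa using ((Complex.ofRealCLM.hasDerivAt (x := s)).const_mul a).fun_neg
    exact this.cexp
  have hconst : ∀ s : ℝ, q s * Complex.exp (-(a * s)) = 1 := by
    intro s
    have hd : ∀ s, HasDerivAt (fun s : ℝ => q s * Complex.exp (-(a * s))) 0 s := fun s => by
      convert! (hder s).mul (hexp s) using 1
      ring
    have := is_const_of_deriv_eq_zero (fun s => (hd s).differentiableAt) (fun s => (hd s).deriv) s 0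
    simpa [hq0] using this
  have hqe : ∀ s : ℝ, q s = Complex.exp (a * s) := by
    intro s
    have := hconst s
    rw [Complex.exp_neg, mul_inv_eq_one₀ (Complex.exp_ne_zero _)] at this
    exact this
  have hre : a.re = 0 := by
    have h := hn 1
    rw [hqe, Complex.norm_exp] at h
    simpa using h
  refine ⟨a.im, fun s => ?_⟩
  rw [hqe]
  congr 1
  apply Complex.ext <;> simp [hre]

/-- A one-parameter group of unit complex numbers that stays near `1` for small parameters is
`s ↦ exp (iμs)`. -/
theorem exists_eq_exp_of_eventually {q : ℝ → ℂ} (hq : ∀ s t, q (s + t) = q s * q t)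
    (hn : ∀ s, ‖q s‖ = 1) (h1 : ∀ᶠ s in 𝓝 (0 : ℝ), ‖q s - 1‖ ≤ 5 / 4) :
    ∃ μ : ℝ, ∀ s, q s = Complex.exp (μ * s * Complex.I) := by
  -- Passing from `2s` to `s` contracts the distance to `1`: `q (2s) - 1 = (q s - 1)(q s + 1)`, and
  -- `‖q s - 1‖ ≤ 5/4` keeps `‖q s + 1‖` above `6/5`. A crude bound thus yields continuity at `0`.
  have hev : ∀ N : ℕ, ∀ᶠ s in 𝓝 (0 : ℝ), ‖q s - 1‖ ≤ 5 / 4 * (5 / 6) ^ N := by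
    intro N
    induction N with
    | zero => simpa using h1
    | succ N ih =>
      have h2 : Tendsto (fun s : ℝ => s + s) (𝓝 0) (𝓝 0) := by
        have : Continuous fun s : ℝ => s + s := by fun_prop
        simpa using this.tendsto 0
      filter_upwards [h1, h2.eventually ih] with s hs1 hs2
      have e : q (s + s) - 1 = (q s - 1) * (q s + 1) := by rw [hq]; ring
      have p := parallelogram_law_with_norm ℝ (q s) 1
      rw [hn, norm_one] at p
      have h3 : 6 / 5 ≤ ‖q s + 1‖ := by nlinarith [norm_nonneg (q s + 1), norm_nonneg (q s - 1)]
      rw [e, norm_mul] at hs2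
      rw [pow_succ]
      nlinarith [norm_nonneg (q s - 1)]
  have hq0 : Tendsto q (𝓝 0) (𝓝 1) := by
    rw [tendsto_iff_norm_sub_tendsto_zero, Metric.tendsto_nhds]
    intro ε hε
    obtain ⟨N, hN⟩ := exists_pow_lt_of_lt_one (show 0 < ε / 2 by positivity)
      (by norm_num : (5 / 6 : ℝ) < 1)
    filter_upwards [hev N] with s hs
    rw [Real.dist_0_eq_abs, abs_of_nonneg (norm_nonneg _)]
    linarith
  refine exists_eq_exp_of_continuous hq hn (continuous_iff_continuousAt.2 fun s => ?_)
  have h2 : Tendsto (fun t => q s * q (t - s)) (𝓝 s) (𝓝 (q s * 1)) := by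
    refine (hq0.comp ?_).const_mul _
    have : Continuous fun t : ℝ => t - s := by fun_prop
    simpa using this.tendsto s
  simpa [ContinuousAt, ← hq] using h2

open MeasureTheory ProbabilityTheory in
/-- If `exp (isλ)` depends continuously on a parameter for every real `s`, then so does `λ`. -/
theorem tendsto_of_forall_tendsto_exp {α : Type*} {l : Filter α} [l.IsCountablyGenerated]
    {f : α → ℝ} {b : ℝ}
    (h : ∀ s : ℝ, Tendsto (fun y => Complex.exp (f y * s * Complex.I)) l
      (𝓝 (Complex.exp (b * s * Complex.I)))) : Tendsto f l (𝓝 b) := by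
  -- Averaging over `s` against a Gaussian turns pointwise convergence of the characters into `exp
  -- (-(f - b)² / 2) → 1`, which excludes escape to infinity and shifts by periods.
  have hint : Tendsto (fun y => ∫ s, Complex.exp (((f y - b : ℝ) : ℂ) * s * Complex.I) ∂(gaussianReal 0 1))
      l (𝓝 (∫ _, (1 : ℂ) ∂(gaussianReal 0 1))) := by
    refine tendsto_integral_filter_of_dominated_convergence (fun _ => 1) ?_ ?_ (by simp) ?_
    · exact Eventually.of_forall fun y => (by fun_prop : Continuous fun s : ℝ =>
        Complex.exp (((f y - b : ℝ) : ℂ) * s * Complex.I)).aestronglyMeasurable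
    · refine Eventually.of_forall fun y => Eventually.of_forall fun s => ?_
      rw [← Complex.ofReal_mul, Complex.norm_exp_ofReal_mul_I]
    · refine Eventually.of_forall fun s => ?_
      have := (h s).mul_const (Complex.exp (-(b * s * Complex.I)))
      rw [← Complex.exp_add, add_neg_cancel, Complex.exp_zero] at this
      refine this.congr fun y => ?_
      rw [← Complex.exp_add]
      push_cast
      ring_nf
  have hval : ∀ y, ∫ s, Complex.exp (((f y - b : ℝ) : ℂ) * s * Complex.I) ∂(gaussianReal 0 1)
      = Complex.exp (-((f y - b : ℝ) : ℂ) ^ 2 / 2) := by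
    intro y
    have := charFun_gaussianReal (μ := 0) (v := 1) (f y - b)
    rw [charFun_apply_real] at this
    rw [this]
    simp [neg_div]
  simp_rw [hval] at hint
  have h2 : Tendsto (fun y => Real.exp (-(f y - b) ^ 2 / 2)) l (𝓝 1) := by
    have := hint.norm
    simp only [integral_const, probReal_univ, one_smul, norm_one] at this
    refine this.congr fun y => ?_
    rw [← Complex.ofReal_pow, ← Complex.ofReal_neg, show ((2 : ℂ)) = ((2 : ℝ) : ℂ) by simp,
      ← Complex.ofReal_div, Complex.norm_exp, Complex.ofReal_re]
  have h3 : Tendsto (fun y => (f y - b) ^ 2) l (𝓝 0) := by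
    have := (h2.log one_ne_zero).const_mul (-2)
    simp only [Real.log_exp, Real.log_one, mul_zero] at this
    refine this.congr fun y => ?_
    ring
  have h4 := h3.sqrt
  simp only [Real.sqrt_sq_eq_abs, Real.sqrt_zero] at h4
  rw [tendsto_iff_norm_sub_tendsto_zero]
  exact h4

/-- `exp (ih)` has no limit along `0⁺` when `h` is continuous and unbounded there. -/
theorem not_tendsto_exp_of_tendsto_atTop {h : ℝ → ℝ} {e : ℝ} (he : 0 < e)
    (hc : ContinuousOn h (Ioo 0 e)) (ht : Tendsto h (𝓝[>] 0) atTop) {d : ℂ} :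
    ¬ Tendsto (fun s => Complex.exp (h s * Complex.I)) (𝓝[>] 0) (𝓝 d) := by
  intro hd
  -- By the intermediate value theorem `h` meets every class modulo `2π` arbitrarily close to `0`,
  -- so `1` and `-1` would both be the limit.
  have hval : ∀ v : ℝ, (∃ᶠ s in 𝓝[>] (0 : ℝ), ∃ k : ℕ, h s = v + k * (2 * Real.pi)) := by
    intro v
    rw [(nhdsGT_basis (0 : ℝ)).frequently_iff]
    intro r hr
    set s1 := min r e / 2
    have hs1 : 0 < s1 := by positivity
    have hs1e : s1 < e := by have := min_le_right r e; simp only [s1]; linarith [lt_min hr he]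
    have hs1r : s1 < r := by have := min_le_left r e; simp only [s1]; linarith [lt_min hr he]
    obtain ⟨k, hk⟩ := exists_nat_gt ((h s1 - v) / (2 * Real.pi))
    rw [div_lt_iff₀ (by positivity)] at hk
    obtain ⟨s0, hs0, hs0'⟩ := ((ht.eventually_ge_atTop (v + k * (2 * Real.pi))).and
      (Ioo_mem_nhdsGT hs1)).exists
    have hsub : Icc s0 s1 ⊆ Ioo 0 e := fun z hz => ⟨hs0'.1.trans_le hz.1, hz.2.trans_lt hs1e⟩
    obtain ⟨z, hz, hzv⟩ := intermediate_value_Icc' hs0'.2.le (hc.mono hsub)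
      (show v + k * (2 * Real.pi) ∈ Icc (h s1) (h s0) from ⟨by linarith, hs0⟩)
    exact ⟨z, ⟨hs0'.1.trans_le hz.1, hz.2.trans_lt hs1r⟩, k, hzv⟩
  have hlim : ∀ v : ℝ, d = Complex.exp (v * Complex.I) := by
    intro v
    by_contra hne
    have := hd.eventually_ne hne
    obtain ⟨s, ⟨k, hk⟩, hs⟩ := ((hval v).and_eventually this).exists
    apply hs
    rw [hk]
    push_cast
    rw [add_mul, Complex.exp_add, mul_assoc (k : ℂ), Complex.exp_nat_mul_two_pi_mul_I, mul_one]
  have h0 := hlim 0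
  have hp := hlim Real.pi
  rw [h0, Complex.exp_pi_mul_I] at hp
  norm_num at hp

/-! ### Cutoffs, and automatic regularity of modulus-preserving operators on the line. -/

theorem exists_norm_iteratedFDeriv_le {E : Type*} [NormedAddCommGroup E] [NormedSpace ℝ E]
    {f : E → ℂ} (hf : ContDiff ℝ ∞ f) (hc : HasCompactSupport f) (j : ℕ) :
    ∃ C : ℝ, 0 < C ∧ ∀ i ≤ j, ∀ x, ‖iteratedFDeriv ℝ i f x‖ ≤ C := by
  have key : ∀ i, ∃ C : ℝ, ∀ x, ‖iteratedFDeriv ℝ i f x‖ ≤ C := fun i =>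
    (hc.iteratedFDeriv i).exists_bound_of_continuous
      (hf.continuous_iteratedFDeriv (by exact_mod_cast le_top))
  choose C hC using key
  refine ⟨1 + ∑ i ∈ Finset.range (j + 1), |C i|, by positivity, fun i hi x => ?_⟩
  have h1 : |C i| ≤ ∑ i ∈ Finset.range (j + 1), |C i| :=
    Finset.single_le_sum (f := fun i => |C i|) (fun _ _ => abs_nonneg _)
      (Finset.mem_range.2 (by omega))
  have := le_abs_self (C i)
  have := hC i x
  linarith

/-- A smooth cutoff function on the line. -/
theorem exists_cutoff (y : ℝ) {r R : ℝ} (hr : 0 < r) (hR : r < R) :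
    ∃ ρ : ℝ → ℂ, ContDiff ℝ ∞ ρ ∧ HasCompactSupport ρ ∧ (∀ t ∉ Ioo (y - R) (y + R), ρ t = 0) ∧
      ∀ t ∈ Icc (y - r) (y + r), ρ t = 1 := by
  let b : ContDiffBump y := ⟨r, R, hr, hR⟩
  refine ⟨fun t => ((b t : ℝ) : ℂ), Complex.ofRealCLM.contDiff.comp b.contDiff, ?_, ?_, ?_⟩
  · exact b.hasCompactSupport.comp_left (g := fun x : ℝ => (x : ℂ)) (by simp)
  · intro t ht
    have : b t = 0 := b.zero_of_le_dist (by
      rw [Real.dist_eq]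
      by_contra! h
      rw [abs_lt] at h
      exact ht ⟨by linarith [h.1], by linarith [h.2]⟩)
    simp [this]
  · intro t ht
    have : b t = 1 := b.one_of_mem_closedBall (by
      rw [Metric.mem_closedBall, Real.dist_eq, abs_le]
      exact ⟨by linarith [ht.1], by linarith [ht.2]⟩)
    simp [this]

/-- A multiplicative, modulus-preserving, local operator from smooth functions on the line to
`C¹` functions on the interval `(-e, e)`. -/
structure IsModulusOperator (e : ℝ) (S : (ℝ → ℂ) → ℝ → ℂ) : Prop where
  pos : 0 < e
  mul : ∀ {G H : ℝ → ℂ}, ContDiff ℝ ∞ G → ContDiff ℝ ∞ H → ∀ {y}, y ∈ Ioo (-e) e →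
    S (fun t => G t * H t) y = S G y * S H y
  norm : ∀ {G : ℝ → ℂ}, ContDiff ℝ ∞ G → ∀ {y}, y ∈ Ioo (-e) e → ‖S G y‖ = ‖G y‖
  congr : ∀ {G H : ℝ → ℂ}, ContDiff ℝ ∞ G → ContDiff ℝ ∞ H → ∀ {y}, y ∈ Ioo (-e) e →
    G =ᶠ[𝓝 y] H → S G y = S H y
  contDiffOn : ∀ {G : ℝ → ℂ}, ContDiff ℝ ∞ G → ContDiffOn ℝ 1 (S G) (Ioo (-e) e)

namespace IsModulusOperator

variable {e : ℝ} {S : (ℝ → ℂ) → ℝ → ℂ}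

theorem continuousOn (h : IsModulusOperator e S) {G : ℝ → ℂ} (hG : ContDiff ℝ ∞ G) :
    ContinuousOn (S G) (Ioo (-e) e) := (h.contDiffOn hG).continuousOn

theorem mem (h : IsModulusOperator e S) {y : ℝ} (hy : y ∈ Ioo 0 e) : y ∈ Ioo (-e) e :=
  ⟨by linarith [hy.1, h.pos], hy.2⟩

theorem map_one (h : IsModulusOperator e S) {y : ℝ} (hy : y ∈ Ioo (-e) e) :
    S (fun _ => 1) y = 1 := by
  have h1 := h.mul (G := fun _ => 1) (H := fun _ => 1) contDiff_const contDiff_const hy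
  have h2 := h.norm (G := fun _ => 1) contDiff_const hy
  simp only [mul_one] at h1
  have h0 : S (fun _ => 1) y ≠ 0 := norm_pos_iff.1 (by rw [h2]; simp)
  exact (mul_eq_left₀ h0).1 h1.symm

theorem pow (h : IsModulusOperator e S) {y : ℝ} (hy : y ∈ Ioo (-e) e) {G : ℝ → ℂ}
    (hG : ContDiff ℝ ∞ G) (q : ℕ) : S (fun t => G t ^ q) y = S G y ^ q := by
  induction q with
  | zero => simpa using h.map_one hy
  | succ q ih => simp only [pow_succ]; rw [h.mul (hG.pow q) hG hy, ih]

theorem tendsto_zero (h : IsModulusOperator e S) {G : ℝ → ℂ} (hG : ContDiff ℝ ∞ G) :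
    Tendsto (S G) (𝓝 0) (𝓝 (S G 0)) :=
  (h.continuousOn hG).continuousAt (Ioo_mem_nhds (by linarith [h.pos]) h.pos)

end IsModulusOperator

/-- Small smooth functions with supports in disjoint intervals accumulating at `0` add up to a
smooth function. -/
theorem exists_glue {y : ℕ → ℝ} (hy : ∀ j, y (j + 1) < y j / 4) (hp : ∀ j, 0 < y j)
    {φ : ℕ → ℝ → ℂ} (hφ : ∀ j, ContDiff ℝ ∞ (φ j))
    (hs : ∀ j, ∀ t ∉ Ioo (y j / 2) (3 * y j / 2), φ j t = 0)
    (hb : ∀ j i, i ≤ j → ∀ x, ‖iteratedFDeriv ℝ i (φ j) x‖ ≤ (1 / 2) ^ j) :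
    ∃ Φ : ℝ → ℂ, ContDiff ℝ ∞ Φ ∧ (∀ j, ∀ t ∈ Ioo (y j / 2) (3 * y j / 2), Φ t = φ j t) ∧
      ∀ t ≤ 0, Φ t = 0 := by
  refine ⟨fun t => ∑' j, φ j t, contDiff_tsum_of_iteratedFDeriv_le hφ hb, fun j t ht =>
    tsum_eq_of_mem_Ioo hy hp (τ := id) hs ht, fun t ht => ?_⟩
  have : ∀ j, φ j t = 0 := fun j => hs j t fun h => by have := h.1; have := hp j; linarith
  simp [this]

theorem tendsto_of_lt_div_pow {y : ℕ → ℝ} {e : ℝ} (hp : ∀ j, 0 < y j) (h : ∀ j, y j < e / 4 ^ j) :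
    Tendsto y atTop (𝓝 0) := by
  refine squeeze_zero (fun j => (hp j).le) (fun j => (h j).le) ?_
  have := (tendsto_pow_atTop_nhds_zero_of_lt_one (by norm_num : (0 : ℝ) ≤ 1 / 4)
    (by norm_num)).const_mul e
  simpa [div_eq_mul_inv] using this

namespace IsModulusOperator

variable {e : ℝ} {S : (ℝ → ℂ) → ℝ → ℂ}

/-- Common engine of the arguments by contradiction that follow. The glued function vanishes on `t ≤
0`, so by locality the image of its composite with `H` is `1` to the left of `0`, and by continuity
also at `0`. The images at the points `y j → 0`, which see only the `j`-th piece, must then tend to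
`1`. -/
theorem tendsto_comp_glue (h : IsModulusOperator e S) {y : ℕ → ℝ} (hy : ∀ j, y (j + 1) < y j / 4)
    (hp : ∀ j, 0 < y j) (he : ∀ j, y j < e / 4 ^ j) {φ : ℕ → ℝ → ℂ} (hφ : ∀ j, ContDiff ℝ ∞ (φ j))
    (hs : ∀ j, ∀ t ∉ Ioo (y j / 2) (3 * y j / 2), φ j t = 0)
    (hb : ∀ j i, i ≤ j → ∀ x, ‖iteratedFDeriv ℝ i (φ j) x‖ ≤ (1 / 2) ^ j) {H : ℂ → ℂ}
    (hH : ContDiff ℝ ∞ H) (hH0 : H 0 = 1) :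
    Tendsto (fun j => S (fun t => H (φ j t)) (y j)) atTop (𝓝 1) := by
  obtain ⟨Φ, hΦ, h1, h2⟩ := exists_glue hy hp hφ hs hb
  have hF : ContDiff ℝ ∞ fun t => H (Φ t) := hH.comp hΦ
  have hI : ∀ j, y j ∈ Ioo (-e) e := fun j => h.mem ⟨hp j, (he j).trans_le
    (div_le_self h.pos.le (one_le_pow₀ (by norm_num)))⟩
  have h0 : S (fun t => H (Φ t)) 0 = 1 := by
    have hneg : Tendsto (S fun t => H (Φ t)) (𝓝[<] 0) (𝓝 1) := by
      refine tendsto_const_nhds.congr' ?_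
      filter_upwards [Ioo_mem_nhdsLT (show -e < 0 by linarith [h.pos])] with t ht
      have htI : t ∈ Ioo (-e) e := ⟨ht.1, ht.2.trans h.pos⟩
      rw [h.congr hF contDiff_const htI (H := fun _ => 1), h.map_one htI]
      filter_upwards [Iio_mem_nhds ht.2] with x hx
      rw [h2 x (le_of_lt hx), hH0]
    exact tendsto_nhds_unique ((h.tendsto_zero hF).mono_left nhdsWithin_le_nhds) hneg
  have ht := (h.tendsto_zero hF).comp (tendsto_of_lt_div_pow hp he)
  rw [h0] at ht
  refine ht.congr fun j => h.congr hF (hH.comp (hφ j)) (hI j) ?_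
  have := hp j
  filter_upwards [Ioo_mem_nhds (show y j / 2 < y j by linarith)
    (show y j < 3 * y j / 2 by linarith)] with t ht
  simp only [h1 j t ht, Function.comp]

/-- If it failed at points `y j → 0`, some `φ j` would have parameters `s j`, as small as desired,
with image far from `1`. Choosing `s j` small enough to make the cut-off pieces `s j * φ j` summable
in every derivative contradicts `tendsto_comp_glue`. The bound `1` need not be small: the group law
in `s` improves it later. -/
theorem eventually_exp_near_one (h : IsModulusOperator e S) :
    ∀ᶠ y in 𝓝[>] (0 : ℝ), ∀ φ : ℝ → ℂ, ContDiff ℝ ∞ φ →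
      ∀ᶠ s : ℝ in 𝓝 0, ‖S (fun t => Complex.exp (s * φ t)) y - 1‖ ≤ 1 := by
  by_contra hcon
  rw [not_eventually] at hcon
  obtain ⟨y, hy⟩ := exists_seq_of_frequently_nhdsGT (fun _ => hcon) h.pos
  have hp : ∀ j, 0 < y j := fun j => (hy j).1
  have bad : ∀ j, ∃ φ : ℝ → ℂ, ContDiff ℝ ∞ φ ∧
      ∃ᶠ s : ℝ in 𝓝 0, 1 < ‖S (fun t => Complex.exp (s * φ t)) (y j) - 1‖ := by
    intro j
    have := (hy j).2.2.2
    push Not at this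
    exact this
  choose φ hφ hbad using bad
  choose ρ hρ hρc hρ0 hρ1 using fun j => exists_cutoff (y j) (r := y j / 8) (R := y j / 4)
    (by linarith [hp j]) (by linarith [hp j])
  have hψ : ∀ j, ContDiff ℝ ∞ fun t => ρ j t * φ j t := fun j => (hρ j).mul (hφ j)
  choose C hC hCb using fun j => exists_norm_iteratedFDeriv_le (hψ j)
    ((hρc j).mul_right (f' := φ j)) j
  have hs : ∀ j, ∃ s : ℝ, |s| ≤ (1 / 2) ^ j / C j ∧
      1 < ‖S (fun t => Complex.exp (s * φ j t)) (y j) - 1‖ := by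
    intro j
    have hpos : 0 < (1 / 2 : ℝ) ^ j / C j := div_pos (by positivity) (hC j)
    obtain ⟨s, hs1, hs2⟩ := ((hbad j).and_eventually (Metric.ball_mem_nhds (0 : ℝ) hpos)).exists
    exact ⟨s, by simpa using hs2.le, hs1⟩
  choose s hs1 hs2 using hs
  have hlim := h.tendsto_comp_glue (fun j => (hy j).2.2.1) hp (fun j => (hy j).2.1)
    (φ := fun j t => (s j) • (ρ j t * φ j t)) (fun j => (hψ j).const_smul _) (fun j t ht => by
      rw [hρ0 j t fun hh => ht ⟨by linarith [hh.1, hp j], by linarith [hh.2, hp j]⟩]; simp)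
    (fun j i hij x => by
      have e1 : (fun t => s j • (ρ j t * φ j t)) = s j • fun t => ρ j t * φ j t := rfl
      rw [e1, iteratedFDeriv_const_smul_apply ((hψ j).of_le (by exact_mod_cast le_top)).contDiffAt,
        norm_smul, Real.norm_eq_abs]
      have h1 := hCb j i hij x
      have h2 := hs1 j
      rw [le_div_iff₀ (hC j)] at h2
      exact (mul_le_mul_of_nonneg_left h1 (abs_nonneg _)).trans h2)
    (H := Complex.exp) Complex.contDiff_exp Complex.exp_zero
  have hev := (tendsto_iff_norm_sub_tendsto_zero.1 hlim).eventually_lt_const one_pos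
  obtain ⟨j, hj⟩ := hev.exists
  have hI : y j ∈ Ioo (-e) e := h.mem ⟨hp j, ((hy j).2.1).trans_le
    (div_le_self h.pos.le (one_le_pow₀ (by norm_num)))⟩
  have := hs2 j
  rw [h.congr (G := fun t => Complex.exp (s j * φ j t))
    (H := fun t => Complex.exp ((s j) • (ρ j t * φ j t))) (by have := hφ j; fun_prop)
    (by have := hψ j; fun_prop) hI] at this
  · linarith
  · filter_upwards [Icc_mem_nhds (show y j - y j / 8 < y j by linarith [hp j])
      (show y j < y j + y j / 8 by linarith [hp j])] with t ht
    rw [hρ1 j t ht]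
    simp

end IsModulusOperator

/-- Cutting off a function vanishing to order `j + 1` at `y` on a small scale makes its first `j`
derivatives small. -/
theorem exists_small_flat_cutoff (j : ℕ) (y : ℝ) {r R ε : ℝ} (hr : 0 < r) (hR : r < R)
    {A : ℝ → ℂ} (hA : ContDiff ℝ ∞ A) (hε : 0 < ε) :
    ∃ φ : ℝ → ℂ, ContDiff ℝ ∞ φ ∧ (∀ t ∉ Ioo (y - R) (y + R), φ t = 0) ∧
      (φ =ᶠ[𝓝 y] fun t => ((t - y : ℝ) : ℂ) ^ (j + 1) * A t) ∧
      ∀ i ≤ j, ∀ x, ‖iteratedFDeriv ℝ i φ x‖ ≤ ε := by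
  obtain ⟨ρ, hρ, hρc, hρ0, hρ1⟩ := exists_cutoff y hr hR
  obtain ⟨θ, hθ, hθc, -, hθ1⟩ := exists_cutoff 0 (r := 1) (R := 2) one_pos (by norm_num)
  have hB : ContDiff ℝ ∞ fun t => ρ t * A t := hρ.mul hA
  have hΘ : ContDiff ℝ ∞ fun w : ℝ => (w : ℂ) ^ (j + 1) * θ w :=
    (Complex.ofRealCLM.contDiff.pow _).mul hθ
  obtain ⟨C, hC, hCb⟩ := exists_norm_iteratedFDeriv_le hB (hρc.mul_right (f' := A)) j
  obtain ⟨D, hD, hDb⟩ := exists_norm_iteratedFDeriv_le hΘ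
    (hθc.mul_left (f := fun w : ℝ => (w : ℂ) ^ (j + 1))) j
  -- Rescaling to width `δ` costs at most `δ⁻ʲ` in the first `j` derivatives, against the gain `δ ^
  -- (j + 1)`. One factor `δ` remains to beat the Leibniz constant `2 ^ j * D * C`.
  set δ := min 1 (ε / (2 ^ j * D * C)) with hδ
  have hδ0 : 0 < δ := by positivity
  have hδ1 : δ ≤ 1 := min_le_left _ _
  let Θ : ℝ → ℂ := fun t => ((δ⁻¹ * (t - y) : ℝ) : ℂ) ^ (j + 1) * θ (δ⁻¹ * (t - y))
  have hΘs : ContDiff ℝ ∞ Θ := hΘ.comp (contDiff_const.mul (contDiff_id.sub contDiff_const))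
  have hΘb : ∀ i ≤ j, ∀ x, ‖iteratedFDeriv ℝ i Θ x‖ ≤ δ⁻¹ ^ i * D := by
    intro i hi x
    have e1 : Θ = fun t => (fun w => ((δ⁻¹ * w : ℝ) : ℂ) ^ (j + 1) * θ (δ⁻¹ * w)) (t - y) := rfl
    rw [e1, iteratedFDeriv_comp_sub (f := fun w : ℝ => ((δ⁻¹ * w : ℝ) : ℂ) ^ (j + 1) * θ (δ⁻¹ * w)),
      norm_iteratedFDeriv_eq_norm_iteratedDeriv]
    have := iteratedDeriv_comp_const_smul (n := i)
      (hΘ.of_le (show (i : WithTop ℕ∞) ≤ ∞ by exact_mod_cast le_top)) δ⁻¹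
    rw [this]
    simp only
    rw [norm_smul, norm_pow, Real.norm_eq_abs, abs_of_pos (by positivity),
      ← norm_iteratedFDeriv_eq_norm_iteratedDeriv]
    exact mul_le_mul_of_nonneg_left (hDb i hi _) (by positivity)
  have hprod : ContDiff ℝ ∞ fun t => Θ t * (ρ t * A t) := hΘs.mul hB
  refine ⟨fun t => (δ ^ (j + 1)) • (Θ t * (ρ t * A t)), hprod.const_smul _, ?_, ?_, ?_⟩
  · intro t ht
    simp [hρ0 t ht]
  · filter_upwards [Icc_mem_nhds (show y - r < y by linarith) (show y < y + r by linarith),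
      Icc_mem_nhds (show y - δ < y by linarith) (show y < y + δ by linarith)] with t ht ht'
    have h1 : θ (δ⁻¹ * (t - y)) = 1 := by
      apply hθ1
      have h2 : |δ⁻¹ * (t - y)| ≤ 1 := by
        rw [abs_mul, abs_of_pos (inv_pos.2 hδ0), inv_mul_le_iff₀ hδ0, mul_one, abs_le]
        exact ⟨by linarith [ht'.1], by linarith [ht'.2]⟩
      rw [zero_sub, zero_add]
      exact abs_le.1 h2
    simp only [Θ, h1, hρ1 t ht, Complex.real_smul]
    have hδc : (δ : ℂ) ≠ 0 := by exact_mod_cast hδ0.ne'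
    push_cast
    rw [mul_pow, inv_pow]
    field_simp
  · intro i hi x
    have e1 : (fun t => (δ ^ (j + 1)) • (Θ t * (ρ t * A t)))
      = (δ ^ (j + 1)) • fun t => Θ t * (ρ t * A t) := rfl
    have hle : ((i : ℕ) : WithTop ℕ∞) ≤ ∞ := by exact_mod_cast le_top
    rw [e1, iteratedFDeriv_const_smul_apply (hprod.of_le hle).contDiffAt, norm_smul,
      Real.norm_eq_abs, abs_of_pos (by positivity)]
    have hm := norm_iteratedFDeriv_mul_le hΘs hB x (n := i) hle
    have hsum : ∑ l ∈ Finset.range (i + 1), (i.choose l : ℝ) * ‖iteratedFDeriv ℝ l Θ x‖ *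
        ‖iteratedFDeriv ℝ (i - l) (fun t => ρ t * A t) x‖
        ≤ ∑ l ∈ Finset.range (i + 1), (i.choose l : ℝ) * (δ⁻¹ ^ j * D) * C := by
      refine Finset.sum_le_sum fun l hl => ?_
      have hl' : l ≤ i := by simpa [Nat.lt_succ_iff] using hl
      have h1 := hΘb l (hl'.trans hi) x
      have h2 := hCb (i - l) (by omega) x
      have h3 : δ⁻¹ ^ l ≤ δ⁻¹ ^ j := pow_le_pow_right₀ (one_le_inv₀ hδ0 |>.2 hδ1) (hl'.trans hi)
      have h4 : ‖iteratedFDeriv ℝ l Θ x‖ ≤ δ⁻¹ ^ j * D :=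
        h1.trans (mul_le_mul_of_nonneg_right h3 hD.le)
      gcongr
    have hch : ∑ l ∈ Finset.range (i + 1), (i.choose l : ℝ) * (δ⁻¹ ^ j * D) * C
        = 2 ^ i * (δ⁻¹ ^ j * D) * C := by
      rw [← Finset.sum_mul, ← Finset.sum_mul]
      congr 2
      exact_mod_cast Nat.sum_range_choose i
    have h2i : (2 : ℝ) ^ i ≤ 2 ^ j := pow_le_pow_right₀ (by norm_num) hi
    calc δ ^ (j + 1) * ‖iteratedFDeriv ℝ i (fun t => Θ t * (ρ t * A t)) x‖
        ≤ δ ^ (j + 1) * (2 ^ j * (δ⁻¹ ^ j * D) * C) := by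
          refine mul_le_mul_of_nonneg_left ((hm.trans hsum).trans ?_) (by positivity)
          rw [hch]
          gcongr
      _ = δ * (2 ^ j * D * C) := by
          rw [inv_pow, pow_succ]
          field_simp
      _ ≤ ε / (2 ^ j * D * C) * (2 ^ j * D * C) :=
          mul_le_mul_of_nonneg_right (min_le_right _ _) (by positivity)
      _ = ε := div_mul_cancel₀ _ (by positivity)

namespace IsModulusOperator

variable {e : ℝ} {S : (ℝ → ℂ) → ℝ → ℂ}

/-- Finite order by contradiction: flatter and flatter counterexamples at points tending to `0` can
be cut off so sharply that their perturbations glue to a smooth function, against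
`tendsto_comp_glue`. This is what makes the phase depend on finitely many Taylor coefficients. -/
theorem exists_flat_order (h : IsModulusOperator e S) :
    ∃ N : ℕ, 2 ≤ N ∧ ∀ᶠ y in 𝓝[>] (0 : ℝ), ∀ A : ℝ → ℂ, ContDiff ℝ ∞ A →
      S (fun t => 1 + ((t - y : ℝ) : ℂ) ^ N * A t) y = 1 := by
  by_contra! hcon
  have hfreq : ∀ j : ℕ, ∃ᶠ y in 𝓝[>] (0 : ℝ), ∃ A : ℝ → ℂ, ContDiff ℝ ∞ A ∧
      1 ≤ ‖S (fun t => 1 + ((t - y : ℝ) : ℂ) ^ (j + 1) * A t) y - 1‖ := by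
    intro j
    have := (hcon (j + 2) (by omega)).and_eventually (Ioo_mem_nhdsGT h.pos)
    refine this.mono fun y hy => ?_
    obtain ⟨⟨A, hA, hne⟩, hyI⟩ := hy
    have hI := h.mem hyI
    have hAs : ContDiff ℝ ∞ fun t : ℝ => 1 + ((t - y : ℝ) : ℂ) ^ (j + 2) * A t := by
      have : ContDiff ℝ ∞ fun t : ℝ => ((t - y : ℝ) : ℂ) :=
        Complex.ofRealCLM.contDiff.comp (contDiff_id.sub contDiff_const)
      exact contDiff_const.add ((this.pow _).mul hA)
    have hn := h.norm hAs hI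
    simp only [sub_self, Complex.ofReal_zero, ne_eq, Nat.add_eq_zero_iff, OfNat.ofNat_ne_zero,
      and_false, not_false_eq_true, zero_pow, zero_mul, add_zero, norm_one] at hn
    obtain ⟨q, hq⟩ := exists_one_le_norm_pow_sub_one hn hne
    let X : ℝ → ℂ := fun t => ((t - y : ℝ) : ℂ) ^ (j + 2) * A t
    have hX : ContDiff ℝ ∞ X := by
      simpa [X] using hAs.sub (contDiff_const (c := (1 : ℂ)))
    have ht : ContDiff ℝ ∞ fun t : ℝ => ((t - y : ℝ) : ℂ) :=
      Complex.ofRealCLM.contDiff.comp (contDiff_id.sub contDiff_const)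
    -- Being different from `1` is amplified to distance at least `1` by a power: `(1 + X) ^ q = 1 +
    -- X * ∑ (1 + X) ^ l` is again `1` plus a multiple of `(t - y) ^ (j + 1)`, the spare factor `t -
    -- y` being absorbed in the new `A`.
    refine ⟨fun t => ((t - y : ℝ) : ℂ) * A t * ∑ l ∈ Finset.range q, (1 + X t) ^ l, ?_, ?_⟩
    · exact (ht.mul hA).mul (ContDiff.sum fun l _ => (contDiff_const.add hX).pow l)
    · rw [← h.pow hI hAs] at hq
      convert hq using 4
      funext t
      have := mul_geom_sum (1 + X t) q
      have e1 : (1 + X t) ^ q = 1 + (1 + X t - 1) * ∑ i ∈ Finset.range q, (1 + X t) ^ i := by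
        rw [this]; ring
      have e2 : ((t - y : ℝ) : ℂ) ^ (j + 1) * (((t - y : ℝ) : ℂ) * A t *
        ∑ l ∈ Finset.range q, (1 + X t) ^ l) = (1 + X t - 1) * ∑ i ∈ Finset.range q, (1 + X t) ^ i := by
        simp only [X]; ring
      rw [e2, ← e1]
  obtain ⟨y, hy⟩ := exists_seq_of_frequently_nhdsGT hfreq h.pos
  have hp : ∀ j, 0 < y j := fun j => (hy j).1
  choose A hA hbad using fun j => (hy j).2.2.2
  choose φ hφ hφ0 hφe hφb using fun j => exists_small_flat_cutoff j (y j) (r := y j / 8)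
    (R := y j / 4) (by linarith [hp j]) (by linarith [hp j]) (hA j)
    (show (0 : ℝ) < (1 / 2) ^ j by positivity)
  have hlim := h.tendsto_comp_glue (fun j => (hy j).2.2.1) hp (fun j => (hy j).2.1) hφ
    (fun j t ht => hφ0 j t fun hh => ht ⟨by linarith [hh.1, hp j], by linarith [hh.2, hp j]⟩)
    (fun j i hij x => hφb j i hij x)
    (H := fun z => 1 + z) (contDiff_const.add contDiff_id) (by simp)
  have hev := (tendsto_iff_norm_sub_tendsto_zero.1 hlim).eventually_lt_const one_pos
  obtain ⟨j, hj⟩ := hev.exists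
  have hI : y j ∈ Ioo (-e) e := h.mem ⟨hp j, ((hy j).2.1).trans_le
    (div_le_self h.pos.le (one_le_pow₀ (by norm_num)))⟩
  have := hbad j
  have hs : ContDiff ℝ ∞ fun t : ℝ => 1 + ((t - y j : ℝ) : ℂ) ^ (j + 1) * A j t := by
    have : ContDiff ℝ ∞ fun t : ℝ => ((t - y j : ℝ) : ℂ) :=
      Complex.ofRealCLM.contDiff.comp (contDiff_id.sub contDiff_const)
    exact contDiff_const.add ((this.pow _).mul (hA j))
  rw [h.congr hs (contDiff_const.add (hφ j)) hI] at this
  · exact absurd hj (not_lt.2 this)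
  · filter_upwards [hφe j] with t ht
    rw [ht]

/-- Uniformity in the complex centre `c` is the point. If it failed at `y j → 0`, small multiples `ε
j * (t - c j)`, cut off near `y j`, would glue to one smooth `Φ`; but `S Φ` is `C¹`, hence Lipschitz
near `0`. -/
theorem eventually_lipschitz (h : IsModulusOperator e S) :
    ∀ᶠ y : ℝ in 𝓝[>] 0, ∃ K δ : ℝ, 0 < K ∧ 0 < δ ∧ ∀ c : ℂ, ‖c - y‖ < δ →
      ∀ t₁ ∈ Ioo (y - δ) (y + δ), ∀ t₂ ∈ Ioo (y - δ) (y + δ),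
        ‖S (fun t => (t : ℂ) - c) t₁ - S (fun t => (t : ℂ) - c) t₂‖ ≤ K * |t₁ - t₂| := by
  by_contra hcon
  rw [not_eventually] at hcon
  obtain ⟨y, hy⟩ := exists_seq_of_frequently_nhdsGT
    (fun _ => hcon.and_eventually (Ioo_mem_nhdsGT (show (0 : ℝ) < 1 / 2 by norm_num))) h.pos
  have hp : ∀ j, 0 < y j := fun j => (hy j).1
  have hy1 : ∀ j, y j < 1 / 2 := fun j => (hy j).2.2.2.2.2
  have hI : ∀ j, y j ∈ Ioo (-e) e := fun j => h.mem ⟨hp j, ((hy j).2.1).trans_le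
    (div_le_self h.pos.le (one_le_pow₀ (by norm_num)))⟩
  choose ρ hρ hρc hρ0 hρ1 using fun j => exists_cutoff (y j) (r := y j / 8) (R := y j / 4)
    (by linarith [hp j]) (by linarith [hp j])
  have hψ : ∀ j, ContDiff ℝ ∞ fun t : ℝ => ρ j t * (t : ℂ) :=
    fun j => (hρ j).mul Complex.ofRealCLM.contDiff
  choose C hC hCb using fun j => exists_norm_iteratedFDeriv_le (hψ j)
    ((hρc j).mul_right (f' := fun t : ℝ => (t : ℂ))) j
  choose D hD hDb using fun j => exists_norm_iteratedFDeriv_le (hρ j) (hρc j) j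
  let ε : ℕ → ℝ := fun j => (1 / 2) ^ j / (C j + D j)
  have hε : ∀ j, 0 < ε j := fun j => div_pos (by positivity) (add_pos (hC j) (hD j))
  have hlipc : ∀ j, ∃ L r : ℝ, 0 ≤ L ∧ 0 < r ∧ ∀ t₁ ∈ Ioo (y j - r) (y j + r),
      ∀ t₂ ∈ Ioo (y j - r) (y j + r),
      ‖S (fun _ => (ε j : ℂ)) t₁ - S (fun _ => (ε j : ℂ)) t₂‖ ≤ L * |t₁ - t₂| := by
    intro j
    obtain ⟨L, s, hs, hL⟩ := ((h.contDiffOn (G := fun _ => (ε j : ℂ)) contDiff_const).contDiffAt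
      (Ioo_mem_nhds (hI j).1 (hI j).2)).exists_lipschitzOnWith
    obtain ⟨r, hr, hrs⟩ := Metric.mem_nhds_iff.1 hs
    rw [Real.ball_eq_Ioo] at hrs
    refine ⟨L, r, L.2, hr, fun t₁ h₁ t₂ h₂ => ?_⟩
    simpa [dist_eq_norm] using hL.dist_le_mul _ (hrs h₁) _ (hrs h₂)
  choose L r hL hr hLip using hlipc
  let δ : ℕ → ℝ := fun j => min (r j) (min (y j / 8) (min (e - y j) (1 / 2)))
  have hδ : ∀ j, 0 < δ j := fun j => lt_min (hr j) (lt_min (by linarith [hp j])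
    (lt_min (by linarith [(hI j).2]) (by norm_num)))
  have hδr : ∀ j, δ j ≤ r j := fun j => min_le_left _ _
  have hδy : ∀ j, δ j ≤ y j / 8 := fun j => (min_le_right _ _).trans (min_le_left _ _)
  have hδe : ∀ j, δ j ≤ e - y j := fun j =>
    (min_le_right _ _).trans ((min_le_right _ _).trans (min_le_left _ _))
  have hδ1 : ∀ j, δ j ≤ 1 / 2 := fun j =>
    (min_le_right _ _).trans ((min_le_right _ _).trans (min_le_right _ _))
  -- Near `y j`, `S Φ` is the product of the image of the constant `ε j`, which has modulus `ε j`
  -- and Lipschitz constant `L j`, and the image of `t - c j`, bounded by `1`. The slope `(j + 1 + L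
  -- j) / ε j` therefore survives in `S Φ` as a slope above `j + 1`.
  have bad : ∀ j, ∃ (c : ℂ) (t₁ t₂ : ℝ), ‖c - y j‖ < δ j ∧ t₁ ∈ Ioo (y j - δ j) (y j + δ j) ∧
      t₂ ∈ Ioo (y j - δ j) (y j + δ j) ∧ (j + 1 + L j) / ε j * |t₁ - t₂| <
        ‖S (fun t => (t : ℂ) - c) t₁ - S (fun t => (t : ℂ) - c) t₂‖ := by
    intro j
    have := (hy j).2.2.2.1
    push Not at this
    obtain ⟨c, h1, t₁, h2, t₂, h3, h4⟩ := this ((j + 1 + L j) / ε j) (δ j)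
      (div_pos (by have := hL j; positivity) (hε j)) (hδ j)
    exact ⟨c, t₁, t₂, h1, h2, h3, h4⟩
  choose c t₁ t₂ hc ht₁ ht₂ hb using bad
  have hc1 : ∀ j, ‖c j‖ ≤ 1 := by
    intro j
    have h1 : ‖c j‖ ≤ ‖c j - y j‖ + ‖(y j : ℂ)‖ := by simpa using norm_add_le (c j - y j) (y j : ℂ)
    rw [Complex.norm_real, Real.norm_eq_abs, abs_of_pos (hp j)] at h1
    linarith [hc j, hδ1 j, hy1 j]
  have hle : ∀ i : ℕ, ((i : ℕ) : WithTop ℕ∞) ≤ ∞ := fun i => by exact_mod_cast le_top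
  let φ : ℕ → ℝ → ℂ := fun j t => (ε j) • (ρ j t * (t : ℂ) - c j • ρ j t)
  have hφ : ∀ j, ContDiff ℝ ∞ (φ j) := fun j => ((hψ j).sub ((hρ j).const_smul (c j))).const_smul _
  obtain ⟨Φ, hΦ, hΦ1, -⟩ := exists_glue (fun j => (hy j).2.2.1) hp hφ (fun j t ht => by
      simp [φ, hρ0 j t fun hh => ht ⟨by linarith [hh.1, hp j], by linarith [hh.2, hp j]⟩])
    (fun j i hij x => by
      have e1 : φ j = ε j • ((fun t : ℝ => ρ j t * (t : ℂ)) - c j • ρ j) := rfl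
      have hd : ContDiff ℝ i ((fun t : ℝ => ρ j t * (t : ℂ)) - c j • ρ j) :=
        ((hψ j).sub ((hρ j).const_smul (c j))).of_le (hle i)
      rw [e1, iteratedFDeriv_const_smul_apply hd.contDiffAt,
        iteratedFDeriv_sub_apply ((hψ j).of_le (hle i)).contDiffAt
          (show ContDiffAt ℝ i (c j • ρ j) x from
            (((hρ j).const_smul (c j)).of_le (hle i)).contDiffAt),
        iteratedFDeriv_const_smul_apply ((hρ j).of_le (hle i)).contDiffAt, norm_smul,
        Real.norm_eq_abs, abs_of_pos (hε j)]
      have h1 := hCb j i hij x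
      have h2 := hDb j i hij x
      have h3 : ‖iteratedFDeriv ℝ i (fun t : ℝ => ρ j t * (t : ℂ)) x - c j • iteratedFDeriv ℝ i (ρ j) x‖
          ≤ C j + D j := by
        refine (norm_sub_le _ _).trans (add_le_add h1 ?_)
        rw [norm_smul]
        calc ‖c j‖ * ‖iteratedFDeriv ℝ i (ρ j) x‖ ≤ 1 * D j :=
              mul_le_mul (hc1 j) h2 (norm_nonneg _) zero_le_one
          _ = D j := one_mul _
      calc ε j * _ ≤ ε j * (C j + D j) := mul_le_mul_of_nonneg_left h3 (hε j).le
        _ = (1 / 2) ^ j := div_mul_cancel₀ _ (add_pos (hC j) (hD j)).ne')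
  have hprod : ∀ j, ∀ t ∈ Ioo (y j - δ j) (y j + δ j),
      S Φ t = S (fun _ => (ε j : ℂ)) t * S (fun t => (t : ℂ) - c j) t := by
    intro j t ht
    have h8 := hδy j
    have htI : t ∈ Ioo (-e) e := h.mem ⟨by linarith [ht.1, hp j], by linarith [ht.2, hδe j]⟩
    have hid : ContDiff ℝ ∞ fun t : ℝ => (t : ℂ) - c j :=
      Complex.ofRealCLM.contDiff.sub contDiff_const
    rw [← h.mul contDiff_const hid htI]
    refine h.congr hΦ (contDiff_const.mul hid) htI ?_
    filter_upwards [Ioo_mem_nhds ht.1 ht.2] with x hx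
    rw [hΦ1 j x ⟨by linarith [hx.1, hp j], by linarith [hx.2, hp j]⟩]
    simp only [φ, hρ1 j x ⟨by linarith [hx.1], by linarith [hx.2]⟩, Complex.real_smul, smul_eq_mul]
    ring
  obtain ⟨K, s, hs, hK⟩ := ((h.contDiffOn hΦ).contDiffAt
      (Ioo_mem_nhds (show -e < 0 by linarith [h.pos]) h.pos)).exists_lipschitzOnWith
  obtain ⟨η, hη, hηs⟩ := Metric.mem_nhds_iff.1 hs
  rw [Real.ball_eq_Ioo, zero_sub, zero_add] at hηs
  have hy0 := tendsto_of_lt_div_pow hp fun j => (hy j).2.1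
  obtain ⟨j, hj1, hj2⟩ := ((hy0.eventually_lt_const (show (0 : ℝ) < η / 2 by positivity)).and
    (eventually_ge_atTop ⌈(K : ℝ)⌉₊)).exists
  have hjK : (K : ℝ) ≤ j := (Nat.le_ceil _).trans (by exact_mod_cast hj2)
  have hmem : ∀ t ∈ Ioo (y j - δ j) (y j + δ j), t ∈ s := fun t ht =>
    hηs ⟨by linarith [ht.1, hδy j, hp j], by linarith [ht.2, hδy j, hp j]⟩
  have h1 := hK.dist_le_mul _ (hmem _ (ht₁ j)) _ (hmem _ (ht₂ j))
  rw [dist_eq_norm, Real.dist_eq, hprod j _ (ht₁ j), hprod j _ (ht₂ j)] at h1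
  have hr' : ∀ t ∈ Ioo (y j - δ j) (y j + δ j), t ∈ Ioo (y j - r j) (y j + r j) := fun t ht =>
    ⟨by linarith [ht.1, hδr j], by linarith [ht.2, hδr j]⟩
  have h2 := hLip j _ (hr' _ (ht₁ j)) _ (hr' _ (ht₂ j))
  have hI' : ∀ t ∈ Ioo (y j - δ j) (y j + δ j), t ∈ Ioo (-e) e := fun t ht =>
    h.mem ⟨by linarith [ht.1, hδy j, hp j], by linarith [ht.2, hδe j]⟩
  have h3 : ‖S (fun t => (t : ℂ) - c j) (t₂ j)‖ ≤ 1 := by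
    have hid : ContDiff ℝ ∞ fun t : ℝ => (t : ℂ) - c j :=
      Complex.ofRealCLM.contDiff.sub contDiff_const
    rw [h.norm hid (hI' _ (ht₂ j))]
    have e1 : ((t₂ j : ℂ) - c j : ℂ) = ((t₂ j - y j : ℝ) : ℂ) - (c j - y j) := by
      simp
    rw [e1]
    refine (norm_sub_le _ _).trans ?_
    rw [Complex.norm_real, Real.norm_eq_abs]
    have : |t₂ j - y j| ≤ δ j := abs_le.2 ⟨by linarith [(ht₂ j).1], by linarith [(ht₂ j).2]⟩
    linarith [hc j, hδ1 j]
  have h4 : ‖S (fun _ => (ε j : ℂ)) (t₁ j)‖ = ε j := by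
    rw [h.norm contDiff_const (hI' _ (ht₁ j)), Complex.norm_real, Real.norm_eq_abs,
      abs_of_pos (hε j)]
  set a₁ := S (fun t => (t : ℂ) - c j) (t₁ j)
  set a₂ := S (fun t => (t : ℂ) - c j) (t₂ j)
  set b₁ := S (fun _ => (ε j : ℂ)) (t₁ j)
  set b₂ := S (fun _ => (ε j : ℂ)) (t₂ j)
  have h5 : ε j * ‖a₁ - a₂‖ ≤ K * |t₁ j - t₂ j| + L j * |t₁ j - t₂ j| := by
    calc ε j * ‖a₁ - a₂‖ = ‖(b₁ * a₁ - b₂ * a₂) - (b₁ - b₂) * a₂‖ := by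
          rw [← h4, ← norm_mul]; congr 1; ring
      _ ≤ ‖b₁ * a₁ - b₂ * a₂‖ + ‖b₁ - b₂‖ * ‖a₂‖ := by rw [← norm_mul]; exact norm_sub_le _ _
      _ ≤ K * |t₁ j - t₂ j| + L j * |t₁ j - t₂ j| * 1 := by
          refine add_le_add h1 (mul_le_mul h2 h3 (norm_nonneg _) ?_)
          exact mul_nonneg (hL j) (abs_nonneg _)
      _ = _ := by rw [mul_one]
  have h6 := hb j
  rw [div_mul_eq_mul_div, div_lt_iff₀ (hε j)] at h6
  have : 0 ≤ |t₁ j - t₂ j| := abs_nonneg _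
  nlinarith

end IsModulusOperator

/-! ### The phase as a real-linear functional. -/

theorem eq_of_forall_exp_eq {μ ν : ℝ}
    (h : ∀ s : ℝ, Complex.exp (μ * s * Complex.I) = Complex.exp (ν * s * Complex.I)) : μ = ν :=
  tendsto_nhds_unique tendsto_const_nhds (tendsto_of_forall_tendsto_exp (l := (atTop : Filter ℕ))
    (f := fun _ => μ) fun s => by rw [h s]; exact tendsto_const_nhds)

/-- Local data describing the phase of a modulus operator on `(0, ε)`. -/
structure PhaseData (S : (ℝ → ℂ) → ℝ → ℂ) (ε : ℝ) (N : ℕ) (lam : ℝ → (ℝ → ℂ) → ℝ) : Prop where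
  two_le : 2 ≤ N
  map_exp : ∀ {y}, y ∈ Ioo 0 ε → ∀ {φ : ℝ → ℂ}, ContDiff ℝ ∞ φ →
    S (fun t => Complex.exp (φ t)) y = Real.exp (φ y).re * Complex.exp (lam y φ * Complex.I)
  add : ∀ {y}, y ∈ Ioo 0 ε → ∀ {φ ψ : ℝ → ℂ}, ContDiff ℝ ∞ φ → ContDiff ℝ ∞ ψ →
    lam y (fun t => φ t + ψ t) = lam y φ + lam y ψ
  smul : ∀ {y}, y ∈ Ioo 0 ε → ∀ {φ : ℝ → ℂ}, ContDiff ℝ ∞ φ → ∀ a : ℝ,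
    lam y (fun t => a * φ t) = a * lam y φ
  continuousOn : ∀ {φ : ℝ → ℂ}, ContDiff ℝ ∞ φ → ContinuousOn (fun y => lam y φ) (Ioo 0 ε)
  flat : ∀ {y}, y ∈ Ioo 0 ε → ∀ {A : ℝ → ℂ}, ContDiff ℝ ∞ A →
    S (fun t => 1 + ((t - y : ℝ) : ℂ) ^ N * A t) y = 1
  lipschitz : ∀ {y : ℝ}, y ∈ Ioo 0 ε → ∃ K δ : ℝ, 0 < K ∧ 0 < δ ∧ ∀ c : ℂ, ‖c - y‖ < δ →
      ∀ t₁ ∈ Ioo (y - δ) (y + δ), ∀ t₂ ∈ Ioo (y - δ) (y + δ),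
        ‖S (fun t => (t : ℂ) - c) t₁ - S (fun t => (t : ℂ) - c) t₂‖ ≤ K * |t₁ - t₂|

namespace IsModulusOperator

variable {e : ℝ} {S : (ℝ → ℂ) → ℝ → ℂ}

/-- Dividing by the known modulus makes `s ↦ S (exp (s φ)) y` a one-parameter group of unit complex
numbers, to which `exists_eq_exp_of_eventually` applies. -/
theorem exists_phase (h : IsModulusOperator e S) {y : ℝ} (hy : y ∈ Ioo (-e) e) {φ : ℝ → ℂ}
    (hφ : ContDiff ℝ ∞ φ)
    (hn : ∀ᶠ s : ℝ in 𝓝 0, ‖S (fun t => Complex.exp (s * φ t)) y - 1‖ ≤ 1) :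
    ∃ μ : ℝ, ∀ s : ℝ, S (fun t => Complex.exp (s * φ t)) y =
      Real.exp (s * (φ y).re) * Complex.exp (μ * s * Complex.I) := by
  have hs : ∀ s : ℝ, ContDiff ℝ ∞ fun t => Complex.exp (s * φ t) := fun s => by fun_prop
  let q : ℝ → ℂ := fun s => Real.exp (-(s * (φ y).re)) * S (fun t => Complex.exp (s * φ t)) y
  have hq : ∀ s t, q (s + t) = q s * q t := by
    intro s t
    have := h.mul (hs s) (hs t) hy
    simp only [q]
    have e1 : (fun x => Complex.exp (((s + t : ℝ) : ℂ) * φ x)) =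
      fun x => Complex.exp (s * φ x) * Complex.exp (t * φ x) := by
      funext x; rw [← Complex.exp_add]; push_cast; ring_nf
    rw [e1, this, add_mul, neg_add, Real.exp_add]
    push_cast
    ring
  have hqn : ∀ s, ‖q s‖ = 1 := by
    intro s
    simp only [q]
    rw [norm_mul, h.norm (hs s) hy, Complex.norm_real, Real.norm_eq_abs, Real.abs_exp,
      Complex.norm_exp, ← Real.exp_add]
    simp
  have hq1 : ∀ᶠ s in 𝓝 (0 : ℝ), ‖q s - 1‖ ≤ 5 / 4 := by
    have hc : Tendsto (fun s : ℝ => Real.exp (-(s * (φ y).re))) (𝓝 0) (𝓝 1) := by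
      have : Continuous fun s : ℝ => Real.exp (-(s * (φ y).re)) := by fun_prop
      simpa using this.tendsto 0
    filter_upwards [hn, hc.eventually (Metric.ball_mem_nhds 1 (show (0 : ℝ) < 1 / 8 by norm_num))]
      with s h1 h2
    rw [Real.dist_eq] at h2
    set r := Real.exp (-(s * (φ y).re)) with hr
    have e1 : q s - 1 = r * (S (fun t => Complex.exp (s * φ t)) y - 1) + ((r - 1 : ℝ) : ℂ) := by
      simp only [q, ← hr]; push_cast; ring
    rw [e1]
    refine (norm_add_le _ _).trans ?_
    rw [norm_mul, Complex.norm_real, Complex.norm_real, Real.norm_eq_abs, Real.norm_eq_abs]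
    -- The real factor is within `1/8` of `1`, so the total is at most `9/8 + 1/8 = 5/4`, the
    -- threshold of `exists_eq_exp_of_eventually`.
    have h3 : |r| ≤ 9 / 8 := by
      rw [abs_lt] at h2; rw [abs_le]; constructor <;> linarith [h2.1, h2.2]
    nlinarith [norm_nonneg (S (fun t => Complex.exp (s * φ t)) y - 1), abs_nonneg r]
  obtain ⟨μ, hμ⟩ := exists_eq_exp_of_eventually hq hqn hq1
  refine ⟨μ, fun s => ?_⟩
  rw [← hμ]
  simp only [q]
  rw [← mul_assoc, ← Complex.ofReal_mul, ← Real.exp_add]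
  simp

/-- Since `lam y φ` is the rate of a character in `s`, and not a phase modulo `2π`, it is unique.
Additivity, homogeneity and continuity in `y` are therefore inherited from the characters. -/
theorem exists_phaseData (h : IsModulusOperator e S) :
    ∃ ε N lam, 0 < ε ∧ ε ≤ e ∧ PhaseData S ε N lam := by
  obtain ⟨N, hN, hflat⟩ := h.exists_flat_order
  have hall := (h.eventually_exp_near_one.and hflat).and h.eventually_lipschitz
  rw [(nhdsGT_basis (0 : ℝ)).eventually_iff] at hall
  obtain ⟨ε', hε', hall⟩ := hall
  set ε := min ε' e with hεdef
  have hε : 0 < ε := lt_min hε' h.pos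
  have hεe : ε ≤ e := min_le_right _ _
  have hI : ∀ {y}, y ∈ Ioo 0 ε → y ∈ Ioo (-e) e := fun hy => h.mem ⟨hy.1, hy.2.trans_le hεe⟩
  have hI' : ∀ {y}, y ∈ Ioo 0 ε → y ∈ Ioo 0 ε' := fun hy => ⟨hy.1, hy.2.trans_le (min_le_left _ _)⟩
  have key : ∀ y (φ : ℝ → ℂ), y ∈ Ioo 0 ε → ContDiff ℝ ∞ φ → ∃ μ : ℝ, ∀ s : ℝ,
      S (fun t => Complex.exp (s * φ t)) y =
        Real.exp (s * (φ y).re) * Complex.exp (μ * s * Complex.I) := fun y φ hy hφ =>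
    h.exists_phase (hI hy) hφ ((hall (hI' hy)).1.1 φ hφ)
  choose! lam hlam using key
  have hlam' : ∀ {y} {φ : ℝ → ℂ}, y ∈ Ioo 0 ε → ContDiff ℝ ∞ φ → ∀ s : ℝ,
      Complex.exp (lam y φ * s * Complex.I) =
        Real.exp (-(s * (φ y).re)) * S (fun t => Complex.exp (s * φ t)) y := by
    intro y φ hy hφ s
    rw [hlam y φ hy hφ, ← mul_assoc, ← Complex.ofReal_mul (Real.exp _), ← Real.exp_add]
    simp
  refine ⟨ε, N, lam, hε, hεe, ⟨hN, ?_, ?_, ?_, ?_, fun hy A hA => (hall (hI' hy)).1.2 A hA,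
    fun hy => (hall (hI' hy)).2⟩⟩
  · intro y hy φ hφ
    simpa using hlam y φ hy hφ 1
  · intro y hy φ ψ hφ hψ
    refine eq_of_forall_exp_eq fun s => ?_
    have hs : ∀ {φ : ℝ → ℂ}, ContDiff ℝ ∞ φ → ContDiff ℝ ∞ fun t => Complex.exp (s * φ t) :=
      fun hφ => by fun_prop
    have e1 : (fun x => Complex.exp (s * (φ x + ψ x))) =
      fun x => Complex.exp (s * φ x) * Complex.exp (s * ψ x) := by
      funext x; rw [← Complex.exp_add]; ring_nf
    rw [hlam' hy (hφ.add hψ), e1, h.mul (hs hφ) (hs hψ) (hI hy), Complex.ofReal_add, add_mul,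
      add_mul, Complex.exp_add, hlam' hy hφ, hlam' hy hψ, Complex.add_re, mul_add, neg_add,
      Real.exp_add]
    push_cast
    ring
  · intro y hy φ hφ a
    refine eq_of_forall_exp_eq fun s => ?_
    have haφ : ContDiff ℝ ∞ fun t => (a : ℂ) * φ t := contDiff_const.mul hφ
    have e1 : (fun x => Complex.exp (s * (a * φ x))) =
      fun x => Complex.exp (((s * a : ℝ) : ℂ) * φ x) := by
      funext x; push_cast; ring_nf
    have e2 : ((a * lam y φ : ℝ) : ℂ) * s * Complex.I = lam y φ * (s * a : ℝ) * Complex.I := by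
      push_cast; ring
    rw [hlam' hy haφ, e1, e2, hlam' hy hφ]
    simp [mul_assoc]
  · intro φ hφ y hy
    refine tendsto_of_forall_tendsto_exp fun s => ?_
    have hs : ContDiff ℝ ∞ fun t => Complex.exp (s * φ t) := by fun_prop
    have hc : ContinuousOn (fun y => Real.exp (-(s * (φ y).re)) *
        S (fun t => Complex.exp (s * φ t)) y) (Ioo 0 ε) := by
      refine ContinuousOn.mul ?_ ((h.continuousOn hs).mono fun y hy => hI hy)
      have := hφ.continuous
      exact Continuous.continuousOn (by fun_prop)
    rw [hlam' hy hφ]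
    refine (hc y hy).congr' ?_
    filter_upwards [self_mem_nhdsWithin] with z hz
    rw [hlam' hz hφ]

end IsModulusOperator

/-! ### Taylor coefficients of the phase and their vanishing. -/

theorem contDiff_mul_sub_pow (ζ : ℂ) (z : ℝ) (l : ℕ) :
    ContDiff ℝ ∞ fun t : ℝ => ζ * ((t - z : ℝ) : ℂ) ^ l :=
  contDiff_const.mul ((Complex.ofRealCLM.contDiff.comp (contDiff_id.sub contDiff_const)).pow l)

/-- `1 + κv` agrees with the exponential of its truncated logarithm up to order `N`. -/
theorem exists_one_add_mul_eq_exp_trunc (κ : ℂ) {N : ℕ} (hN : 1 ≤ N) :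
    ∃ A : ℝ → ℂ, ContDiff ℝ ∞ A ∧ ∀ v : ℝ, 1 + κ * v =
      Complex.exp (∑ l ∈ Finset.Ico 1 N, (-1) ^ (l - 1) / l * κ ^ l * (v : ℂ) ^ l) *
        (1 + (v : ℂ) ^ N * A v) := by
  let p : ℂ → ℂ := fun v => ∑ l ∈ Finset.Ico 1 N, (-1) ^ (l - 1) / l * κ ^ l * v ^ l
  let F : ℂ → ℂ := fun v => (1 + κ * v) * Complex.exp (-p v)
  have hp : ∀ v, HasDerivAt p (∑ l ∈ Finset.Ico 1 N, κ * (-(κ * v)) ^ (l - 1)) v := by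
    intro v
    refine (HasDerivAt.fun_sum fun l _ => ((hasDerivAt_pow l v).const_mul
      ((-1) ^ (l - 1) / l * κ ^ l))).congr_deriv ?_
    refine Finset.sum_congr rfl fun l hl => ?_
    have hl1 : 1 ≤ l := (Finset.mem_Ico.1 hl).1
    have hl0 : (l : ℂ) ≠ 0 := by exact_mod_cast (by omega : l ≠ 0)
    obtain ⟨k, rfl⟩ : ∃ k, l = k + 1 := ⟨l - 1, by omega⟩
    simp only [Nat.add_sub_cancel]
    rw [neg_pow (κ * v) k]
    field_simp
    ring
  -- The derivative of `p` is a partial geometric sum for `κ / (1 + κ v)`, so all but one term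
  -- cancel in `F'`. The remaining factor `v ^ (N - 1)` makes `F - 1` vanish to order `N`.
  have hF : ∀ v, HasDerivAt F (v ^ (N - 1) * (κ * (-κ) ^ (N - 1) * Complex.exp (-p v))) v := by
    intro v
    have h1 : HasDerivAt (fun v : ℂ => 1 + κ * v) κ v := by
      simpa using ((hasDerivAt_id v).const_mul κ).const_add 1
    refine (h1.mul (hp v).fun_neg.cexp).congr_deriv ?_
    have h2 : ∑ l ∈ Finset.Ico 1 N, κ * (-(κ * v)) ^ (l - 1) =
        κ * ∑ l ∈ Finset.range (N - 1), (-(κ * v)) ^ l := by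
      rw [← Finset.mul_sum, Finset.sum_Ico_eq_sum_range]
      simp
    have h3 := mul_neg_geom_sum (-(κ * v)) (N - 1)
    rw [h2]
    have h4 : (1 + κ * v) * (Complex.exp (-p v) * -(κ * ∑ l ∈ Finset.range (N - 1), (-(κ * v)) ^ l))
      = -κ * Complex.exp (-p v) *
        ((1 - -(κ * v)) * ∑ l ∈ Finset.range (N - 1), (-(κ * v)) ^ l) := by ring
    rw [h4, h3, ← neg_mul, mul_pow]
    ring
  have hFd : Differentiable ℂ F := fun v => (hF v).differentiableAt
  have hpd : Differentiable ℂ p := fun v => (hp v).differentiableAt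
  have hFa : AnalyticAt ℂ F 0 := hFd.analyticAt 0
  have hp0 : p 0 = 0 := Finset.sum_eq_zero fun l hl => by
    have : l ≠ 0 := by have := (Finset.mem_Ico.1 hl).1; omega
    simp [this]
  have hF0 : F 0 = 1 := by simp [F, hp0]
  have hord : ((N : ℕ) : ℕ∞) ≤ analyticOrderAt (fun v => F v - F 0) 0 := by
    rw [← hFa.analyticOrderAt_deriv_add_one]
    have hd : ((N - 1 : ℕ) : ℕ∞) ≤ analyticOrderAt (deriv F) 0 := by
      rw [natCast_le_analyticOrderAt hFa.deriv]
      refine ⟨fun v => κ * (-κ) ^ (N - 1) * Complex.exp (-p v),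
        (by fun_prop : Differentiable ℂ _).analyticAt 0, Eventually.of_forall fun v => ?_⟩
      rw [(hF v).deriv]
      simp
    calc ((N : ℕ) : ℕ∞) = ((N - 1 : ℕ) : ℕ∞) + 1 := by
          rw [← Nat.cast_one (R := ℕ∞), ← Nat.cast_add, Nat.sub_add_cancel hN]
      _ ≤ _ := by gcongr
  rw [natCast_le_analyticOrderAt (hFa.fun_sub analyticAt_const)] at hord
  obtain ⟨g, hg, hge⟩ := hord
  simp only [sub_zero, smul_eq_mul, hF0] at hge
  -- The analytic quotient `g` is only available near `0`; its value there fills the removable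
  -- singularity of the global quotient.
  let A : ℝ → ℂ := fun v => if v = 0 then g 0 else (F v - 1) / (v : ℂ) ^ N
  have hA0 : A =ᶠ[𝓝 0] fun v : ℝ => g v := by
    have : Tendsto (fun v : ℝ => (v : ℂ)) (𝓝 0) (𝓝 0) := by
      simpa using Complex.continuous_ofReal.tendsto 0
    filter_upwards [this.eventually hge] with v hv
    by_cases h0 : v = 0
    · simp [A, h0]
    · have : (v : ℂ) ≠ 0 := by exact_mod_cast h0
      simp only [A, h0, if_false, hv]
      field_simp
  have hA : ContDiff ℝ ∞ A := by
    rw [contDiff_iff_contDiffAt]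
    intro v
    by_cases h0 : v = 0
    · subst h0
      refine ContDiffAt.congr_of_eventuallyEq ?_ hA0
      have h1 : ContDiffAt ℂ ∞ g ((0 : ℝ) : ℂ) := by simpa using hg.contDiffAt
      exact (h1.restrict_scalars ℝ).comp (0 : ℝ) Complex.ofRealCLM.contDiff.contDiffAt
    · have hv : (v : ℂ) ≠ 0 := by exact_mod_cast h0
      have e1 : A =ᶠ[𝓝 v] fun v : ℝ => (F v - 1) / (v : ℂ) ^ N := by
        filter_upwards [isOpen_ne.mem_nhds h0] with x hx
        simp only [A, if_neg (show x ≠ 0 from hx)]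
      refine ContDiffAt.congr_of_eventuallyEq ?_ e1
      have h1 : ContDiffAt ℂ ∞ (fun v : ℂ => (F v - 1) / v ^ N) ((v : ℝ) : ℂ) :=
        (hFd.contDiff.contDiffAt.sub contDiffAt_const).div (contDiffAt_id.pow N) (pow_ne_zero _ hv)
      exact (h1.restrict_scalars ℝ).comp v Complex.ofRealCLM.contDiff.contDiffAt
  refine ⟨A, hA, fun v => ?_⟩
  have hFA : F v = 1 + (v : ℂ) ^ N * A v := by
    by_cases h0 : v = 0
    · have : N ≠ 0 := by omega
      simp [h0, hF0, this]
    · have hv : (v : ℂ) ≠ 0 := by exact_mod_cast h0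
      simp only [A, if_neg h0]
      field_simp
      ring
  rw [← hFA]
  simp only [F]
  rw [mul_left_comm, ← Complex.exp_add]
  simp [p]

namespace PhaseData

variable {S : (ℝ → ℂ) → ℝ → ℂ} {ε e : ℝ} {N : ℕ} {lam : ℝ → (ℝ → ℂ) → ℝ}

/-- The coefficient functional of `(t - z) ^ l` at `z`. -/
noncomputable def coeff (lam : ℝ → (ℝ → ℂ) → ℝ) (l : ℕ) (z : ℝ) (ζ : ℂ) : ℝ :=
  lam z fun t => ζ * ((t - z : ℝ) : ℂ) ^ l

theorem coeff_eq (h : PhaseData S ε N lam) (l : ℕ) {z : ℝ} (hz : z ∈ Ioo 0 ε) (ζ : ℂ) :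
    coeff lam l z ζ = ζ.re * coeff lam l z 1 + ζ.im * coeff lam l z Complex.I := by
  simp only [coeff]
  rw [← h.smul hz (contDiff_mul_sub_pow 1 z l), ← h.smul hz (contDiff_mul_sub_pow Complex.I z l),
    ← h.add hz (contDiff_const.mul (contDiff_mul_sub_pow 1 z l))
      (contDiff_const.mul (contDiff_mul_sub_pow Complex.I z l))]
  congr 1
  funext t
  rw [← mul_assoc, ← mul_assoc, ← add_mul, mul_one, Complex.re_add_im]

theorem lam_sum (h : PhaseData S ε N lam) {z : ℝ} (hz : z ∈ Ioo 0 ε) {ι : Type*} (s : Finset ι)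
    {φ : ι → ℝ → ℂ} (hφ : ∀ i ∈ s, ContDiff ℝ ∞ (φ i)) :
    lam z (fun t => ∑ i ∈ s, φ i t) = ∑ i ∈ s, lam z (φ i) := by
  classical
  induction s using Finset.induction_on with
  | empty =>
    have := h.smul hz (φ := fun _ => 0) contDiff_const 0
    simpa using this
  | insert a s ha ih =>
    simp only [Finset.sum_insert ha]
    rw [h.add hz (hφ a (Finset.mem_insert_self _ _))
      (ContDiff.sum fun i hi => hφ i (Finset.mem_insert_of_mem hi)),
      ih fun i hi => hφ i (Finset.mem_insert_of_mem hi)]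

/-- The test function `(t - z) ^ l` itself moves with `z`; binomial expansion reduces to fixed test
functions `t ^ i` with coefficients polynomial in `z`. -/
theorem continuousOn_coeff (h : PhaseData S ε N lam) (l : ℕ) (ζ : ℂ) :
    ContinuousOn (fun z => coeff lam l z ζ) (Ioo 0 ε) := by
  have hs : ∀ i : ℕ, ContDiff ℝ ∞ fun t : ℝ => ζ * (t : ℂ) ^ i := fun i =>
    contDiff_const.mul (Complex.ofRealCLM.contDiff.pow i)
  have e1 : EqOn (fun z => coeff lam l z ζ) (fun z => ∑ i ∈ Finset.range (l + 1),
      ((-z) ^ (l - i) * (l.choose i : ℝ)) * lam z fun t => ζ * (t : ℂ) ^ i) (Ioo 0 ε) := by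
    intro z hz
    simp only [coeff]
    have e2 : (fun t : ℝ => ζ * ((t - z : ℝ) : ℂ) ^ l) = fun t : ℝ => ∑ i ∈ Finset.range (l + 1),
        (((-z) ^ (l - i) * (l.choose i : ℝ) : ℝ) : ℂ) * (ζ * (t : ℂ) ^ i) := by
      funext t
      rw [sub_eq_add_neg, Complex.ofReal_add, add_pow, Finset.mul_sum]
      refine Finset.sum_congr rfl fun i _ => ?_
      push_cast
      ring
    rw [e2, h.lam_sum hz _ fun i _ => contDiff_const.mul (hs i)]
    exact Finset.sum_congr rfl fun i _ => h.smul hz (hs i) _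
  refine ContinuousOn.congr ?_ e1
  refine continuousOn_finsetSum _ fun i _ => ContinuousOn.mul ?_ (h.continuousOn (hs i))
  exact Continuous.continuousOn (by fun_prop)

/-- The value of the operator on `t ↦ t - c`. -/
theorem map_sub_const (h : PhaseData S ε N lam) (hS : IsModulusOperator e S) (hεe : ε ≤ e) {z : ℝ}
    (hz : z ∈ Ioo 0 ε) {c w : ℂ} (hw : w ≠ 0) (hc : (z : ℂ) - c = w) :
    S (fun t => (t : ℂ) - c) z = ‖w‖ * Complex.exp ((coeff lam 0 z (Complex.log w) +
      ∑ l ∈ Finset.Ico 1 N, coeff lam l z ((-1) ^ (l - 1) / l * (w ^ l)⁻¹) : ℝ) * Complex.I) := by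
  have hI : z ∈ Ioo (-e) e := hS.mem ⟨hz.1, hz.2.trans_le hεe⟩
  have hN : 1 ≤ N := by have := h.two_le; omega
  obtain ⟨A, hA, hAe⟩ := exists_one_add_mul_eq_exp_trunc w⁻¹ hN
  have hshift : ContDiff ℝ ∞ fun t : ℝ => A (t - z) := hA.comp (contDiff_id.sub contDiff_const)
  let P : ℝ → ℂ := fun t => ∑ l ∈ Finset.Ico 1 N,
    ((-1) ^ (l - 1) / l * w⁻¹ ^ l) * ((t - z : ℝ) : ℂ) ^ l
  have hP : ContDiff ℝ ∞ P := ContDiff.sum fun l _ => contDiff_mul_sub_pow _ z l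
  have hE : ContDiff ℝ ∞ fun t => Complex.exp (P t) := hP.cexp
  have hW : ContDiff ℝ ∞ fun t : ℝ => 1 + ((t - z : ℝ) : ℂ) ^ N * A (t - z) := by
    have := (contDiff_mul_sub_pow 1 z N).mul hshift
    simp only [one_mul] at this
    exact contDiff_const.add this
  -- The factorization is `t - c = w * (1 + (t - z) / w)`, with the second factor replaced by the
  -- exponential of its truncated logarithm times a flat factor. The flat factor has image `1` at
  -- `z`.
  have e1 : (fun t : ℝ => (t : ℂ) - c) = fun t => Complex.exp (Complex.log w) *
      (Complex.exp (P t) * (1 + ((t - z : ℝ) : ℂ) ^ N * A (t - z))) := by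
    funext t
    rw [← hAe (t - z), Complex.exp_log hw, mul_add, mul_one, ← mul_assoc, mul_inv_cancel₀ hw, ← hc]
    push_cast
    ring
  have hPz : P z = 0 := Finset.sum_eq_zero fun l hl => by
    have : l ≠ 0 := by have := (Finset.mem_Ico.1 hl).1; omega
    simp [this]
  rw [e1, hS.mul contDiff_const (hE.mul hW) hI, hS.mul hE hW hI, h.flat hz hshift,
    h.map_exp hz hP, h.map_exp hz (contDiff_const (c := Complex.log w)), hPz, mul_one,
    Complex.log_re, Real.exp_log (norm_pos_iff.2 hw)]
  have e2 : lam z P = ∑ l ∈ Finset.Ico 1 N, coeff lam l z ((-1) ^ (l - 1) / l * (w ^ l)⁻¹) := by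
    simp only [P]
    rw [h.lam_sum hz _ fun l _ => contDiff_mul_sub_pow _ z l]
    simp only [coeff, inv_pow]
  have e3 : lam z (fun _ => Complex.log w) = coeff lam 0 z (Complex.log w) := by
    simp [coeff]
  rw [e2, e3]
  simp only [Complex.zero_re, Real.exp_zero, Complex.ofReal_one, one_mul, Complex.ofReal_add, add_mul,
    Complex.exp_add]
  ring

end PhaseData

/-- A real-linear functional that is constant along `τ ↦ (τ + i)⁻ᵐ`, `m ≥ 1`, vanishes. -/
theorem eq_zero_of_const_on_inv_pow {L : ℂ →L[ℝ] ℝ} {m : ℕ} (hm : 1 ≤ m) {r : ℝ} (hr : 0 < r)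
    {a : ℂ} (ha : a ≠ 0) {d : ℝ}
    (h : ∀ τ ∈ Ioo 0 r, L (a * (((τ : ℂ) + Complex.I) ^ m)⁻¹) = d) : L = 0 := by
  have hne : ∀ τ : ℝ, (τ : ℂ) + Complex.I ≠ 0 := fun τ h0 => by
    simpa using congrArg Complex.im h0
  have step : ∀ (m : ℤ) (a : ℂ) (d : ℝ),
      (∀ τ ∈ Ioo 0 r, L (a * ((τ : ℂ) + Complex.I) ^ m) = d) →
      ∀ τ ∈ Ioo 0 r, L ((a * m) * ((τ : ℂ) + Complex.I) ^ (m - 1)) = 0 := by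
    intro m a d h τ hτ
    have h1 : HasDerivAt (fun τ : ℝ => a * ((τ : ℂ) + Complex.I) ^ m)
        (a * (m * ((τ : ℂ) + Complex.I) ^ (m - 1))) τ := by
      have h2 : HasDerivAt (fun τ : ℝ => (τ : ℂ) + Complex.I) 1 τ :=
        (Complex.ofRealCLM.hasDerivAt (x := τ)).add_const _
      have h3 := (hasDerivAt_zpow m ((τ : ℂ) + Complex.I) (Or.inl (hne τ))).comp_of_eq τ h2 rfl
      simpa using h3.const_mul a
    have h4 : HasDerivAt (fun τ : ℝ => L (a * ((τ : ℂ) + Complex.I) ^ m))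
        (L (a * (m * ((τ : ℂ) + Complex.I) ^ (m - 1)))) τ :=
      L.hasFDerivAt.comp_hasDerivAt τ h1
    have h5 : HasDerivAt (fun τ : ℝ => L (a * ((τ : ℂ) + Complex.I) ^ m)) 0 τ := by
      refine (hasDerivAt_const τ d).congr_of_eventuallyEq ?_
      filter_upwards [Ioo_mem_nhds hτ.1 hτ.2] with x hx using h x hx
    rw [mul_assoc]
    exact h4.unique h5
  -- The first and second derivatives of the curve both lie in the kernel of `L`. Up to real factors
  -- their quotient is `τ + i`, which is not real, so they span `ℂ` over `ℝ`.
  have h1 := step (-(m : ℤ)) a d (fun τ hτ => by rw [zpow_neg, zpow_natCast]; exact h τ hτ)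
  have h2 := step _ _ 0 h1
  have hτ : r / 2 ∈ Ioo 0 r := ⟨by positivity, by linarith⟩
  have h3 := h1 _ hτ
  have h4 := h2 _ hτ
  set z : ℂ := ((r / 2 : ℝ) : ℂ) + Complex.I with hz
  have hz0 : z ≠ 0 := hne _
  set w : ℂ := a * ((-(m : ℤ) : ℤ) : ℂ) * z ^ (-(m : ℤ) - 1 - 1) with hw
  have hm0 : ((m : ℤ) : ℂ) ≠ 0 := by exact_mod_cast (by omega : m ≠ 0)
  have hw0 : w ≠ 0 := by
    refine mul_ne_zero (mul_ne_zero ha ?_) (zpow_ne_zero _ hz0)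
    push_cast
    exact neg_ne_zero.2 (by exact_mod_cast (by omega : m ≠ 0))
  have e1 : a * ((-(m : ℤ) : ℤ) : ℂ) * z ^ (-(m : ℤ) - 1) = (r / 2) • w + Complex.I * w := by
    rw [hw, zpow_sub_one₀ hz0 (-(m : ℤ) - 1), Complex.real_smul, ← add_mul, ← hz]
    field_simp
  have e2 : a * ((-(m : ℤ) : ℤ) : ℂ) * ((-(m : ℤ) - 1 : ℤ) : ℂ) * z ^ (-(m : ℤ) - 1 - 1)
      = (-(m : ℝ) - 1) • w := by
    rw [hw, Complex.real_smul]; push_cast; ring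
  rw [e2, map_smul, smul_eq_mul, mul_eq_zero] at h4
  have hLw : L w = 0 := by
    rcases h4 with h4 | h4
    · exfalso
      have : (0 : ℝ) ≤ m := Nat.cast_nonneg m
      linarith
    · exact h4
  rw [e1, map_add, map_smul, hLw, smul_zero, zero_add] at h3
  clear_value w
  ext v
  have : v = (v / w).re • w + (v / w).im • (Complex.I * w) := by
    rw [Complex.real_smul, Complex.real_smul, ← mul_assoc, ← add_mul, Complex.re_add_im,
      div_mul_cancel₀ _ hw0]
  rw [this, map_add, map_smul, map_smul, hLw, h3]
  simp

namespace PhaseData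

variable {S : (ℝ → ℂ) → ℝ → ℂ} {ε e : ℝ} {N : ℕ} {lam : ℝ → (ℝ → ℂ) → ℝ}

theorem norm_add_I_ge (τ : ℝ) : 1 ≤ ‖(τ : ℂ) + Complex.I‖ := by
  have := Complex.abs_im_le_norm ((τ : ℂ) + Complex.I)
  simpa using this

theorem add_I_ne_zero (τ : ℝ) : (τ : ℂ) + Complex.I ≠ 0 :=
  norm_pos_iff.1 (zero_lt_one.trans_le (norm_add_I_ge τ))

/-- Opposite phases give the largest possible distance; against the Lipschitz bound this limits how
far a phase can turn. -/
theorem norm_mul_exp_add_norm_of_opposite {a b x y : ℝ} (ha : 0 ≤ a) (hb : 0 ≤ b)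
    (h : |x - y| = Real.pi) :
    ‖(a : ℂ) * Complex.exp (x * Complex.I) - b * Complex.exp (y * Complex.I)‖ = a + b := by
  have e1 : Complex.exp (x * Complex.I) = -Complex.exp (y * Complex.I) := by
    rcases (abs_eq Real.pi_pos.le).1 h with h | h
    · rw [show x = y + Real.pi by linarith, Complex.ofReal_add, add_mul, Complex.exp_add,
        Complex.exp_pi_mul_I, mul_neg_one]
    · rw [show x = y - Real.pi by linarith, Complex.ofReal_sub, sub_mul, Complex.exp_sub,
        Complex.exp_pi_mul_I, div_neg, div_one]
  have e2 : (a : ℂ) * Complex.exp (x * Complex.I) - b * Complex.exp (y * Complex.I) =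
      -(((a + b : ℝ) : ℂ) * Complex.exp (y * Complex.I)) := by
    rw [e1]; push_cast; ring
  rw [e2, norm_neg, norm_mul, Complex.norm_exp_ofReal_mul_I, Complex.norm_real, Real.norm_eq_abs,
    abs_of_nonneg (by positivity), mul_one]

/-- The phase of the operator on `t - (y - is)` at the point `y + sτ`. -/
noncomputable def scaledPhase (lam : ℝ → (ℝ → ℂ) → ℝ) (m : ℕ) (y s τ : ℝ) : ℝ :=
  coeff lam 0 (y + s * τ) (Complex.log (s * ((τ : ℂ) + Complex.I))) +
    ∑ l ∈ Finset.Ico 1 (m + 1),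
      coeff lam l (y + s * τ) ((-1) ^ (l - 1) / l * ((s * ((τ : ℂ) + Complex.I)) ^ l)⁻¹)

/-- With centre `y - is` and point `y + sτ` the increment is `s (τ + i)`: it scales with `s` and
never vanishes. Only orders up to `m` enter the phase, because the higher coefficients are assumed
to vanish. -/
theorem map_sub_scaled (h : PhaseData S ε N lam) (hS : IsModulusOperator e S) (hεe : ε ≤ e) {m : ℕ}
    (hmN : m < N)
    (hv : ∀ l, m < l → l < N → ∀ z ∈ Ioo 0 ε, ∀ ζ, coeff lam l z ζ = 0) {y s τ : ℝ} (hs : 0 < s)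
    (hz : y + s * τ ∈ Ioo 0 ε) :
    S (fun t => (t : ℂ) - (y - s * Complex.I)) (y + s * τ) =
      ((s * ‖(τ : ℂ) + Complex.I‖ : ℝ) : ℂ) *
        Complex.exp (scaledPhase lam m y s τ * Complex.I) := by
  have hs' : (s : ℂ) ≠ 0 := by exact_mod_cast hs.ne'
  rw [h.map_sub_const hS hεe hz (w := s * ((τ : ℂ) + Complex.I))
    (mul_ne_zero hs' (add_I_ne_zero τ)) (by push_cast; ring), norm_mul, Complex.norm_real,
    Real.norm_eq_abs, abs_of_pos hs, scaledPhase]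
  congr 5
  symm
  refine Finset.sum_subset (Finset.Ico_subset_Ico_right hmN) fun l hl hl' => ?_
  rw [Finset.mem_Ico] at hl hl'
  exact hv l (by omega) hl.2 _ hz _

theorem scaledPhase_eq (h : PhaseData S ε N lam) (m : ℕ) {y s τ : ℝ} (hs : 0 < s)
    (hz : y + s * τ ∈ Ioo 0 ε) :
    scaledPhase lam m y s τ =
      ((Real.log s + (Complex.log ((τ : ℂ) + Complex.I)).re) * coeff lam 0 (y + s * τ) 1 +
        (Complex.log ((τ : ℂ) + Complex.I)).im * coeff lam 0 (y + s * τ) Complex.I) +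
      ∑ l ∈ Finset.Ico 1 (m + 1), (s ^ l)⁻¹ *
        (((-1) ^ (l - 1) / l * (((τ : ℂ) + Complex.I) ^ l)⁻¹).re * coeff lam l (y + s * τ) 1 +
        ((-1) ^ (l - 1) / l * (((τ : ℂ) + Complex.I) ^ l)⁻¹).im *
          coeff lam l (y + s * τ) Complex.I) := by
  rw [scaledPhase, h.coeff_eq 0 hz, Complex.log_ofReal_mul hs (add_I_ne_zero τ)]
  congr 1
  · simp
  · refine Finset.sum_congr rfl fun l _ => ?_
    have e1 : (-1) ^ (l - 1) / (l : ℂ) * ((s * ((τ : ℂ) + Complex.I)) ^ l)⁻¹ =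
        (((s ^ l)⁻¹ : ℝ) : ℂ) * ((-1) ^ (l - 1) / l * (((τ : ℂ) + Complex.I) ^ l)⁻¹) := by
      rw [mul_pow, mul_inv]; push_cast; ring
    rw [h.coeff_eq l hz, e1, Complex.re_ofReal_mul, Complex.im_ofReal_mul]
    ring

theorem continuousOn_scaledPhase (h : PhaseData S ε N lam) (m : ℕ) {y s r : ℝ} (hs : 0 < s)
    (hz : ∀ τ ∈ Icc 0 r, y + s * τ ∈ Ioo 0 ε) :
    ContinuousOn (scaledPhase lam m y s) (Icc 0 r) := by
  have hc : ∀ l ζ, ContinuousOn (fun τ => coeff lam l (y + s * τ) ζ) (Icc 0 r) := fun l ζ =>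
    (h.continuousOn_coeff l ζ).comp (Continuous.continuousOn (by fun_prop)) hz
  have hlog : Continuous fun τ : ℝ => Complex.log ((τ : ℂ) + Complex.I) :=
    Continuous.clog (by fun_prop) fun τ => Or.inr (by simp)
  have hinv : ∀ l : ℕ, Continuous fun τ : ℝ => (((τ : ℂ) + Complex.I) ^ l)⁻¹ := fun l =>
    Continuous.inv₀ (by fun_prop) fun τ => pow_ne_zero _ (add_I_ne_zero τ)
  refine ContinuousOn.congr ?_ fun τ hτ => h.scaledPhase_eq m hs (hz τ hτ)
  have hre := Complex.continuous_re
  have him := Complex.continuous_im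
  refine ContinuousOn.add (ContinuousOn.add (ContinuousOn.mul ?_ (hc 0 1))
    (ContinuousOn.mul ?_ (hc 0 Complex.I))) (continuousOn_finsetSum _ fun l _ =>
    continuousOn_const.mul (ContinuousOn.add (ContinuousOn.mul ?_ (hc l 1))
      (ContinuousOn.mul ?_ (hc l Complex.I))))
  · exact (continuous_const.add (hre.comp hlog)).continuousOn
  · exact (him.comp hlog).continuousOn
  · exact (hre.comp (continuous_const.mul (hinv l))).continuousOn
  · exact (him.comp (continuous_const.mul (hinv l))).continuousOn

/-- The order `m` term carries `s⁻ᵐ`; the lower orders and the `log s` term are negligible after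
multiplication by `s ^ m`. -/
theorem tendsto_pow_mul_scaledPhase (h : PhaseData S ε N lam) {m : ℕ} (hm : 1 ≤ m) {y : ℝ}
    (hy : y ∈ Ioo 0 ε) (τ : ℝ) :
    Tendsto (fun s => s ^ m * scaledPhase lam m y s τ) (𝓝[>] 0)
      (𝓝 (coeff lam m y ((-1) ^ (m - 1) / m * (((τ : ℂ) + Complex.I) ^ m)⁻¹))) := by
  have hlin : Tendsto (fun s : ℝ => y + s * τ) (𝓝[>] 0) (𝓝 y) := by
    have : Continuous fun s : ℝ => y + s * τ := by fun_prop
    simpa using (this.tendsto 0).mono_left (nhdsWithin_le_nhds (s := Ioi 0))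
  have hc : ∀ l ζ, Tendsto (fun s => coeff lam l (y + s * τ) ζ) (𝓝[>] 0) (𝓝 (coeff lam l y ζ)) :=
    fun l ζ => ((h.continuousOn_coeff l ζ).continuousAt (Ioo_mem_nhds hy.1 hy.2)).tendsto.comp hlin
  have hpow : ∀ k : ℕ, 1 ≤ k → Tendsto (fun s : ℝ => s ^ k) (𝓝[>] 0) (𝓝 0) := fun k hk => by
    have : Continuous fun s : ℝ => s ^ k := by fun_prop
    have h2 := (this.tendsto 0).mono_left (nhdsWithin_le_nhds (s := Ioi 0))
    simpa [show k ≠ 0 by omega] using h2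
  have hlogs : Tendsto (fun s : ℝ => s ^ m * Real.log s) (𝓝[>] 0) (𝓝 0) := by
    have := tendsto_log_mul_rpow_nhdsGT_zero (r := m) (by exact_mod_cast hm)
    refine this.congr fun s => ?_
    rw [Real.rpow_natCast, mul_comm]
  set C := Complex.log ((τ : ℂ) + Complex.I)
  let g : ℕ → ℂ := fun l => (-1) ^ (l - 1) / l * (((τ : ℂ) + Complex.I) ^ l)⁻¹
  have h0 : Tendsto (fun s : ℝ => (s ^ m * Real.log s + s ^ m * C.re) * coeff lam 0 (y + s * τ) 1 +
      s ^ m * (C.im * coeff lam 0 (y + s * τ) Complex.I)) (𝓝[>] 0) (𝓝 0) := by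
    have := ((hlogs.add ((hpow m hm).mul_const C.re)).mul (hc 0 1)).add
      ((hpow m hm).mul ((hc 0 Complex.I).const_mul C.im))
    simpa using this
  have hterm : ∀ l ∈ Finset.Ico 1 (m + 1), Tendsto (fun s : ℝ => s ^ (m - l) *
      ((g l).re * coeff lam l (y + s * τ) 1 + (g l).im * coeff lam l (y + s * τ) Complex.I))
      (𝓝[>] 0) (𝓝 (if l = m then coeff lam m y (g m) else 0)) := by
    intro l hl
    have hl := Finset.mem_Ico.1 hl
    have h1 := ((hc l 1).const_mul (g l).re).add ((hc l Complex.I).const_mul (g l).im)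
    split_ifs with hlm
    · subst hlm
      simp only [Nat.sub_self, pow_zero, one_mul]
      rw [h.coeff_eq l hy]
      exact h1
    · simpa using (hpow (m - l) (by omega)).mul h1
  have hsum := h0.add (tendsto_finsetSum _ hterm)
  rw [zero_add, Finset.sum_ite_eq' (Finset.Ico 1 (m + 1)) m,
    if_pos (Finset.mem_Ico.2 ⟨hm, Nat.lt_succ_self m⟩)] at hsum
  refine hsum.congr' ?_
  filter_upwards [self_mem_nhdsWithin, hlin (Ioo_mem_nhds hy.1 hy.2)] with s hs hz
  have hs : 0 < s := hs
  rw [h.scaledPhase_eq m hs hz, mul_add, Finset.mul_sum]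
  congr 1
  · ring
  · refine Finset.sum_congr rfl fun l hl => ?_
    have hl := Finset.mem_Ico.1 hl
    have e1 : s ^ m = s ^ (m - l) * s ^ l := by rw [← pow_add]; congr 1; omega
    rw [e1, mul_assoc, mul_inv_cancel_left₀ (pow_ne_zero _ hs.ne')]

/-- As `τ` runs over a fixed interval `[0, r]` the phase cannot turn by more than `π`: otherwise two
values of modulus at least `s` would be opposite, too far apart for the Lipschitz bound. Multiplying
by `s ^ m` and letting `s → 0`, the order `m` functional is constant along `τ ↦ (τ + i)⁻ᵐ`, hence
zero. -/
theorem coeff_eq_zero_step (h : PhaseData S ε N lam) (hS : IsModulusOperator e S) (hεe : ε ≤ e)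
    {m : ℕ} (hm : 1 ≤ m) (hmN : m < N)
    (hv : ∀ l, m < l → l < N → ∀ z ∈ Ioo 0 ε, ∀ ζ, coeff lam l z ζ = 0) {y : ℝ}
    (hy : y ∈ Ioo 0 ε) (ζ : ℂ) : coeff lam m y ζ = 0 := by
  obtain ⟨K, δ, hK, hδ, hLip⟩ := h.lipschitz hy
  -- With `K * r ≤ 1` the Lipschitz bound over a step `sτ` is at most `s`, whereas opposite values
  -- would be at least `2s` apart.
  set r := min 1 (1 / K) with hr
  have hr0 : 0 < r := by positivity
  have hr1 : r ≤ 1 := min_le_left _ _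
  have hrK : K * r ≤ 1 := by
    have : r ≤ 1 / K := min_le_right _ _
    rwa [le_div_iff₀ hK, mul_comm] at this
  have hbound : ∀ s ∈ Ioo 0 (min δ (ε - y)), ∀ τ ∈ Icc 0 r,
      |scaledPhase lam m y s τ - scaledPhase lam m y s 0| ≤ Real.pi := by
    intro s hs τ hτ
    have hs0 : 0 < s := hs.1
    have hsδ : s < δ := hs.2.trans_le (min_le_left _ _)
    have hsε : s < ε - y := hs.2.trans_le (min_le_right _ _)
    have hsτ : ∀ τ ∈ Icc 0 r, 0 ≤ s * τ ∧ s * τ ≤ s := fun τ hτ =>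
      ⟨mul_nonneg hs0.le hτ.1, by nlinarith [hτ.2]⟩
    have hz : ∀ τ ∈ Icc 0 r, y + s * τ ∈ Ioo 0 ε := fun τ hτ => by
      have := hsτ τ hτ
      exact ⟨by linarith [hy.1], by linarith⟩
    by_contra! hcon
    have hcont : ContinuousOn (fun τ => |scaledPhase lam m y s τ - scaledPhase lam m y s 0|)
        (Icc 0 τ) := (((h.continuousOn_scaledPhase m hs0 hz).mono
          (Icc_subset_Icc_right hτ.2)).sub continuousOn_const).abs
    obtain ⟨τ', hτ', hval⟩ := intermediate_value_Icc hτ.1 hcont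
      (show Real.pi ∈ Icc _ _ from ⟨by simpa using Real.pi_pos.le, hcon.le⟩)
    have hτr : τ' ∈ Icc 0 r := ⟨hτ'.1, hτ'.2.trans hτ.2⟩
    have h0r : (0 : ℝ) ∈ Icc 0 r := ⟨le_rfl, hr0.le⟩
    have e1 := h.map_sub_scaled hS hεe hmN hv hs0 (hz τ' hτr)
    have e2 := h.map_sub_scaled hS hεe hmN hv hs0 (hz 0 h0r)
    have hl := hLip (y - s * Complex.I) (by simpa [abs_of_pos hs0] using hsδ) (y + s * τ')
      ⟨by linarith [hsτ τ' hτr], by linarith [hsτ τ' hτr]⟩ (y + s * 0)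
      ⟨by linarith, by linarith⟩
    rw [e1, e2, norm_mul_exp_add_norm_of_opposite (by positivity) (by positivity) hval] at hl
    have h1 := mul_le_mul_of_nonneg_left (norm_add_I_ge τ') hs0.le
    have h2 := mul_le_mul_of_nonneg_left (norm_add_I_ge 0) hs0.le
    have h3 : K * |y + s * τ' - (y + s * 0)| ≤ s := by
      rw [show y + s * τ' - (y + s * 0) = s * τ' by ring, abs_of_nonneg (hsτ τ' hτr).1]
      have : K * τ' ≤ K * r := mul_le_mul_of_nonneg_left hτr.2 hK.le
      nlinarith
    linarith
  have hconst : ∀ τ ∈ Ioo 0 r, coeff lam m y ((-1) ^ (m - 1) / m * (((τ : ℂ) + Complex.I) ^ m)⁻¹) =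
      coeff lam m y ((-1) ^ (m - 1) / m * ((((0 : ℝ) : ℂ) + Complex.I) ^ m)⁻¹) := by
    intro τ hτ
    have h1 := (h.tendsto_pow_mul_scaledPhase hm hy τ).sub (h.tendsto_pow_mul_scaledPhase hm hy 0)
    have h2 : Tendsto (fun s => s ^ m * scaledPhase lam m y s τ - s ^ m * scaledPhase lam m y s 0)
        (𝓝[>] 0) (𝓝 0) := by
      have hpow : Tendsto (fun s : ℝ => s ^ m * Real.pi) (𝓝[>] 0) (𝓝 0) := by
        have : Continuous fun s : ℝ => s ^ m * Real.pi := by fun_prop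
        have h2 := (this.tendsto 0).mono_left (nhdsWithin_le_nhds (s := Ioi 0))
        simpa [show m ≠ 0 by omega] using h2
      refine squeeze_zero_norm' ?_ hpow
      have hpos : 0 < min δ (ε - y) := lt_min hδ (by linarith [hy.2])
      filter_upwards [Ioo_mem_nhdsGT hpos] with s hs
      have hs0 : 0 < s := hs.1
      rw [← mul_sub, norm_mul, Real.norm_eq_abs, Real.norm_eq_abs, abs_of_pos (by positivity)]
      exact mul_le_mul_of_nonneg_left (hbound s hs τ ⟨hτ.1.le, hτ.2.le⟩) (by positivity)
    exact sub_eq_zero.1 (tendsto_nhds_unique h1 h2)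
  let L : ℂ →L[ℝ] ℝ := coeff lam m y 1 • Complex.reCLM + coeff lam m y Complex.I • Complex.imCLM
  have hL : ∀ ζ, coeff lam m y ζ = L ζ := fun ζ => by
    rw [h.coeff_eq m hy]; simp [L, mul_comm]
  have ha : (-1 : ℂ) ^ (m - 1) / m ≠ 0 :=
    div_ne_zero (pow_ne_zero _ (by norm_num)) (by exact_mod_cast (by omega : m ≠ 0))
  have := eq_zero_of_const_on_inv_pow (L := L) hm hr0 ha fun τ hτ => by
    rw [← hL]; exact hconst τ hτ
  rw [hL, this]
  rfl

/-- The induction descends from `N - 1`, since each step needs the vanishing of all higher orders.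
-/
theorem coeff_eq_zero (h : PhaseData S ε N lam) (hS : IsModulusOperator e S) (hεe : ε ≤ e)
    {m : ℕ} (hm : 1 ≤ m) (hmN : m < N) {y : ℝ} (hy : y ∈ Ioo 0 ε) (ζ : ℂ) :
    coeff lam m y ζ = 0 := by
  have key : ∀ d m, 1 ≤ m → m < N → N - m ≤ d → ∀ z ∈ Ioo 0 ε, ∀ ζ, coeff lam m z ζ = 0 := by
    intro d
    induction d with
    | zero => intro m _ h2 h3; omega
    | succ d ih =>
      intro m h1 h2 h3 z hz ζ
      exact h.coeff_eq_zero_step hS hεe h1 h2 (fun l hl hlN => ih l (by omega) hlN (by omega)) hz ζ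
  exact key _ m hm hmN le_rfl y hy ζ

/-- With the higher orders gone, the image of `t - y` at `y + s` is `s * exp (i b log s)`, where `b`
is the coefficient at `y + s`. Differentiability at `y` makes the exponential converge as `s → 0⁺`,
impossible if `b` has a nonzero limit, for then `b log s` is continuous and unbounded. -/
theorem coeff_zero_one (h : PhaseData S ε N lam) (hS : IsModulusOperator e S) (hεe : ε ≤ e)
    {y : ℝ} (hy : y ∈ Ioo 0 ε) : coeff lam 0 y 1 = 0 := by
  have hid : ContDiff ℝ ∞ fun t : ℝ => (t : ℂ) - y := Complex.ofRealCLM.contDiff.sub contDiff_const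
  have hI : y ∈ Ioo (-e) e := hS.mem ⟨hy.1, hy.2.trans_le hεe⟩
  have hform : ∀ s ∈ Ioo 0 (ε - y), S (fun t => (t : ℂ) - y) (y + s) =
      s * Complex.exp ((Real.log s * coeff lam 0 (y + s) 1 : ℝ) * Complex.I) := by
    intro s hs
    have hz : y + s ∈ Ioo 0 ε := ⟨by linarith [hy.1, hs.1], by linarith [hs.2]⟩
    have hs' : (s : ℂ) ≠ 0 := by exact_mod_cast hs.1.ne'
    rw [h.map_sub_const hS hεe hz (w := s) hs' (by push_cast; ring), Complex.norm_real,
      Real.norm_eq_abs, abs_of_pos hs.1, Finset.sum_eq_zero fun l hl => h.coeff_eq_zero hS hεe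
        (Finset.mem_Ico.1 hl).1 (Finset.mem_Ico.1 hl).2 hz _, add_zero, h.coeff_eq 0 hz,
      ← Complex.ofReal_log hs.1.le]
    simp
  have h0 : S (fun t => (t : ℂ) - y) y = 0 := by
    rw [← norm_eq_zero, hS.norm hid hI]; simp
  obtain ⟨D, hD⟩ : ∃ D, HasDerivAt (S fun t => (t : ℂ) - y) D y :=
    ⟨_, (((hS.contDiffOn hid).contDiffAt (Ioo_mem_nhds hI.1 hI.2)).differentiableAt
      one_ne_zero).hasDerivAt⟩
  have hlim : Tendsto (fun s => Complex.exp ((Real.log s * coeff lam 0 (y + s) 1 : ℝ) * Complex.I))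
      (𝓝[>] 0) (𝓝 D) := by
    have h1 := hD.tendsto_slope_zero_right
    refine h1.congr' ?_
    filter_upwards [Ioo_mem_nhdsGT (show 0 < ε - y by linarith [hy.2])] with s hs
    have hs' : (s : ℂ) ≠ 0 := by exact_mod_cast hs.1.ne'
    rw [hform s hs, h0, sub_zero, Complex.real_smul, Complex.ofReal_inv, inv_mul_cancel_left₀ hs']
  have hlin : Tendsto (fun s : ℝ => y + s) (𝓝[>] 0) (𝓝 y) := by
    have : Continuous fun s : ℝ => y + s := by fun_prop
    simpa using (this.tendsto 0).mono_left (nhdsWithin_le_nhds (s := Ioi 0))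
  have hb : Tendsto (fun s => coeff lam 0 (y + s) 1) (𝓝[>] 0) (𝓝 (coeff lam 0 y 1)) :=
    ((h.continuousOn_coeff 0 1).continuousAt (Ioo_mem_nhds hy.1 hy.2)).tendsto.comp hlin
  have hcont : ContinuousOn (fun s => Real.log s * coeff lam 0 (y + s) 1) (Ioo 0 (ε - y)) := by
    refine ContinuousOn.mul (Real.continuousOn_log.mono fun s hs => hs.1.ne') ?_
    exact (h.continuousOn_coeff 0 1).comp (Continuous.continuousOn (by fun_prop))
      fun s hs => ⟨by linarith [hy.1, hs.1], by linarith [hs.2]⟩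
  have hpos : 0 < ε - y := by linarith [hy.2]
  by_contra hne
  rcases lt_or_gt_of_ne hne with hneg | hpos'
  · exact not_tendsto_exp_of_tendsto_atTop hpos hcont
      (Real.tendsto_log_nhdsGT_zero.atBot_mul_neg hneg hb) hlim
  · refine not_tendsto_exp_of_tendsto_atTop hpos hcont.neg (tendsto_neg_atBot_atTop.comp
      (Real.tendsto_log_nhdsGT_zero.atBot_mul_pos hpos' hb)) (d := D⁻¹) ?_
    have hD0 : D ≠ 0 := by
      have := hlim.norm
      simp only [Complex.norm_exp_ofReal_mul_I] at this
      have h1 := tendsto_nhds_unique this tendsto_const_nhds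
      exact norm_pos_iff.1 (by rw [h1]; exact one_pos)
    refine (hlim.inv₀ hD0).congr fun s => ?_
    rw [← Complex.exp_neg]
    congr 1
    simp

/-- Since `exp (2πi) = 1` has image `1`, the coefficient is an integer at each point; being
continuous on an interval, it is constant. -/
theorem exists_int_coeff_zero_I (h : PhaseData S ε N lam) (hS : IsModulusOperator e S)
    (hεe : ε ≤ e) : ∃ n : ℤ, ∀ y ∈ Ioo 0 ε, coeff lam 0 y Complex.I = n := by
  have hint : ∀ y ∈ Ioo 0 ε, ∃ n : ℤ, coeff lam 0 y Complex.I = n := by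
    intro y hy
    have hI : y ∈ Ioo (-e) e := hS.mem ⟨hy.1, hy.2.trans_le hεe⟩
    have h1 := h.map_exp hy (φ := fun _ => 2 * Real.pi * Complex.I) contDiff_const
    have h2 : lam y (fun _ => 2 * Real.pi * Complex.I) = 2 * Real.pi * coeff lam 0 y Complex.I := by
      rw [coeff, ← h.smul hy (contDiff_mul_sub_pow Complex.I y 0)]
      simp
    rw [Complex.exp_two_pi_mul_I, hS.map_one hI, h2] at h1
    simp only [Complex.mul_re, Complex.ofReal_re, Complex.I_re, mul_zero, Complex.I_im, mul_one,
      Complex.mul_im, Complex.re_ofNat, Complex.im_ofNat, Complex.ofReal_im, zero_mul, add_zero,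
      sub_zero, sub_self, Real.exp_zero, Complex.ofReal_one, one_mul] at h1
    obtain ⟨n, hn⟩ := Complex.exp_eq_one_iff.1 h1.symm
    refine ⟨n, ?_⟩
    have h3 := congrArg Complex.im hn
    simp at h3
    have := Real.pi_pos
    have h4 : (coeff lam 0 y Complex.I - n) * (2 * Real.pi) = 0 := by linarith
    rcases mul_eq_zero.1 h4 with h5 | h5
    · linarith
    · linarith
  rcases (Ioo (0 : ℝ) ε).eq_empty_or_nonempty with hemp | ⟨y₀, hy₀⟩
  · exact ⟨0, fun y hy => by rw [hemp] at hy; exact absurd hy (notMem_empty y)⟩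
  obtain ⟨n, hn⟩ := hint y₀ hy₀
  have hc := h.continuousOn_coeff 0 Complex.I
  refine ⟨n, fun y hy => ?_⟩
  rw [← hn]
  have hd : IsDiscrete (range ((↑) : ℤ → ℝ)) :=
    ⟨Int.isClosedEmbedding_coe_real.isEmbedding.toHomeomorph.symm.isEmbedding.discreteTopology⟩
  refine IsPreconnected.constant_of_mapsTo isPreconnected_Ioo hd hc
    (fun z hz => ?_) hy hy₀
  obtain ⟨k, hk⟩ := hint z hz
  exact ⟨k, hk.symm⟩

end PhaseData

/-- A modulus operator takes the expected values on exponentials, and acts on constants as a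
power of the phase. -/
theorem IsModulusOperator.map_exp_mul_and_const {e : ℝ} {S : (ℝ → ℂ) → ℝ → ℂ}
    (hS : IsModulusOperator e S) :
    (∀ ζ : ℂ, S (fun t => Complex.exp (ζ * t)) 0 = 1) ∧
      ∃ n : ℤ, ∀ c : ℂ, S (fun _ => c) 0 = ‖c‖ * Complex.exp (n * c.arg * Complex.I) := by
  obtain ⟨ε, N, lam, hε, hεe, h⟩ := hS.exists_phaseData
  obtain ⟨n, hn⟩ := h.exists_int_coeff_zero_I hS hεe
  have h0 : ∀ y ∈ Ioo 0 ε, ∀ β : ℂ, PhaseData.coeff lam 0 y β = β.im * n := fun y hy β => by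
    rw [h.coeff_eq 0 hy, h.coeff_zero_one hS hεe hy, hn y hy]; ring
  have hmem : Ioo 0 ε ∈ 𝓝[>] (0 : ℝ) := Ioo_mem_nhdsGT hε
  refine ⟨fun ζ => ?_, n, fun c => ?_⟩
  · have hs : ContDiff ℝ ∞ fun t : ℝ => ζ * (t : ℂ) := contDiff_const.mul Complex.ofRealCLM.contDiff
    have h1 := (hS.tendsto_zero hs.cexp).mono_left (nhdsWithin_le_nhds (s := Ioi 0))
    refine tendsto_nhds_unique h1 ?_
    have h2 : Tendsto (fun y : ℝ => (Real.exp (ζ * y).re : ℂ) *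
        Complex.exp (((ζ * y).im * n : ℝ) * Complex.I)) (𝓝[>] 0) (𝓝 1) := by
      have : Continuous fun y : ℝ => (Real.exp (ζ * y).re : ℂ) *
        Complex.exp (((ζ * y).im * n : ℝ) * Complex.I) := by fun_prop
      have h3 := (this.tendsto 0).mono_left (nhdsWithin_le_nhds (s := Ioi 0))
      simpa using h3
    refine h2.congr' ?_
    filter_upwards [hmem] with y hy
    rw [h.map_exp hy hs]
    have e1 : lam y (fun t : ℝ => ζ * (t : ℂ)) = (ζ * y).im * n := by
      have e2 : (fun t : ℝ => ζ * (t : ℂ)) = fun t : ℝ =>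
          ζ * ((t - y : ℝ) : ℂ) ^ 1 + (ζ * y) * ((t - y : ℝ) : ℂ) ^ 0 := by
        funext t; push_cast; ring
      rw [e2, h.add hy (contDiff_mul_sub_pow _ y 1) (contDiff_mul_sub_pow _ y 0)]
      have h3 := h.coeff_eq_zero hS hεe le_rfl (by have := h.two_le; omega) hy ζ
      have h4 := h0 y hy (ζ * y)
      simp only [PhaseData.coeff] at h3 h4
      rw [h3, h4, zero_add]
    rw [e1]
  · by_cases hc : c = 0
    · have h2 := hS.norm (G := fun _ => c) contDiff_const (y := 0) ⟨by linarith [hS.pos], hS.pos⟩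
      rw [hc, norm_zero, norm_eq_zero] at h2
      simp [hc, h2]
    · have h1 := (hS.tendsto_zero (G := fun _ => c) contDiff_const).mono_left
        (nhdsWithin_le_nhds (s := Ioi 0))
      refine tendsto_nhds_unique h1 (tendsto_const_nhds.congr' ?_)
      filter_upwards [hmem] with y hy
      have h2 := h.map_exp hy (φ := fun _ => Complex.log c) contDiff_const
      have h3 := h0 y hy (Complex.log c)
      simp only [PhaseData.coeff, pow_zero, mul_one] at h3
      rw [Complex.exp_log hc, h3, Complex.log_re, Complex.log_im,
        Real.exp_log (norm_pos_iff.2 hc)] at h2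
      rw [h2]
      push_cast
      ring_nf

/-! ### Bump functions on a `C^k` manifold. -/

section Bump

variable {n : ℕ} {k : ℕ∞} {M : Type*} [TopologicalSpace M]
  [ChartedSpace (EuclideanSpace ℝ (Fin n)) M] [IsManifold (𝓡 n) k M] [T2Space M]

/-- Cutoff functions on a `C^k` manifold. -/
theorem exists_contMDiff_bump {x : M} {V : Set M} (hV : V ∈ 𝓝 x) :
    ∃ b : M → ℝ, ContMDiff (𝓡 n) 𝓘(ℝ, ℝ) k b ∧ HasCompactSupport b ∧ tsupport b ⊆ V ∧
      b =ᶠ[𝓝 x] 1 := by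
  obtain ⟨f, -, hf⟩ := (SmoothBumpFunction.nhds_basis_tsupport (I := 𝓡 n) x).mem_iff.1 hV
  refine ⟨f, ?_, f.hasCompactSupport, hf, f.eventuallyEq_one⟩
  refine contMDiff_of_tsupport fun y hy => ?_
  have hy' : y ∈ (chartAt (EuclideanSpace ℝ (Fin n)) x).source :=
    f.tsupport_subset_chartAt_source hy
  refine ContMDiffAt.congr_of_eventuallyEq ?_ <| f.eqOn_source.eventuallyEq_of_mem <|
    (chartAt _ x).open_source.mem_nhds hy'
  exact (f.contDiffAt.of_le (by exact_mod_cast le_top)).contMDiffAt.comp _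
    (contMDiffAt_extChartAt' hy')

/-- A function that is `C^k` near a point agrees there with a compactly supported `C^k` function. -/
theorem exists_contMDiff_eventuallyEq {F : Type*} [NormedAddCommGroup F] [NormedSpace ℝ F]
    {x : M} {V W : Set M} (hV : IsOpen V) (hx : x ∈ V) {g : M → F}
    (hg : ContMDiffOn (𝓡 n) 𝓘(ℝ, F) k g V) (hW : W ∈ 𝓝 x) :
    ∃ G : M → F, ContMDiff (𝓡 n) 𝓘(ℝ, F) k G ∧ HasCompactSupport G ∧ tsupport G ⊆ W ∧
      G =ᶠ[𝓝 x] g := by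
  obtain ⟨b, hb, hbc, hbV, hb1⟩ := exists_contMDiff_bump (n := n) (k := k)
    (inter_mem (hV.mem_nhds hx) hW)
  refine ⟨fun y => b y • g y, contMDiff_of_tsupport fun y hy => ?_, hbc.smul_right,
    (tsupport_smul_subset_left _ _).trans (hbV.trans inter_subset_right), ?_⟩
  · have hy' := (hbV (tsupport_smul_subset_left _ _ hy)).1
    exact hb.contMDiffAt.smul (hg.contMDiffAt (hV.mem_nhds hy'))
  · filter_upwards [hb1] with y hy
    simp [hy]

theorem exists_contMDiff_bump_complex {x : M} {V : Set M} (hV : V ∈ 𝓝 x) :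
    ∃ b : M → ℂ, ContMDiff (𝓡 n) 𝓘(ℝ, ℂ) k b ∧ HasCompactSupport b ∧ tsupport b ⊆ V ∧
      b =ᶠ[𝓝 x] 1 :=
  exists_contMDiff_eventuallyEq isOpen_univ (mem_univ x)
    (contMDiff_const (c := (1 : ℂ))).contMDiffOn hV

end Bump

/-! ### Recovering the points of `M` from multiplication. -/

/-- A sequence of nonzero elements, each acting as the identity on the next one, that is maximal
in the sense that it decides every pair of functions separated by a third one. -/
structure IsCharSeq {A : Type*} [Mul A] [Zero A] (f : ℕ → A) : Prop where
  ne_zero : ∀ i, f i ≠ 0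
  mul_succ : ∀ i, f i * f (i + 1) = f (i + 1)
  decide : ∀ h g' g : A, h * g' = h → g' * g = g' → (∃ i, h * f i = 0) ∨ ∃ i, g * f i = f i

theorem MulEquiv.apply_zero_of_mulZeroClass {A B : Type*} [MulZeroClass A] [MulZeroClass B]
    (E : A ≃* B) : E 0 = 0 := by
  have h : E 0 * E (E.symm 0) = E 0 := by rw [← map_mul, zero_mul]
  rw [E.apply_symm_apply, mul_zero] at h
  exact h.symm

theorem IsCharSeq.map {A B : Type*} [MulZeroClass A] [MulZeroClass B] (E : A ≃* B) {f : ℕ → A}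
    (hf : IsCharSeq f) : IsCharSeq fun i => E (f i) := by
  have hz : ∀ a, E a = 0 ↔ a = 0 := fun a => by
    rw [← E.apply_zero_of_mulZeroClass, E.injective.eq_iff]
  refine ⟨fun i h => hf.ne_zero i ((hz _).1 h), fun i => by rw [← map_mul, hf.mul_succ], ?_⟩
  intro h g' g h1 h2
  have h1' : E.symm h * E.symm g' = E.symm h := by rw [← map_mul, h1]
  have h2' : E.symm g' * E.symm g = E.symm g' := by rw [← map_mul, h2]
  refine (hf.decide _ _ _ h1' h2').imp ?_ ?_
  · rintro ⟨i, hi⟩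
    exact ⟨i, by simpa [E.apply_zero_of_mulZeroClass] using congrArg E hi⟩
  · rintro ⟨i, hi⟩
    exact ⟨i, by simpa using congrArg E hi⟩

/-- The properties of the function algebras that determine their multiplicative bijections. -/
structure IsAdmissible (n : ℕ) (k : ℕ∞) {M : Type*} [TopologicalSpace M]
    [ChartedSpace (EuclideanSpace ℝ (Fin n)) M] (B : NonUnitalSubalgebra ℝ (M → ℂ)) : Prop where
  contMDiff : ∀ f ∈ B, ContMDiff (𝓡 n) 𝓘(ℝ, ℂ) k f
  mem : ∀ f : M → ℂ, ContMDiff (𝓡 n) 𝓘(ℝ, ℂ) k f → HasCompactSupport f → f ∈ B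
  exists_mem_tsupport : ∀ f : ℕ → B, IsCharSeq f → ∃ x, ∀ i, x ∈ tsupport (f i : M → ℂ)

namespace IsAdmissible

/-- Dictionary between algebra and topology: inclusion of a support in the set where another
function is `1` becomes a multiplicative identity. -/
theorem mul_eq_iff {M : Type*} {B : NonUnitalSubalgebra ℝ (M → ℂ)} {h g : B} : h * g = h ↔ ∀ x, (h : M → ℂ) x ≠ 0 → (g : M → ℂ) x = 1 := by
  rw [Subtype.ext_iff, funext_iff]
  refine forall_congr' fun x => ?_
  simp only [NonUnitalSubalgebra.coe_mul, Pi.mul_apply]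
  by_cases hx : (h : M → ℂ) x = 0
  · simp [hx]
  · simp [hx]

variable {n : ℕ} {k : ℕ∞} {M : Type*} [TopologicalSpace M]
  [ChartedSpace (EuclideanSpace ℝ (Fin n)) M] {B : NonUnitalSubalgebra ℝ (M → ℂ)}

theorem continuous (hB : IsAdmissible n k B) (f : B) : Continuous (f : M → ℂ) :=
  (hB.contMDiff f f.2).continuous

theorem eq_one_of_mem_tsupport (hB : IsAdmissible n k B) {h g : B} (hg : h * g = h) {x : M}
    (hx : x ∈ tsupport (h : M → ℂ)) : (g : M → ℂ) x = 1 := by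
  have hc : IsClosed {x | (g : M → ℂ) x = 1} := isClosed_eq (hB.continuous g) continuous_const
  exact closure_minimal (fun x hx => mul_eq_iff.1 hg x hx) hc hx

variable [IsManifold (𝓡 n) k M] [T2Space M]

theorem exists_bump (hB : IsAdmissible n k B) {x : M} {V : Set M} (hV : V ∈ 𝓝 x) :
    ∃ b : B, (b : M → ℂ) =ᶠ[𝓝 x] 1 ∧ tsupport (b : M → ℂ) ⊆ V := by
  obtain ⟨b, hb, hbc, hbV, hb1⟩ := exists_contMDiff_bump_complex (n := n) (k := k) hV
  exact ⟨⟨b, hB.mem b hb hbc⟩, hb1, hbV⟩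

/-- Nested bumps shrinking to `x` do the job. In `decide`, if `x` is in the closed support of `h`,
then `g' x = 1`, so `g = 1` near `x` and `g` fixes a late bump; otherwise `h` kills a late bump. -/
theorem exists_isCharSeq [FirstCountableTopology M] (hB : IsAdmissible n k B) (x : M) :
    ∃ c : ℕ → B, IsCharSeq c ∧ (∀ i, (c i : M → ℂ) =ᶠ[𝓝 x] 1) ∧
      ∀ V ∈ 𝓝 x, ∃ i, tsupport (c i : M → ℂ) ⊆ V := by
  obtain ⟨U, hU⟩ := (𝓝 x).exists_antitone_basis
  choose! b hb1 hbV using fun (V : Set M) (hV : V ∈ 𝓝 x) => hB.exists_bump hV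
  obtain ⟨c, hc0, hs⟩ : ∃ c : ℕ → B, c 0 = b (U 0) ∧
      ∀ i, c (i + 1) = b (U (i + 1) ∩ {y | (c i : M → ℂ) y = 1}) :=
    ⟨fun i => Nat.rec (motive := fun _ => B) (b (U 0))
      (fun i f => b (U (i + 1) ∩ {y | (f : M → ℂ) y = 1})) i, rfl, fun _ => rfl⟩
  have h1 : ∀ i, (c i : M → ℂ) =ᶠ[𝓝 x] 1 := by
    intro i
    induction i with
    | zero => rw [hc0]; exact hb1 _ (hU.1.mem_of_mem trivial)
    | succ i ih => rw [hs]; exact hb1 _ (inter_mem (hU.1.mem_of_mem trivial) ih)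
  have h2 : ∀ i, tsupport (c (i + 1) : M → ℂ) ⊆ U (i + 1) ∩ {y | (c i : M → ℂ) y = 1} := by
    intro i
    rw [hs]
    exact hbV _ (inter_mem (hU.1.mem_of_mem trivial) (h1 i))
  have h3 : ∀ V ∈ 𝓝 x, ∃ i, tsupport (c i : M → ℂ) ⊆ V := by
    intro V hV
    obtain ⟨i, -, hi⟩ := hU.1.mem_iff.1 hV
    exact ⟨i + 1, (h2 i).trans (inter_subset_left.trans ((hU.2 (Nat.le_succ i)).trans hi))⟩
  refine ⟨c, ⟨?_, ?_, ?_⟩, h1, h3⟩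
  · intro i h0
    have := (h1 i).self_of_nhds
    simp [h0] at this
  · intro i
    rw [mul_comm, mul_eq_iff]
    exact fun y hy => (h2 i (subset_tsupport _ hy)).2
  · intro h g' g hg' hg
    by_cases hx : x ∈ tsupport (h : M → ℂ)
    · right
      have hx1 := hB.eq_one_of_mem_tsupport hg' hx
      have hnear : ∀ᶠ y in 𝓝 x, (g' : M → ℂ) y ≠ 0 :=
        (hB.continuous g').continuousAt.eventually_ne (by rw [hx1]; exact one_ne_zero)
      obtain ⟨i, hi⟩ := h3 _ hnear
      refine ⟨i, ?_⟩
      rw [mul_comm, mul_eq_iff]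
      exact fun y hy => mul_eq_iff.1 hg y (hi (subset_tsupport _ hy))
    · left
      obtain ⟨i, hi⟩ := h3 _ ((isClosed_tsupport (h : M → ℂ)).isOpen_compl.mem_nhds hx)
      refine ⟨i, Subtype.ext (funext fun y => ?_)⟩
      simp only [NonUnitalSubalgebra.coe_mul, Pi.mul_apply, ZeroMemClass.coe_zero, Pi.zero_apply,
        mul_eq_zero]
      by_contra! hne
      exact hi (subset_tsupport _ hne.2) (subset_tsupport _ hne.1)

/-- Admissibility supplies a common point `x` of the closed supports. Applying `decide` to three
nested bumps at `x` inside `V` forces late supports into `V`: the first alternative fails because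
the bump `h` and every `f i` equal `1` at `x`. -/
theorem exists_limit_of_isCharSeq (hB : IsAdmissible n k B) {f : ℕ → B} (hf : IsCharSeq f) :
    ∃ x, (∀ i, (f i : M → ℂ) =ᶠ[𝓝 x] 1) ∧ ∀ V ∈ 𝓝 x, ∃ i, tsupport (f i : M → ℂ) ⊆ V := by
  obtain ⟨x, hx⟩ := hB.exists_mem_tsupport f hf
  have hmul : ∀ i, f (i + 1) * f i = f (i + 1) := fun i => by rw [mul_comm]; exact hf.mul_succ i
  have h1 : ∀ i, (f i : M → ℂ) x = 1 := fun i => hB.eq_one_of_mem_tsupport (hmul i) (hx (i + 1))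
  refine ⟨x, fun i => ?_, fun V hV => ?_⟩
  · have hne : ∀ᶠ y in 𝓝 x, (f (i + 1) : M → ℂ) y ≠ 0 :=
      (hB.continuous _).continuousAt.eventually_ne (by rw [h1]; exact one_ne_zero)
    filter_upwards [hne] with y hy
    exact mul_eq_iff.1 (hmul i) y hy
  · obtain ⟨g, hg1, hgV⟩ := hB.exists_bump hV
    obtain ⟨g', hg1', hgV'⟩ := hB.exists_bump hg1
    obtain ⟨h, hh1, hhV⟩ := hB.exists_bump hg1'
    have e1 : h * g' = h := mul_eq_iff.2 fun y hy => hhV (subset_tsupport _ hy)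
    have e2 : g' * g = g' := mul_eq_iff.2 fun y hy => hgV' (subset_tsupport _ hy)
    rcases hf.decide h g' g e1 e2 with ⟨i, hi⟩ | ⟨i, hi⟩
    · exfalso
      have := congrFun (congrArg Subtype.val hi) x
      simp [h1 i, hh1.self_of_nhds] at this
    · refine ⟨i, (closure_mono fun y hy => ?_).trans hgV⟩
      rw [mul_comm, mul_eq_iff] at hi
      rw [Function.mem_support, hi y hy]
      exact one_ne_zero

theorem eq_of_forall_eventuallyEq_one_iff (hB : IsAdmissible n k B) {y y' : M}
    (h : ∀ g : B, (g : M → ℂ) =ᶠ[𝓝 y] 1 → (g : M → ℂ) =ᶠ[𝓝 y'] 1) : y = y' := by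
  by_contra hne
  obtain ⟨g, hg1, hgV⟩ := hB.exists_bump (isOpen_ne.mem_nhds hne : {z | z ≠ y'} ∈ 𝓝 y)
  have h1 := (h g hg1).self_of_nhds
  have : y' ∈ tsupport (g : M → ℂ) := subset_tsupport _ (by simp [h1])
  exact hgV this rfl

/-- Equality of germs at `x` is multiplicative: it means `f * e = g * e` for some `e` equal to `1`
near `x`, and `u` transports such `e`. -/
theorem eventuallyEq_iff (hB : IsAdmissible n k B) {E : B ≃* B} {u : M → M}
    (hu : ∀ x (g : B), (g : M → ℂ) =ᶠ[𝓝 x] 1 ↔ (E g : M → ℂ) =ᶠ[𝓝 (u x)] 1) {x : M} (f g : B) :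
    (f : M → ℂ) =ᶠ[𝓝 x] g ↔ (E f : M → ℂ) =ᶠ[𝓝 (u x)] E g := by
  have key : ∀ {x : M} {f g e : B}, (e : M → ℂ) =ᶠ[𝓝 x] 1 → f * e = g * e →
      (f : M → ℂ) =ᶠ[𝓝 x] g := by
    intro x f g e he h
    filter_upwards [he] with y hy
    have := congrFun (congrArg Subtype.val h) y
    simpa [hy] using this
  have key' : ∀ {x : M} {f g : B}, (f : M → ℂ) =ᶠ[𝓝 x] g →
      ∃ e : B, (e : M → ℂ) =ᶠ[𝓝 x] 1 ∧ f * e = g * e := by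
    intro x f g h
    obtain ⟨e, he1, heV⟩ := hB.exists_bump h
    refine ⟨e, he1, Subtype.ext (funext fun y => ?_)⟩
    simp only [NonUnitalSubalgebra.coe_mul, Pi.mul_apply]
    by_cases hy : (e : M → ℂ) y = 0
    · simp [hy]
    · have : (f : M → ℂ) y = (g : M → ℂ) y := heV (subset_tsupport _ hy)
      rw [this]
  constructor
  · intro h
    obtain ⟨e, he1, he⟩ := key' h
    exact key ((hu x e).1 he1) (by rw [← map_mul, he, map_mul])
  · intro h
    obtain ⟨e, he1, he⟩ := key' h
    refine key (e := E.symm e) ((hu x _).2 (by simpa using he1)) ?_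
    apply E.injective
    simpa using he

variable [FirstCountableTopology M]

/-- For a characteristic sequence `f` concentrating at `x`, `g = 1` near `x` if and only if `g * f i
= f i` for some `i`. This condition and characteristic sequences are both preserved by `E`, and the
image sequence has a limit point. -/
theorem exists_image_point (hB : IsAdmissible n k B) (E : B ≃* B) (x : M) :
    ∃ y : M, ∀ g : B, (g : M → ℂ) =ᶠ[𝓝 x] 1 ↔ (E g : M → ℂ) =ᶠ[𝓝 y] 1 := by
  have key : ∀ {f : ℕ → B} {x : M}, (∀ i, (f i : M → ℂ) =ᶠ[𝓝 x] 1) →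
      (∀ V ∈ 𝓝 x, ∃ i, tsupport (f i : M → ℂ) ⊆ V) → ∀ g : B,
        (g : M → ℂ) =ᶠ[𝓝 x] 1 ↔ ∃ i, g * f i = f i := by
    intro f x h1 h2 g
    constructor
    · intro hg
      obtain ⟨i, hi⟩ := h2 _ hg
      refine ⟨i, ?_⟩
      rw [mul_comm, mul_eq_iff]
      exact fun y hy => hi (subset_tsupport _ hy)
    · rintro ⟨i, hi⟩
      rw [mul_comm, mul_eq_iff] at hi
      filter_upwards [h1 i] with y hy
      exact hi y (by rw [hy]; exact one_ne_zero)
  obtain ⟨c, hc, hc1, hc2⟩ := hB.exists_isCharSeq x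
  obtain ⟨y, hy1, hy2⟩ := hB.exists_limit_of_isCharSeq (hc.map E)
  refine ⟨y, fun g => ?_⟩
  rw [key hc1 hc2 g, key hy1 hy2 (E g)]
  simp only [← map_mul, E.injective.eq_iff]

/-- A multiplicative bijection induces a homeomorphism of the underlying manifold. -/
theorem exists_homeomorph (hB : IsAdmissible n k B) (E : B ≃* B) :
    ∃ u : M ≃ₜ M, ∀ x (g : B), (g : M → ℂ) =ᶠ[𝓝 x] 1 ↔ (E g : M → ℂ) =ᶠ[𝓝 (u x)] 1 := by
  choose u hu using hB.exists_image_point E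
  choose v hv using hB.exists_image_point E.symm
  have hcont : ∀ (E : B ≃* B) (u : M → M),
      (∀ x (g : B), (g : M → ℂ) =ᶠ[𝓝 x] 1 ↔ (E g : M → ℂ) =ᶠ[𝓝 (u x)] 1) → Continuous u := by
    intro E u hu
    rw [continuous_iff_continuousAt]
    intro x V hV
    obtain ⟨g, hg1, hgV⟩ := hB.exists_bump hV
    have h1 : (E.symm g : M → ℂ) =ᶠ[𝓝 x] 1 := by rw [hu x]; simpa using hg1
    have h2 := eventually_eventually_nhds.2 h1
    refine mem_map.2 ?_
    filter_upwards [h2] with x' hx'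
    have h3 : (E.symm g : M → ℂ) =ᶠ[𝓝 x'] 1 := hx'
    rw [hu x', E.apply_symm_apply] at h3
    exact hgV (subset_tsupport _ (by simp [h3.self_of_nhds]))
  refine ⟨⟨⟨u, v, fun x => ?_, fun y => ?_⟩, hcont E u hu, hcont E.symm v hv⟩, hu⟩
  · refine hB.eq_of_forall_eventuallyEq_one_iff fun g hg => ?_
    rw [hu x, ← E.symm_apply_apply g]
    have h1 : (E.symm (E g) : M → ℂ) =ᶠ[𝓝 (v (u x))] 1 := by simpa using hg
    rw [← hv] at h1
    simpa using h1
  · refine hB.eq_of_forall_eventuallyEq_one_iff fun g hg => ?_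
    have h1 : (E (E.symm g) : M → ℂ) =ᶠ[𝓝 (u (v y))] 1 := by simpa using hg
    rw [← hu] at h1
    rw [hv y]
    exact h1

end IsAdmissible

/-! ### Extension to all `C^k` functions. -/

section

variable {n : ℕ} {k : ℕ∞} {M : Type*} [TopologicalSpace M]
  [ChartedSpace (EuclideanSpace ℝ (Fin n)) M]

theorem ContMDiff.mul_complex {f g : M → ℂ} (hf : ContMDiff (𝓡 n) 𝓘(ℝ, ℂ) k f)
    (hg : ContMDiff (𝓡 n) 𝓘(ℝ, ℂ) k g) : ContMDiff (𝓡 n) 𝓘(ℝ, ℂ) k (f * g) :=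
  (ckFunctions n k M).mul_mem hf hg

theorem ContMDiff.pow_complex {f : M → ℂ} (hf : ContMDiff (𝓡 n) 𝓘(ℝ, ℂ) k f) (m : ℕ) :
    ContMDiff (𝓡 n) 𝓘(ℝ, ℂ) k (f ^ m) := by
  induction m with
  | zero => rw [pow_zero]; exact contMDiff_const
  | succ m ih => rw [pow_succ]; exact ih.mul_complex hf

end

/-- A multiplicative bijection of the global `C^k` functions that acts on germs along a
homeomorphism. -/
structure CkIso (n : ℕ) (k : ℕ∞) (M : Type*) [TopologicalSpace M]
    [ChartedSpace (EuclideanSpace ℝ (Fin n)) M] where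
  toFun : (M → ℂ) → M → ℂ
  invFun : (M → ℂ) → M → ℂ
  point : M ≃ₜ M
  contMDiff_toFun : ∀ {f}, ContMDiff (𝓡 n) 𝓘(ℝ, ℂ) k f → ContMDiff (𝓡 n) 𝓘(ℝ, ℂ) k (toFun f)
  contMDiff_invFun : ∀ {f}, ContMDiff (𝓡 n) 𝓘(ℝ, ℂ) k f → ContMDiff (𝓡 n) 𝓘(ℝ, ℂ) k (invFun f)
  map_mul : ∀ {f g}, ContMDiff (𝓡 n) 𝓘(ℝ, ℂ) k f → ContMDiff (𝓡 n) 𝓘(ℝ, ℂ) k g →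
    toFun (f * g) = toFun f * toFun g
  inv_map_mul : ∀ {f g}, ContMDiff (𝓡 n) 𝓘(ℝ, ℂ) k f → ContMDiff (𝓡 n) 𝓘(ℝ, ℂ) k g →
    invFun (f * g) = invFun f * invFun g
  map_congr : ∀ {f g}, ContMDiff (𝓡 n) 𝓘(ℝ, ℂ) k f → ContMDiff (𝓡 n) 𝓘(ℝ, ℂ) k g →
    ∀ {x}, f =ᶠ[𝓝 x] g → toFun f =ᶠ[𝓝 (point x)] toFun g
  inv_map_congr : ∀ {f g}, ContMDiff (𝓡 n) 𝓘(ℝ, ℂ) k f → ContMDiff (𝓡 n) 𝓘(ℝ, ℂ) k g →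
    ∀ {x}, f =ᶠ[𝓝 x] g → invFun f =ᶠ[𝓝 (point.symm x)] invFun g
  inv_toFun : ∀ {f}, ContMDiff (𝓡 n) 𝓘(ℝ, ℂ) k f → invFun (toFun f) = f
  toFun_inv : ∀ {f}, ContMDiff (𝓡 n) 𝓘(ℝ, ℂ) k f → toFun (invFun f) = f

namespace IsAdmissible

variable {n : ℕ} {k : ℕ∞} {M : Type*} [TopologicalSpace M]
  [ChartedSpace (EuclideanSpace ℝ (Fin n)) M] {B : NonUnitalSubalgebra ℝ (M → ℂ)}

open Classical in
/-- The value at `u x` of a multiplicative bijection, on the germ at `x` of a function. -/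
noncomputable def extend (E : B ≃* B) (u : M ≃ₜ M) (f : M → ℂ) (y : M) : ℂ :=
  if h : ∃ F : B, (F : M → ℂ) =ᶠ[𝓝 (u.symm y)] f then (E h.choose : M → ℂ) y else 0

variable [IsManifold (𝓡 n) k M] [T2Space M]

theorem exists_mem_eventuallyEq (hB : IsAdmissible n k B) {f : M → ℂ}
    (hf : ContMDiff (𝓡 n) 𝓘(ℝ, ℂ) k f) (x : M) : ∃ F : B, (F : M → ℂ) =ᶠ[𝓝 x] f := by
  obtain ⟨G, hG, hGc, -, hGe⟩ := exists_contMDiff_eventuallyEq isOpen_univ (mem_univ x)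
    hf.contMDiffOn (univ_mem (f := 𝓝 x))
  exact ⟨⟨G, hB.mem G hG hGc⟩, hGe⟩

/-- The choice of representative in `extend` is immaterial by `eventuallyEq_iff`, and one
representative serves at all nearby points. -/
theorem extend_eventuallyEq (hB : IsAdmissible n k B) {E : B ≃* B} {u : M ≃ₜ M}
    (hu : ∀ x (g : B), (g : M → ℂ) =ᶠ[𝓝 x] 1 ↔ (E g : M → ℂ) =ᶠ[𝓝 (u x)] 1) {f : M → ℂ} {x : M}
    {F : B} (hF : (F : M → ℂ) =ᶠ[𝓝 x] f) : extend E u f =ᶠ[𝓝 (u x)] E F := by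
  have h1 := u.symm.continuous.continuousAt (x := u x)
  rw [ContinuousAt, u.symm_apply_apply] at h1
  filter_upwards [h1.eventually (eventually_eventually_nhds.2 hF)] with y hy
  have hex : ∃ F : B, (F : M → ℂ) =ᶠ[𝓝 (u.symm y)] f := ⟨F, hy⟩
  rw [extend, dif_pos hex]
  have h2 := (hB.eventuallyEq_iff hu _ F).1 (hex.choose_spec.trans (EventuallyEq.symm hy))
  rw [u.apply_symm_apply] at h2
  exact h2.self_of_nhds

theorem extend_coe (hB : IsAdmissible n k B) {E : B ≃* B} {u : M ≃ₜ M}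
    (hu : ∀ x (g : B), (g : M → ℂ) =ᶠ[𝓝 x] 1 ↔ (E g : M → ℂ) =ᶠ[𝓝 (u x)] 1) (F : B) :
    extend E u F = E F := by
  funext y
  have := (hB.extend_eventuallyEq hu (F := F) (x := u.symm y) EventuallyEq.rfl)
  rw [u.apply_symm_apply] at this
  exact this.self_of_nhds

theorem contMDiff_extend (hB : IsAdmissible n k B) {E : B ≃* B} {u : M ≃ₜ M}
    (hu : ∀ x (g : B), (g : M → ℂ) =ᶠ[𝓝 x] 1 ↔ (E g : M → ℂ) =ᶠ[𝓝 (u x)] 1) {f : M → ℂ}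
    (hf : ContMDiff (𝓡 n) 𝓘(ℝ, ℂ) k f) : ContMDiff (𝓡 n) 𝓘(ℝ, ℂ) k (extend E u f) := by
  intro y
  obtain ⟨F, hF⟩ := hB.exists_mem_eventuallyEq hf (u.symm y)
  have h1 := hB.extend_eventuallyEq hu hF
  rw [u.apply_symm_apply] at h1
  exact (hB.contMDiff _ (E F).2).contMDiffAt.congr_of_eventuallyEq h1

theorem extend_mul (hB : IsAdmissible n k B) {E : B ≃* B} {u : M ≃ₜ M}
    (hu : ∀ x (g : B), (g : M → ℂ) =ᶠ[𝓝 x] 1 ↔ (E g : M → ℂ) =ᶠ[𝓝 (u x)] 1) {f g : M → ℂ}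
    (hf : ContMDiff (𝓡 n) 𝓘(ℝ, ℂ) k f) (hg : ContMDiff (𝓡 n) 𝓘(ℝ, ℂ) k g) :
    extend E u (f * g) = extend E u f * extend E u g := by
  funext y
  obtain ⟨F, hF⟩ := hB.exists_mem_eventuallyEq hf (u.symm y)
  obtain ⟨G, hG⟩ := hB.exists_mem_eventuallyEq hg (u.symm y)
  have hFG : ((F * G : B) : M → ℂ) =ᶠ[𝓝 (u.symm y)] f * g := hF.mul hG
  have h1 := (hB.extend_eventuallyEq hu hF).self_of_nhds
  have h2 := (hB.extend_eventuallyEq hu hG).self_of_nhds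
  have h3 := (hB.extend_eventuallyEq hu hFG).self_of_nhds
  rw [u.apply_symm_apply] at h1 h2 h3
  rw [h3, _root_.map_mul, Pi.mul_apply, h1, h2]
  rfl

theorem extend_congr (hB : IsAdmissible n k B) {E : B ≃* B} {u : M ≃ₜ M}
    (hu : ∀ x (g : B), (g : M → ℂ) =ᶠ[𝓝 x] 1 ↔ (E g : M → ℂ) =ᶠ[𝓝 (u x)] 1) {f g : M → ℂ}
    (hf : ContMDiff (𝓡 n) 𝓘(ℝ, ℂ) k f) {x : M} (hfg : f =ᶠ[𝓝 x] g) :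
    extend E u f =ᶠ[𝓝 (u x)] extend E u g := by
  obtain ⟨F, hF⟩ := hB.exists_mem_eventuallyEq hf x
  exact (hB.extend_eventuallyEq hu hF).trans (hB.extend_eventuallyEq hu (hF.trans hfg)).symm

theorem extend_symm_extend (hB : IsAdmissible n k B) {E : B ≃* B} {u : M ≃ₜ M}
    (hu : ∀ x (g : B), (g : M → ℂ) =ᶠ[𝓝 x] 1 ↔ (E g : M → ℂ) =ᶠ[𝓝 (u x)] 1)
    (hu' : ∀ x (g : B), (g : M → ℂ) =ᶠ[𝓝 x] 1 ↔ (E.symm g : M → ℂ) =ᶠ[𝓝 (u.symm x)] 1) {f : M → ℂ}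
    (hf : ContMDiff (𝓡 n) 𝓘(ℝ, ℂ) k f) : extend E.symm u.symm (extend E u f) = f := by
  funext x
  obtain ⟨F, hF⟩ := hB.exists_mem_eventuallyEq hf x
  have h1 := hB.extend_eventuallyEq hu hF
  have h2 := (hB.extend_eventuallyEq (E := E.symm) (u := u.symm) hu' h1.symm).self_of_nhds
  rw [u.symm_apply_apply] at h2
  rw [h2, E.symm_apply_apply, hF.self_of_nhds]

/-- A multiplicative bijection of an admissible algebra extends to all `C^k` functions. -/
theorem exists_ckIso [FirstCountableTopology M] (hB : IsAdmissible n k B) (E : B ≃* B) :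
    ∃ Φ : CkIso n k M, ∀ f : B, Φ.toFun f = E f := by
  obtain ⟨u, hu⟩ := hB.exists_homeomorph E
  have hu' : ∀ x (g : B), (g : M → ℂ) =ᶠ[𝓝 x] 1 ↔ (E.symm g : M → ℂ) =ᶠ[𝓝 (u.symm x)] 1 := by
    intro x g
    rw [hu (u.symm x) (E.symm g), E.apply_symm_apply, u.apply_symm_apply]
  exact ⟨{ toFun := extend E u
           invFun := extend E.symm u.symm
           point := u
           contMDiff_toFun := hB.contMDiff_extend hu
           contMDiff_invFun := hB.contMDiff_extend hu'
           map_mul := hB.extend_mul hu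
           inv_map_mul := hB.extend_mul hu'
           map_congr := fun hf _ => hB.extend_congr hu hf
           inv_map_congr := fun hf _ => hB.extend_congr hu' hf
           inv_toFun := hB.extend_symm_extend hu hu'
           toFun_inv := fun hf => hB.extend_symm_extend (E := E.symm) (u := u.symm) hu' hu hf },
    hB.extend_coe hu⟩

end IsAdmissible

namespace CkIso

variable {n : ℕ} {k : ℕ∞} {M : Type*} [TopologicalSpace M]
  [ChartedSpace (EuclideanSpace ℝ (Fin n)) M]

/-- The inverse of a `CkIso`. -/
def symm (Φ : CkIso n k M) : CkIso n k M where
  toFun := Φ.invFun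
  invFun := Φ.toFun
  point := Φ.point.symm
  contMDiff_toFun := Φ.contMDiff_invFun
  contMDiff_invFun := Φ.contMDiff_toFun
  map_mul := Φ.inv_map_mul
  inv_map_mul := Φ.map_mul
  map_congr := Φ.inv_map_congr
  inv_map_congr := Φ.map_congr
  inv_toFun := Φ.toFun_inv
  toFun_inv := Φ.inv_toFun

theorem toFun_one (Φ : CkIso n k M) : Φ.toFun 1 = 1 := by
  have h1 : ContMDiff (𝓡 n) 𝓘(ℝ, ℂ) k (1 : M → ℂ) := contMDiff_const
  have h2 := Φ.contMDiff_invFun h1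
  have h3 : Φ.toFun (1 * Φ.invFun 1) = Φ.toFun 1 * Φ.toFun (Φ.invFun 1) := Φ.map_mul h1 h2
  rw [one_mul, Φ.toFun_inv h1, mul_one] at h3
  exact h3.symm

theorem toFun_pow (Φ : CkIso n k M) {f : M → ℂ} (hf : ContMDiff (𝓡 n) 𝓘(ℝ, ℂ) k f) (m : ℕ) :
    Φ.toFun (f ^ m) = Φ.toFun f ^ m := by
  induction m with
  | zero => rw [pow_zero, pow_zero, Φ.toFun_one]
  | succ m ih => rw [pow_succ, pow_succ, Φ.map_mul (hf.pow_complex m) hf, ih]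

variable [IsManifold (𝓡 n) k M] [T2Space M]

/-- A function that is nonzero at a point has a local inverse there. -/
theorem exists_local_inv {f : M → ℂ} (hf : ContMDiff (𝓡 n) 𝓘(ℝ, ℂ) k f) {x : M} (hx : f x ≠ 0) :
    ∃ g : M → ℂ, ContMDiff (𝓡 n) 𝓘(ℝ, ℂ) k g ∧ f * g =ᶠ[𝓝 x] 1 := by
  have hV : IsOpen {y | f y ≠ 0} := isOpen_ne.preimage hf.continuous
  have hinv : ContMDiffOn (𝓡 n) 𝓘(ℝ, ℂ) k (fun y => (f y)⁻¹) {y | f y ≠ 0} := by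
    intro y hy
    have h1 : ContDiffAt ℝ k (fun z : ℂ => z⁻¹) (f y) := contDiffAt_inv ℝ hy
    exact (h1.contMDiffAt.comp y hf.contMDiffAt).contMDiffWithinAt
  obtain ⟨g, hg, -, -, hge⟩ := exists_contMDiff_eventuallyEq hV hx hinv (univ_mem (f := 𝓝 x))
  refine ⟨g, hg, ?_⟩
  filter_upwards [hge, hV.mem_nhds hx] with y hy hy'
  simp [hy, mul_inv_cancel₀ hy']

omit [IsManifold (𝓡 n) k M] [T2Space M] in
theorem toFun_mul_eq_one (Φ : CkIso n k M) {f g : M → ℂ} (hf : ContMDiff (𝓡 n) 𝓘(ℝ, ℂ) k f)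
    (hg : ContMDiff (𝓡 n) 𝓘(ℝ, ℂ) k g) {x : M} (h : f * g =ᶠ[𝓝 x] 1) :
    Φ.toFun f (Φ.point x) * Φ.toFun g (Φ.point x) = 1 := by
  have h1 : ContMDiff (𝓡 n) 𝓘(ℝ, ℂ) k (1 : M → ℂ) := contMDiff_const
  have h2 := (Φ.map_congr (hf.mul_complex hg) h1 h).self_of_nhds
  rw [Φ.map_mul hf hg, Φ.toFun_one] at h2
  exact h2

theorem toFun_ne_zero (Φ : CkIso n k M) {f : M → ℂ} (hf : ContMDiff (𝓡 n) 𝓘(ℝ, ℂ) k f) {x : M}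
    (hx : f x ≠ 0) : Φ.toFun f (Φ.point x) ≠ 0 := by
  obtain ⟨g, hg, hge⟩ := exists_local_inv hf hx
  exact left_ne_zero_of_mul_eq_one (Φ.toFun_mul_eq_one hf hg hge)

theorem toFun_eq_zero_iff (Φ : CkIso n k M) {f : M → ℂ} (hf : ContMDiff (𝓡 n) 𝓘(ℝ, ℂ) k f) {x : M} :
    Φ.toFun f (Φ.point x) = 0 ↔ f x = 0 := by
  refine not_iff_not.1 ⟨fun h => ?_, Φ.toFun_ne_zero hf⟩
  have h1 := Φ.symm.toFun_ne_zero (Φ.contMDiff_toFun hf) h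
  have e1 : Φ.symm.toFun (Φ.toFun f) = f := Φ.inv_toFun hf
  have e2 : Φ.symm.point (Φ.point x) = x := Φ.point.symm_apply_apply x
  rwa [e1, e2] at h1

end CkIso

/-! ### The modulus: monotonicity, power law, smoothness of `u`, exponent one. -/

/-- `γ` is a `C^k` curve through `x`, parametrized by the values of the function `t`. -/
structure IsLevelCurve (n : ℕ) (k : ℕ∞) {M : Type*} [TopologicalSpace M]
    [ChartedSpace (EuclideanSpace ℝ (Fin n)) M] (x : M) (ε : ℝ) (t : M → ℝ) (γ : ℝ → M) : Prop where
  pos : 0 < ε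
  contMDiffOn : ContMDiffOn 𝓘(ℝ, ℝ) (𝓡 n) k γ (Ioo (-ε) ε)
  apply_zero : γ 0 = x
  contMDiff : ContMDiff (𝓡 n) 𝓘(ℝ, ℝ) k t
  apply_curve : ∀ s ∈ Ioo (-ε) ε, t (γ s) = s

theorem exists_isLevelCurve {n : ℕ} (hn : 1 ≤ n) (k : ℕ∞) {M : Type*} [TopologicalSpace M]
    [ChartedSpace (EuclideanSpace ℝ (Fin n)) M] [IsManifold (𝓡 n) k M] [T2Space M] (x : M) :
    ∃ ε t γ, IsLevelCurve n k x ε t γ := by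
  let i : Fin n := ⟨0, hn⟩
  let e := extChartAt (𝓡 n) x
  let L : ℝ → EuclideanSpace ℝ (Fin n) := fun s => e x + s • EuclideanSpace.single i 1
  have hL : ContDiff ℝ k L := contDiff_const.add (contDiff_id.smul contDiff_const)
  have hL0 : L 0 = e x := by simp [L]
  let c : M → ℝ := fun y => e y i - e x i
  have hc : ContMDiffOn (𝓡 n) 𝓘(ℝ, ℝ) k c e.source := by
    have h1 : ContDiff ℝ k fun v : EuclideanSpace ℝ (Fin n) => v i - e x i :=
      (contDiff_piLp_apply (p := 2)).sub contDiff_const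
    have h2 := contMDiffOn_extChartAt (I := 𝓡 n) (n := (k : WithTop ℕ∞)) (x := x)
    rw [← extChartAt_source (𝓡 n)] at h2
    exact h1.contMDiff.comp_contMDiffOn h2
  obtain ⟨t, ht, -, -, hte⟩ := exists_contMDiff_eventuallyEq (isOpen_extChartAt_source x)
    (mem_extChartAt_source x) hc (univ_mem (f := 𝓝 x))
  have hcont : ContinuousAt (fun s => e.symm (L s)) 0 := by
    have h1 : ContinuousAt e.symm (L 0) := by
      rw [hL0]; exact continuousAt_extChartAt_symm x
    exact h1.comp hL.continuous.continuousAt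
  have hγ0 : e.symm (L 0) = x := by rw [hL0]; exact extChartAt_to_inv x
  have hev : ∀ᶠ s in 𝓝 (0 : ℝ), L s ∈ e.target ∧ t (e.symm (L s)) = c (e.symm (L s)) := by
    refine Eventually.and ?_ ?_
    · refine hL.continuous.continuousAt.eventually_mem ?_
      rw [hL0]
      exact extChartAt_target_mem_nhds x
    · rw [ContinuousAt, hγ0] at hcont
      exact hcont.eventually hte
  obtain ⟨ε, hε, hball⟩ := Metric.eventually_nhds_iff_ball.1 hev
  rw [Real.ball_eq_Ioo, zero_sub, zero_add] at hball
  refine ⟨ε, t, fun s => e.symm (L s), hε, ?_, hγ0, ht, fun s hs => ?_⟩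
  · exact (contMDiffOn_extChartAt_symm x).comp hL.contMDiff.contMDiffOn fun s hs => (hball s hs).1
  · rw [(hball s hs).2]
    simp only [c]
    rw [e.right_inv (hball s hs).1]
    simp [L]

theorem norm_iteratedFDeriv_fst_pow_le (m i : ℕ) (p : ℂ × ℝ) :
    ‖iteratedFDeriv ℝ i (fun p : ℂ × ℝ => p.1 ^ m) p‖ ≤ m.descFactorial i * ‖p.1‖ ^ (m - i) := by
  let f := ContinuousMultilinearMap.mkPiAlgebra ℝ (Fin m) ℂ
  let L : ℂ × ℝ →L[ℝ] (Fin m → ℂ) := ContinuousLinearMap.pi fun _ => ContinuousLinearMap.fst ℝ ℂ ℝ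
  have hf : ‖f‖ ≤ 1 := by
    refine ContinuousMultilinearMap.opNorm_le_bound zero_le_one fun v => ?_
    simp [f]
  have hL : ‖L‖ ≤ 1 := by
    refine ContinuousLinearMap.opNorm_le_bound _ zero_le_one fun v => ?_
    rw [one_mul, pi_norm_le_iff_of_nonneg (norm_nonneg _)]
    exact fun _ => norm_fst_le v
  have e : (fun p : ℂ × ℝ => p.1 ^ m) = f ∘ L := by
    funext p
    simp [f, L]
  have hLp : ‖L p‖ ≤ ‖p.1‖ := by
    rw [pi_norm_le_iff_of_nonneg (norm_nonneg _)]
    exact fun _ => le_rfl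
  rw [e, ContinuousLinearMap.iteratedFDeriv_comp_right L (n := i) f.contDiff p le_rfl]
  refine (ContinuousMultilinearMap.norm_compContinuousLinearMap_le _ _).trans ?_
  rw [Finset.prod_const]
  refine (mul_le_of_le_one_right (norm_nonneg _) (pow_le_one₀ (norm_nonneg _) hL)).trans ?_
  refine (f.norm_iteratedFDeriv_le i (L p)).trans ?_
  rw [Fintype.card_fin]
  have h1 : ‖L p‖ ^ (m - i) ≤ ‖p.1‖ ^ (m - i) := by gcongr
  have h2 : (m.descFactorial i : ℝ) * ‖f‖ ≤ m.descFactorial i :=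
    mul_le_of_le_one_right (Nat.cast_nonneg _) hf
  exact mul_le_mul h2 h1 (by positivity) (by positivity)

/-- High powers of a coordinate are small with all derivatives on a ball of radius less than one. -/
theorem eventually_norm_iteratedFDeriv_fst_pow_mul_le {B : ℂ × ℝ → ℂ} (hB : ContDiff ℝ ∞ B)
    (hc : HasCompactSupport B) {q : ℝ} (hq0 : 0 < q) (hq1 : q < 1) (hs : ∀ p, B p ≠ 0 → ‖p.1‖ ≤ q)
    (j : ℕ) {δ : ℝ} (hδ : 0 < δ) :
    ∀ᶠ m : ℕ in atTop, ∀ i ≤ j, ∀ p, ‖iteratedFDeriv ℝ i (fun p => p.1 ^ m * B p) p‖ ≤ δ := by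
  obtain ⟨C, hC0, hC⟩ := exists_norm_iteratedFDeriv_le hB hc j
  -- Derivatives of order at most `j` cost only `m ^ j` and leave `q ^ (m - j)`; the Leibniz rule
  -- contributes `2 ^ j` and the cutoff contributes `C`.
  have hlim : Tendsto (fun m : ℕ => (m : ℝ) ^ j * q ^ m * (2 ^ j * C / q ^ j)) atTop (𝓝 0) := by
    have := (tendsto_pow_const_mul_const_pow_of_abs_lt_one j
      (by rwa [abs_of_pos hq0] : |q| < 1)).mul_const (2 ^ j * C / q ^ j)
    rwa [zero_mul] at this
  filter_upwards [hlim.eventually (gt_mem_nhds hδ), eventually_ge_atTop j, eventually_ge_atTop 1]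
    with m hm hmj hm1 i hi p
  by_cases hp : p ∈ tsupport B
  swap
  · have h1 : p ∉ tsupport fun p => p.1 ^ m * B p := fun h => hp (tsupport_mul_subset_right h)
    have h2 : iteratedFDeriv ℝ i (fun p => p.1 ^ m * B p) p = 0 := by
      by_contra h
      exact h1 (support_iteratedFDeriv_subset i h)
    rw [h2, norm_zero]
    exact hδ.le
  have hpq : ‖p.1‖ ≤ q := by
    have hcl : IsClosed {p : ℂ × ℝ | ‖p.1‖ ≤ q} :=
      isClosed_le (continuous_fst.norm) continuous_const
    exact closure_minimal (fun p hp => hs p hp) hcl hp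
  have hpow : ContDiff ℝ ∞ fun p : ℂ × ℝ => p.1 ^ m := contDiff_fst.pow m
  refine (norm_iteratedFDeriv_mul_le hpow hB p
    (n := i) (by exact_mod_cast le_top)).trans (le_trans ?_ hm.le)
  have hm1' : (1 : ℝ) ≤ m := by exact_mod_cast hm1
  have hterm : ∀ l ∈ Finset.range (i + 1),
      (i.choose l : ℝ) * ‖iteratedFDeriv ℝ l (fun p : ℂ × ℝ => p.1 ^ m) p‖ *
        ‖iteratedFDeriv ℝ (i - l) B p‖ ≤ (i.choose l : ℝ) * ((m : ℝ) ^ j * q ^ (m - j) * C) := by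
    intro l hl
    have hlj : l ≤ j := (Nat.lt_succ_iff.1 (Finset.mem_range.1 hl)).trans hi
    have h1 : ‖iteratedFDeriv ℝ l (fun p : ℂ × ℝ => p.1 ^ m) p‖ ≤ (m : ℝ) ^ j * q ^ (m - j) := by
      refine (norm_iteratedFDeriv_fst_pow_le m l p).trans ?_
      have h2 : (m.descFactorial l : ℝ) ≤ (m : ℝ) ^ j := by
        calc (m.descFactorial l : ℝ) ≤ (m : ℝ) ^ l := by exact_mod_cast Nat.descFactorial_le_pow m l
          _ ≤ (m : ℝ) ^ j := pow_le_pow_right₀ hm1' hlj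
      have h3 : ‖p.1‖ ^ (m - l) ≤ q ^ (m - j) :=
        (pow_le_pow_left₀ (norm_nonneg _) hpq _).trans
          (pow_le_pow_of_le_one hq0.le hq1.le (by omega))
      exact mul_le_mul h2 h3 (by positivity) (by positivity)
    rw [mul_assoc]
    exact mul_le_mul_of_nonneg_left (mul_le_mul h1 (hC _ (by omega) p) (norm_nonneg _)
      (by positivity)) (Nat.cast_nonneg _)
  refine (Finset.sum_le_sum hterm).trans ?_
  rw [← Finset.sum_mul]
  have hsum : ∑ l ∈ Finset.range (i + 1), (i.choose l : ℝ) = 2 ^ i := by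
    exact_mod_cast Nat.sum_range_choose i
  rw [hsum]
  have h2i : (2 : ℝ) ^ i ≤ 2 ^ j := pow_le_pow_right₀ one_le_two hi
  have hqm : q ^ m = q ^ (m - j) * q ^ j := by rw [← pow_add, Nat.sub_add_cancel hmj]
  have hqj : 0 < q ^ j := by positivity
  calc (2 : ℝ) ^ i * ((m : ℝ) ^ j * q ^ (m - j) * C) ≤ 2 ^ j * ((m : ℝ) ^ j * q ^ (m - j) * C) := by
        gcongr
    _ = _ := by rw [hqm]; field_simp

/-- Sums of high powers of a coordinate, cut off near a sequence of points. -/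
theorem exists_sum_fst_pow {r q : ℝ} (hr : 0 < r) (hrq : r < q) (hq1 : q < 1) {y : ℕ → ℝ} (hp : ∀ j, 0 < y j)
    (hy : ∀ j, y (j + 1) < y j / 4) {P : ℕ → ℕ → Prop} (hP : ∀ j, ∀ᶠ m in atTop, P j m) :
    ∃ (G : ℂ × ℝ → ℂ) (m : ℕ → ℕ), ContDiff ℝ ∞ G ∧ (∀ j, P j (m j)) ∧
      ∀ j (p : ℂ × ℝ), ‖p.1‖ ≤ r → p.2 ∈ Icc (y j - y j / 4) (y j + y j / 4) →
        G p = p.1 ^ m j := by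
  let χ : ContDiffBump (0 : ℂ) := ⟨r, q, hr, hrq⟩
  choose ρ hρ hρc hρ0 hρ1 using fun j => exists_cutoff (y j) (r := y j / 4) (R := y j / 2)
    (by linarith [hp j]) (by linarith [hp j])
  let B : ℕ → ℂ × ℝ → ℂ := fun j p => ((χ p.1 : ℝ) : ℂ) * ρ j p.2
  have hB : ∀ j, ContDiff ℝ ∞ (B j) := fun j =>
    ((Complex.ofRealCLM.contDiff.comp χ.contDiff).comp contDiff_fst).mul
      ((hρ j).comp contDiff_snd)
  have hBq : ∀ j p, B j p ≠ 0 → ‖p.1‖ ≤ q := by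
    intro j p h
    by_contra! hlt
    refine h ?_
    have : χ p.1 = 0 := χ.zero_of_le_dist (by rw [dist_zero_right]; exact hlt.le)
    simp [B, this]
  have hBc : ∀ j, HasCompactSupport (B j) := by
    intro j
    refine HasCompactSupport.intro' (K := Metric.closedBall (0 : ℂ) q ×ˢ tsupport (ρ j))
      ((isCompact_closedBall _ _).prod (hρc j)) (Metric.isClosed_closedBall.prod (isClosed_tsupport _))
      fun p hp => ?_
    by_contra h
    refine hp ⟨by simpa using hBq j p h, subset_tsupport _ fun h0 => h ?_⟩
    simp [B, h0]
  choose m hm1 hm2 using fun j => ((hP j).and (eventually_norm_iteratedFDeriv_fst_pow_mul_le (hB j)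
    (hBc j) (hr.trans hrq) hq1 (hBq j) j (by positivity : (0 : ℝ) < (1 / 2) ^ j))).exists
  refine ⟨fun p => ∑' j, p.1 ^ m j * B j p, m, contDiff_tsum_of_iteratedFDeriv_le
    (fun j => (contDiff_fst.pow _).mul (hB j)) hm2, hm1, fun j p hp1 hp2 => ?_⟩
  have hyj := hp j
  have h1 : p.2 ∈ Ioo (y j / 2) (3 * y j / 2) := ⟨by linarith [hp2.1], by linarith [hp2.2]⟩
  simp only []
  rw [tsum_eq_of_mem_Ioo hy hp (τ := Prod.snd) (φ := fun j p => p.1 ^ m j * B j p) ?_ h1]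
  · have h2 : χ p.1 = 1 := χ.one_of_mem_closedBall (by simpa using hp1)
    simp [B, h2, hρ1 j _ hp2]
  · intro i p h
    have : ρ i p.2 = 0 := hρ0 i _ fun h' => h ⟨by linarith [h'.1], by linarith [h'.2]⟩
    simp [B, this]

namespace CkIso

variable {n : ℕ} {k : ℕ∞} {M : Type*} [TopologicalSpace M]
  [ChartedSpace (EuclideanSpace ℝ (Fin n)) M]

theorem continuousOn_toFun_curve (Φ : CkIso n k M) {x : M} {ε : ℝ} {t : M → ℝ} {γ : ℝ → M}
    (hγ : IsLevelCurve n k x ε t γ) {f : M → ℂ} (hf : ContMDiff (𝓡 n) 𝓘(ℝ, ℂ) k f) :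
    ContinuousOn (fun s => Φ.toFun f (Φ.point (γ s))) (Ioo (-ε) ε) :=
  ((Φ.contMDiff_toFun hf).continuous.comp Φ.point.continuous).comp_continuousOn
    hγ.contMDiffOn.continuousOn

variable [IsManifold (𝓡 n) k M] [T2Space M]

/-- If the image had modulus above `c > 1` near `u x`, a single function `G (f, t)` could equal `f ^
m j` near points `γ (y j) → x`. It is `C^k` because high powers of a value below `1` are small with
all derivatives. With `c ^ m j ≥ j` its image is unbounded near `u x`, contradicting continuity. -/
theorem norm_toFun_le_one (Φ : CkIso n k M) (hn : 1 ≤ n) {f : M → ℂ}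
    (hf : ContMDiff (𝓡 n) 𝓘(ℝ, ℂ) k f) {x : M} (hx : ‖f x‖ < 1) :
    ‖Φ.toFun f (Φ.point x)‖ ≤ 1 := by
  by_contra! hcon
  obtain ⟨ε, t, γ, hγ⟩ := exists_isLevelCurve hn k x
  obtain ⟨q, hxq, hq1⟩ := exists_between hx
  obtain ⟨r, hxr, hrq⟩ := exists_between hxq
  obtain ⟨c, hc1, hc⟩ := exists_between hcon
  have h0 : (0 : ℝ) ∈ Ioo (-ε) ε := ⟨by linarith [hγ.pos], hγ.pos⟩
  have hnhds : Ioo (-ε) ε ∈ 𝓝 (0 : ℝ) := isOpen_Ioo.mem_nhds h0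
  have hγc : ContinuousAt γ 0 := hγ.contMDiffOn.continuousOn.continuousAt hnhds
  have hcont : ContinuousAt (fun s => ‖Φ.toFun f (Φ.point (γ s))‖) 0 :=
    ((Φ.continuousOn_toFun_curve hγ hf).continuousAt hnhds).norm
  have hcf : ContinuousAt (fun s => ‖f (γ s)‖) 0 :=
    (hf.continuous.continuousAt.comp hγc).norm
  have hev : ∀ᶠ s in 𝓝 (0 : ℝ), s ∈ Ioo (-ε) ε ∧ c < ‖Φ.toFun f (Φ.point (γ s))‖ ∧
      ‖f (γ s)‖ < r := by
    refine Eventually.and hnhds (Eventually.and ?_ ?_)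
    · exact hcont.eventually (lt_mem_nhds (by simpa [hγ.apply_zero] using hc))
    · exact hcf.eventually (gt_mem_nhds (by simpa [hγ.apply_zero] using hxr))
  obtain ⟨y, hy⟩ := exists_seq_of_frequently_nhdsGT
    (fun _ => (hev.filter_mono nhdsWithin_le_nhds).frequently) one_pos
  have hyp : ∀ j, 0 < y j := fun j => (hy j).1
  have hy4 : ∀ j, y (j + 1) < y j / 4 := fun j => (hy j).2.2.1
  have hyc : ∀ j, c < ‖Φ.toFun f (Φ.point (γ (y j)))‖ := fun j => (hy j).2.2.2.2.1
  have hyf : ∀ j, ‖f (γ (y j))‖ < r := fun j => (hy j).2.2.2.2.2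
  have hyε : ∀ j, y j ∈ Ioo (-ε) ε := fun j => (hy j).2.2.2.1
  obtain ⟨G, m, hG, hm, hGm⟩ := exists_sum_fst_pow ((norm_nonneg _).trans_lt hxr) hrq hq1 hyp hy4
    (P := fun j m => (j : ℝ) ≤ c ^ m)
    fun j => (tendsto_pow_atTop_atTop_of_one_lt hc1).eventually_ge_atTop _
  have hg : ContMDiff (𝓡 n) 𝓘(ℝ, ℂ) k fun z => G (f z, t z) :=
    (hG.of_le (by exact_mod_cast le_top)).contMDiff.comp (hf.prodMk_space hγ.contMDiff)
  have heq : ∀ j, Φ.toFun (fun z => G (f z, t z)) (Φ.point (γ (y j))) =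
      Φ.toFun f (Φ.point (γ (y j))) ^ m j := by
    intro j
    have hloc : (fun z => G (f z, t z)) =ᶠ[𝓝 (γ (y j))] f ^ m j := by
      have h1 : ∀ᶠ z in 𝓝 (γ (y j)), ‖f z‖ < r :=
        hf.continuous.norm.continuousAt.eventually (gt_mem_nhds (hyf j))
      have h2 : ∀ᶠ z in 𝓝 (γ (y j)), t z ∈ Icc (y j - y j / 4) (y j + y j / 4) := by
        refine hγ.contMDiff.continuous.continuousAt.eventually (Icc_mem_nhds ?_ ?_) <;>
        · rw [hγ.apply_curve _ (hyε j)]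
          linarith [hyp j]
      filter_upwards [h1, h2] with z hz1 hz2
      exact hGm j (f z, t z) hz1.le hz2
    rw [(Φ.map_congr hg (hf.pow_complex _) hloc).self_of_nhds, Φ.toFun_pow hf]
    rfl
  have hlim : Tendsto (fun j => ‖Φ.toFun (fun z => G (f z, t z)) (Φ.point (γ (y j)))‖) atTop
      (𝓝 ‖Φ.toFun (fun z => G (f z, t z)) (Φ.point (γ 0))‖) :=
    ((Φ.continuousOn_toFun_curve hγ hg).continuousAt hnhds).norm.tendsto.comp
      (tendsto_of_lt_div_pow hyp fun j => (hy j).2.1)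
  refine not_tendsto_nhds_of_tendsto_atTop (tendsto_atTop_mono (fun j => ?_)
    tendsto_natCast_atTop_atTop) _ hlim
  rw [heq, norm_pow]
  exact (hm j).trans (pow_le_pow_left₀ (zero_le_one.trans hc1.le) (hyc j).le _)

/-- Division by `g`, through a local inverse, reduces this to `norm_toFun_le_one`. -/
theorem norm_toFun_le_of_norm_lt (Φ : CkIso n k M) (hn : 1 ≤ n) {f g : M → ℂ}
    (hf : ContMDiff (𝓡 n) 𝓘(ℝ, ℂ) k f) (hg : ContMDiff (𝓡 n) 𝓘(ℝ, ℂ) k g) {x : M}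
    (hx : ‖f x‖ < ‖g x‖) : ‖Φ.toFun f (Φ.point x)‖ ≤ ‖Φ.toFun g (Φ.point x)‖ := by
  have hgx : g x ≠ 0 := norm_pos_iff.1 ((norm_nonneg _).trans_lt hx)
  obtain ⟨h, hh, hgh⟩ := exists_local_inv hg hgx
  have h1 : g x * h x = 1 := hgh.self_of_nhds
  have h2 := Φ.toFun_mul_eq_one hg hh hgh
  have h3 : ‖(f * h) x‖ < 1 := by
    have h4 : ‖g x‖ * ‖h x‖ = 1 := by rw [← norm_mul, h1, norm_one]
    rw [Pi.mul_apply, norm_mul, ← h4]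
    have h5 : 0 < ‖h x‖ := norm_pos_iff.2 (right_ne_zero_of_mul_eq_one h1)
    gcongr
  have h6 := Φ.norm_toFun_le_one hn (hf.mul_complex hh) h3
  rw [Φ.map_mul hf hh, Pi.mul_apply, norm_mul] at h6
  have h7 : ‖Φ.toFun g (Φ.point x)‖ * ‖Φ.toFun h (Φ.point x)‖ = 1 := by rw [← norm_mul, h2, norm_one]
  rw [← h7] at h6
  exact le_of_mul_le_mul_right h6 (norm_pos_iff.2 (right_ne_zero_of_mul_eq_one h2))

/-- The modulus is transformed by a power. -/
theorem exists_norm_toFun_eq_rpow (Φ : CkIso n k M) (hn : 1 ≤ n) (x : M) :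
    ∃ a : ℝ, ∀ f, ContMDiff (𝓡 n) 𝓘(ℝ, ℂ) k f → f x ≠ 0 →
      Real.log ‖Φ.toFun f (Φ.point x)‖ = a * Real.log ‖f x‖ := by
  let e : ℝ → M → ℂ := fun s _ => (Real.exp s : ℝ)
  have he : ∀ s, ContMDiff (𝓡 n) 𝓘(ℝ, ℂ) k (e s) := fun s => contMDiff_const
  have hen : ∀ s, ‖e s x‖ = Real.exp s := fun s => by
    simp only [e, Complex.norm_real, Real.norm_eq_abs, Real.abs_exp]
  have hne : ∀ s, Φ.toFun (e s) (Φ.point x) ≠ 0 := fun s => Φ.toFun_ne_zero (he s)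
    (norm_pos_iff.1 (by rw [hen]; exact Real.exp_pos s))
  have hadd : ∀ s t, e (s + t) = e s * e t := fun s t => by
    funext y
    simp only [e, Real.exp_add, Complex.ofReal_mul, Pi.mul_apply]
  -- On positive constants the logarithm of the image modulus is additive and monotone, hence
  -- linear. A general `f` is then squeezed between constants slightly above and below `‖f x‖`.
  let L : ℝ →+ ℝ := AddMonoidHom.mk' (fun s => Real.log ‖Φ.toFun (e s) (Φ.point x)‖) fun s t => by
    rw [hadd, Φ.map_mul (he s) (he t), Pi.mul_apply, norm_mul,
      Real.log_mul (norm_ne_zero_iff.2 (hne s)) (norm_ne_zero_iff.2 (hne t))]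
  have hmono : Monotone L := by
    intro s t hst
    rcases hst.eq_or_lt with rfl | h
    · exact le_rfl
    · refine Real.log_le_log (norm_pos_iff.2 (hne s)) (Φ.norm_toFun_le_of_norm_lt hn (he s) (he t) ?_)
      rw [hen, hen]
      exact Real.exp_lt_exp.2 h
  have hL : ∀ s, L s = s * L 1 := by
    intro s
    have := map_real_smul L (MeasureTheory.Measure.AddMonoidHom.continuous_of_measurable L hmono.measurable) s 1
    simpa using this
  refine ⟨L 1, fun f hf hfx => ?_⟩
  have hfp := norm_pos_iff.2 (Φ.toFun_ne_zero hf hfx)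
  have hup : ∀ s, Real.log ‖f x‖ < s → Real.log ‖Φ.toFun f (Φ.point x)‖ ≤ s * L 1 := by
    intro s hs
    rw [← hL]
    refine Real.log_le_log hfp (Φ.norm_toFun_le_of_norm_lt hn hf (he s) ?_)
    rw [hen]
    exact (Real.log_lt_iff_lt_exp (norm_pos_iff.2 hfx)).1 hs
  have hlo : ∀ s, s < Real.log ‖f x‖ → s * L 1 ≤ Real.log ‖Φ.toFun f (Φ.point x)‖ := by
    intro s hs
    rw [← hL]
    refine Real.log_le_log (norm_pos_iff.2 (hne s)) (Φ.norm_toFun_le_of_norm_lt hn (he s) hf ?_)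
    rw [hen]
    exact (Real.lt_log_iff_exp_lt (norm_pos_iff.2 hfx)).1 hs
  have hc : ∀ l : Filter ℝ, l ≤ 𝓝 (Real.log ‖f x‖) →
      Tendsto (fun s => s * L 1) l (𝓝 (L 1 * Real.log ‖f x‖)) := fun l hl => by
    rw [mul_comm]
    exact (tendsto_id.mul_const (L 1)).mono_left hl
  refine le_antisymm ?_ ?_
  · exact ge_of_tendsto (hc (𝓝[>] _) nhdsWithin_le_nhds)
      (eventually_nhdsWithin_of_forall fun s hs => hup s hs)
  · exact le_of_tendsto (hc (𝓝[<] _) nhdsWithin_le_nhds)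
      (eventually_nhdsWithin_of_forall fun s hs => hlo s hs)

end CkIso

/-- A continuous map of manifolds is `C^k` if its composition with every real `C^k` function is. -/
theorem contMDiff_of_forall_contMDiff_comp {n : ℕ} {k : ℕ∞} {M : Type*} [TopologicalSpace M]
    [ChartedSpace (EuclideanSpace ℝ (Fin n)) M] [IsManifold (𝓡 n) k M] [T2Space M] {v : M → M}
    (hv : Continuous v) (h : ∀ H : M → ℝ, ContMDiff (𝓡 n) 𝓘(ℝ, ℝ) k H →
      ContMDiff (𝓡 n) 𝓘(ℝ, ℝ) k fun y => H (v y)) : ContMDiff (𝓡 n) (𝓡 n) k v := by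
  intro y
  rw [contMDiffAt_iff_target]
  refine ⟨hv.continuousAt, ?_⟩
  have h2 := contMDiffOn_extChartAt (I := 𝓡 n) (n := (k : WithTop ℕ∞)) (x := v y)
  rw [← extChartAt_source (𝓡 n)] at h2
  obtain ⟨c, hc, -, -, hce⟩ := exists_contMDiff_eventuallyEq (isOpen_extChartAt_source (v y))
    (mem_extChartAt_source (v y)) h2 (univ_mem (f := 𝓝 (v y)))
  have h3 : (extChartAt (𝓡 n) (v y) ∘ v) =ᶠ[𝓝 y] fun z => c (v z) :=
    (hv.continuousAt.eventually hce).mono fun z hz => hz.symm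
  refine ContMDiffAt.congr_of_eventuallyEq ?_ h3
  have h4 : ContMDiff (𝓡 n) 𝓘(ℝ, Fin n → ℝ) k fun z => (EuclideanSpace.equiv (Fin n) ℝ) (c (v z)) := by
    rw [contMDiff_pi_space]
    intro i
    have h5 : ContMDiff (𝓡 n) 𝓘(ℝ, ℝ) k fun z => c z i :=
      (contDiff_piLp_apply (p := 2) (i := i)).contMDiff.comp hc
    exact h _ h5
  have h6 := (EuclideanSpace.equiv (Fin n) ℝ).symm.contDiff.contMDiff.comp h4
  exact h6.contMDiffAt

namespace CkIso

variable {n : ℕ} {k : ℕ∞} {M : Type*} [TopologicalSpace M]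
  [ChartedSpace (EuclideanSpace ℝ (Fin n)) M] [IsManifold (𝓡 n) k M] [T2Space M]

open Classical in
/-- The exponent in the transformation law of the modulus. -/
noncomputable def exponent (Φ : CkIso n k M) (x : M) : ℝ :=
  if hn : 1 ≤ n then (Φ.exists_norm_toFun_eq_rpow hn x).choose else 0

theorem log_norm_toFun (Φ : CkIso n k M) (hn : 1 ≤ n) {f : M → ℂ}
    (hf : ContMDiff (𝓡 n) 𝓘(ℝ, ℂ) k f) {x : M} (hx : f x ≠ 0) :
    Real.log ‖Φ.toFun f (Φ.point x)‖ = Φ.exponent x * Real.log ‖f x‖ := by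
  rw [exponent, dif_pos hn]
  exact (Φ.exists_norm_toFun_eq_rpow hn x).choose_spec f hf hx

omit [IsManifold (𝓡 n) k M] [T2Space M] in
theorem contMDiff_log_norm {f : M → ℂ} (hf : ContMDiff (𝓡 n) 𝓘(ℝ, ℂ) k f) (h0 : ∀ x, f x ≠ 0) :
    ContMDiff (𝓡 n) 𝓘(ℝ, ℝ) k fun x => Real.log ‖f x‖ := by
  intro x
  have h1 : ContDiffAt ℝ k (fun z : ℂ => Real.log ‖z‖) (f x) :=
    (contDiffAt_norm ℝ (h0 x)).log (norm_ne_zero_iff.2 (h0 x))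
  exact h1.contMDiffAt.comp x hf.contMDiffAt

theorem exponent_mul_exponent (Φ : CkIso n k M) (hn : 1 ≤ n) (x : M) :
    Φ.symm.exponent (Φ.point x) * Φ.exponent x = 1 := by
  have hc : ContMDiff (𝓡 n) 𝓘(ℝ, ℂ) k (fun _ : M => (2 : ℂ)) := contMDiff_const
  have h1 := Φ.log_norm_toFun hn hc (x := x) two_ne_zero
  have h2 := Φ.symm.log_norm_toFun hn (Φ.contMDiff_toFun hc) (Φ.toFun_ne_zero hc (x := x) two_ne_zero)
  have e1 : Φ.symm.toFun (Φ.toFun fun _ => 2) = fun _ => 2 := Φ.inv_toFun hc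
  have hlog : Real.log ‖(2 : ℂ)‖ ≠ 0 := by
    rw [Complex.norm_ofNat]
    exact (Real.log_pos one_lt_two).ne'
  rw [e1, h1, ← mul_assoc] at h2
  exact (mul_eq_right₀ hlog).1 h2.symm

theorem exponent_ne_zero (Φ : CkIso n k M) (hn : 1 ≤ n) (x : M) : Φ.exponent x ≠ 0 :=
  right_ne_zero_of_mul_eq_one (Φ.exponent_mul_exponent hn x)

/-- The power law for the preimage `g` of the constant `2` gives the exponent as `log 2 / log ‖g‖`.
Using the image of `2` instead would only control the exponent composed with `u⁻¹`, and `u` is not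
yet known to be smooth. -/
theorem contMDiff_exponent (Φ : CkIso n k M) (hn : 1 ≤ n) :
    ContMDiff (𝓡 n) 𝓘(ℝ, ℝ) k Φ.exponent := by
  have hc : ContMDiff (𝓡 n) 𝓘(ℝ, ℂ) k (fun _ : M => (2 : ℂ)) := contMDiff_const
  have hg := Φ.contMDiff_invFun hc
  have e1 : Φ.toFun (Φ.invFun fun _ => 2) = fun _ => 2 := Φ.toFun_inv hc
  have h0 : ∀ x, Φ.invFun (fun _ => 2) x ≠ 0 := fun x h => by
    have := (Φ.toFun_eq_zero_iff hg).2 h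
    rw [e1] at this
    exact two_ne_zero this
  have hlog : Real.log 2 ≠ 0 := (Real.log_pos one_lt_two).ne'
  have h1 : ∀ x, Real.log 2 = Φ.exponent x * Real.log ‖Φ.invFun (fun _ => 2) x‖ := fun x => by
    rw [← Φ.log_norm_toFun hn hg (h0 x), e1, Complex.norm_ofNat]
  have hne : ∀ x, Real.log ‖Φ.invFun (fun _ => 2) x‖ ≠ 0 := fun x h => by
    have := h1 x
    rw [h, mul_zero] at this
    exact hlog this
  have h2 : Φ.exponent = fun x => Real.log 2 * (Real.log ‖Φ.invFun (fun _ => 2) x‖)⁻¹ := by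
    funext x
    rw [h1 x, mul_assoc, mul_inv_cancel₀ (hne x), mul_one]
  rw [h2]
  intro x
  have h3 : ContDiffAt ℝ k (fun r : ℝ => Real.log 2 * r⁻¹) (Real.log ‖Φ.invFun (fun _ => 2) x‖) :=
    contDiffAt_const.mul (contDiffAt_inv ℝ (hne x))
  exact ContMDiffAt.comp (g := fun r : ℝ => Real.log 2 * r⁻¹) x h3.contMDiffAt
    (contMDiff_log_norm hg h0).contMDiffAt

/-- With `a` the exponent, the image of `exp (H / a)` has modulus `exp (H ∘ u⁻¹)`, so composition
with `u⁻¹` preserves real `C^k` functions. -/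
theorem contMDiff_symm_point (Φ : CkIso n k M) (hn : 1 ≤ n) :
    ContMDiff (𝓡 n) (𝓡 n) k Φ.point.symm := by
  refine contMDiff_of_forall_contMDiff_comp Φ.point.symm.continuous fun H hH => ?_
  have hF : ContMDiff (𝓡 n) 𝓘(ℝ, ℂ) k
      fun x => Complex.exp (((Φ.exponent x)⁻¹ * H x : ℝ) : ℂ) := by
    intro x
    have h1 : ContDiffAt ℝ k (fun p : ℝ × ℝ => Complex.exp ((p.1⁻¹ * p.2 : ℝ) : ℂ))
        (Φ.exponent x, H x) :=
      (Complex.ofRealCLM.contDiff.contDiffAt.comp _ ((contDiffAt_fst.inv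
        (Φ.exponent_ne_zero hn x)).mul contDiffAt_snd)).cexp
    exact ContMDiffAt.comp (g := fun p : ℝ × ℝ => Complex.exp ((p.1⁻¹ * p.2 : ℝ) : ℂ)) x
      h1.contMDiffAt ((Φ.contMDiff_exponent hn).prodMk_space hH).contMDiffAt
  have hΦ0 : ∀ y, Φ.toFun (fun x => Complex.exp (((Φ.exponent x)⁻¹ * H x : ℝ) : ℂ)) y ≠ 0 := by
    intro y
    have := Φ.toFun_ne_zero hF (x := Φ.point.symm y) (Complex.exp_ne_zero _)
    rwa [Φ.point.apply_symm_apply] at this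
  have h2 := contMDiff_log_norm (Φ.contMDiff_toFun hF) hΦ0
  convert h2 using 2 with y
  have h3 := Φ.log_norm_toFun hn hF (x := Φ.point.symm y) (Complex.exp_ne_zero _)
  rw [Φ.point.apply_symm_apply] at h3
  rw [h3, Complex.norm_exp, Real.log_exp, Complex.ofReal_re, mul_inv_cancel_left₀
    (Φ.exponent_ne_zero hn _)]

theorem contMDiff_point (Φ : CkIso n k M) (hn : 1 ≤ n) : ContMDiff (𝓡 n) (𝓡 n) k Φ.point :=
  Φ.symm.contMDiff_symm_point hn

theorem contDiffOn_toFun_curve (Φ : CkIso n k M) (hn : 1 ≤ n) {x : M} {ε : ℝ} {t : M → ℝ}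
    {γ : ℝ → M} (hγ : IsLevelCurve n k x ε t γ) {f : M → ℂ} (hf : ContMDiff (𝓡 n) 𝓘(ℝ, ℂ) k f) :
    ContDiffOn ℝ k (fun s => Φ.toFun f (Φ.point (γ s))) (Ioo (-ε) ε) :=
  (((Φ.contMDiff_toFun hf).comp (Φ.contMDiff_point hn)).comp_contMDiffOn
    hγ.contMDiffOn).contDiffOn

/-- Along the curve the image of the coordinate `t` has modulus `s ^ a(γ s)` for `s > 0`. It is
differentiable and vanishes at `0`, hence is `O(s)`. Dividing logarithms by `log s < 0` gives `a(γ
s) ≥ 1 + log C / log s`, which tends to `1`. -/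
theorem one_le_exponent (Φ : CkIso n k M) (hn : 1 ≤ n) (hk : 1 ≤ k) (x : M) :
    1 ≤ Φ.exponent x := by
  obtain ⟨ε, t, γ, hγ⟩ := exists_isLevelCurve hn k x
  have h0 : (0 : ℝ) ∈ Ioo (-ε) ε := ⟨by linarith [hγ.pos], hγ.pos⟩
  have hnhds : Ioo (-ε) ε ∈ 𝓝 (0 : ℝ) := isOpen_Ioo.mem_nhds h0
  have ht : ContMDiff (𝓡 n) 𝓘(ℝ, ℂ) k fun y => (t y : ℂ) :=
    Complex.ofRealCLM.contDiff.contMDiff.comp hγ.contMDiff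
  have hd : DifferentiableAt ℝ (fun s => Φ.toFun (fun y => (t y : ℂ)) (Φ.point (γ s))) 0 :=
    ((Φ.contDiffOn_toFun_curve hn hγ ht).contDiffAt hnhds).differentiableAt
      (by
        have : (1 : WithTop ℕ∞) ≤ k := by exact_mod_cast hk
        exact (zero_lt_one.trans_le this).ne')
  have hz : Φ.toFun (fun y => (t y : ℂ)) (Φ.point (γ 0)) = 0 := by
    rw [Φ.toFun_eq_zero_iff ht, hγ.apply_curve 0 h0, Complex.ofReal_zero]
  obtain ⟨C, hC0, hC⟩ := hd.isBigO_sub.exists_pos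
  have hC' := hC.bound
  simp only [hz, sub_zero] at hC'
  have hcont : Tendsto (fun s => Φ.exponent (γ s)) (𝓝[>] 0) (𝓝 (Φ.exponent x)) := by
    have h1 := ((Φ.contMDiff_exponent hn).continuous.comp_continuousOn
      hγ.contMDiffOn.continuousOn).continuousAt hnhds
    rw [ContinuousAt, Function.comp_apply, hγ.apply_zero] at h1
    exact h1.mono_left nhdsWithin_le_nhds
  have hlim : Tendsto (fun s : ℝ => 1 + Real.log C / Real.log s) (𝓝[>] 0) (𝓝 1) := by
    simpa using (Real.tendsto_log_nhdsGT_zero.const_div_atBot (Real.log C)).const_add 1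
  refine le_of_tendsto_of_tendsto hlim hcont ?_
  filter_upwards [hC'.filter_mono nhdsWithin_le_nhds, nhdsWithin_le_nhds hnhds,
    Ioo_mem_nhdsGT one_pos] with s hs hsε hs1
  have hts := hγ.apply_curve s hsε
  have hne : (t (γ s) : ℂ) ≠ 0 := by
    rw [hts]
    exact_mod_cast hs1.1.ne'
  have h2 := Φ.log_norm_toFun hn ht (x := γ s) hne
  rw [hts, Complex.norm_real, Real.norm_of_nonneg hs1.1.le] at h2
  rw [Real.norm_of_nonneg hs1.1.le] at hs
  have h3 := Real.log_le_log (norm_pos_iff.2 (Φ.toFun_ne_zero ht hne)) hs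
  rw [h2, Real.log_mul hC0.ne' hs1.1.ne'] at h3
  have hneg : Real.log s < 0 := Real.log_neg hs1.1 hs1.2
  have h4 : 1 + Real.log C / Real.log s = (Real.log C + Real.log s) / Real.log s := by
    field_simp [hneg.ne]
    ring
  rw [h4, div_le_iff_of_neg hneg]
  exact h3

theorem exponent_eq_one (Φ : CkIso n k M) (hn : 1 ≤ n) (hk : 1 ≤ k) (x : M) :
    Φ.exponent x = 1 := by
  have h1 := Φ.one_le_exponent hn hk x
  have h2 := Φ.symm.one_le_exponent hn hk (Φ.point x)
  have h3 := Φ.exponent_mul_exponent hn x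
  nlinarith

theorem norm_toFun (Φ : CkIso n k M) (hn : 1 ≤ n) (hk : 1 ≤ k) {f : M → ℂ}
    (hf : ContMDiff (𝓡 n) 𝓘(ℝ, ℂ) k f) (x : M) : ‖Φ.toFun f (Φ.point x)‖ = ‖f x‖ := by
  by_cases hx : f x = 0
  · rw [(Φ.toFun_eq_zero_iff hf).2 hx, hx]
  · have h := Φ.log_norm_toFun hn hf hx
    rw [Φ.exponent_eq_one hn hk, one_mul] at h
    exact Real.log_injOn_pos (norm_pos_iff.2 (Φ.toFun_ne_zero hf hx)) (norm_pos_iff.2 hx) h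

end CkIso

/-! ### From the modulus to the values: phases, constants and the sign. -/

/-- Reparametrization of a curve by the values of a function with nonzero derivative along it. -/
theorem IsLevelCurve.exists_reparametrization {n : ℕ} {k : ℕ∞} (hk : 1 ≤ k) {M : Type*}
    [TopologicalSpace M] [ChartedSpace (EuclideanSpace ℝ (Fin n)) M] {x : M} {ε : ℝ} {t : M → ℝ}
    {γ : ℝ → M} (hγ : IsLevelCurve n k x ε t γ) {φ : M → ℝ} (hφ : ContMDiff (𝓡 n) 𝓘(ℝ, ℝ) k φ)
    (h0 : φ x = 0) (hd : deriv (fun s => φ (γ s)) 0 ≠ 0) : ∃ ε' γ', IsLevelCurve n k x ε' φ γ' := by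
  have hk' : (1 : WithTop ℕ∞) ≤ k := by exact_mod_cast hk
  have hk0 : (k : WithTop ℕ∞) ≠ 0 := (zero_lt_one.trans_le hk').ne'
  have h0ε : (0 : ℝ) ∈ Ioo (-ε) ε := ⟨by linarith [hγ.pos], hγ.pos⟩
  have hf : ContDiffOn ℝ k (fun s => φ (γ s)) (Ioo (-ε) ε) :=
    (hφ.comp_contMDiffOn hγ.contMDiffOn).contDiffOn
  have hf0 : ContDiffAt ℝ k (fun s => φ (γ s)) 0 := hf.contDiffAt (isOpen_Ioo.mem_nhds h0ε)
  have hder := (hf0.differentiableAt hk0).hasDerivAt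
  have hderc : ContinuousAt (deriv fun s => φ (γ s)) 0 :=
    (hf.continuousOn_deriv_of_isOpen isOpen_Ioo hk').continuousAt (isOpen_Ioo.mem_nhds h0ε)
  let e := hf0.toOpenPartialHomeomorph (f' := ContinuousLinearEquiv.unitsEquivAut ℝ (Units.mk0 _ hd))
    (fun s => φ (γ s)) hder hk0
  have hes : (0 : ℝ) ∈ e.source := hf0.mem_toOpenPartialHomeomorph_source
    (f' := ContinuousLinearEquiv.unitsEquivAut ℝ (Units.mk0 _ hd)) hder hk0
  have he0 : e 0 = 0 := by
    change φ (γ 0) = 0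
    rw [hγ.apply_zero, h0]
  have het : (0 : ℝ) ∈ e.target := by
    rw [← he0]
    exact e.map_source hes
  have hse0 : e.symm 0 = 0 := by
    conv_lhs => rw [← he0]
    exact e.left_inv hes
  have hsc : ContinuousAt e.symm 0 := e.continuousAt_symm het
  have hev : ∀ᶠ s in 𝓝 (0 : ℝ), s ∈ e.target ∧ e.symm s ∈ Ioo (-ε) ε ∧
      deriv (fun s => φ (γ s)) (e.symm s) ≠ 0 := by
    refine Eventually.and (e.open_target.mem_nhds het) (Eventually.and ?_ ?_)
    · exact hsc.eventually_mem (isOpen_Ioo.mem_nhds (by rwa [hse0]))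
    · rw [ContinuousAt, hse0] at hsc
      exact hsc.eventually (hderc.eventually_ne hd)
  obtain ⟨ε', hε', hball⟩ := Metric.eventually_nhds_iff_ball.1 hev
  rw [Real.ball_eq_Ioo, zero_sub, zero_add] at hball
  refine ⟨ε', fun s => γ (e.symm s), hε', ?_, ?_, hφ, fun s hs => e.right_inv (hball s hs).1⟩
  · have h1 : ContDiffOn ℝ k e.symm (Ioo (-ε') ε') := by
      intro s hs
      obtain ⟨h2, h3, h4⟩ := hball s hs
      have h5 := hf.contDiffAt (isOpen_Ioo.mem_nhds h3)
      exact (e.contDiffAt_symm_deriv h4 h2 (h5.differentiableAt hk0).hasDerivAt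
        h5).contDiffWithinAt
    exact hγ.contMDiffOn.comp h1.contMDiffOn fun s hs => (hball s hs).2.1
  · rw [hse0, hγ.apply_zero]

namespace CkIso

variable {n : ℕ} {k : ℕ∞} {M : Type*} [TopologicalSpace M]
  [ChartedSpace (EuclideanSpace ℝ (Fin n)) M] [IsManifold (𝓡 n) k M] [T2Space M]

theorem isModulusOperator (Φ : CkIso n k M) (hn : 1 ≤ n) (hk : 1 ≤ k) {x : M} {ε : ℝ} {t : M → ℝ}
    {γ : ℝ → M} (hγ : IsLevelCurve n k x ε t γ) :
    IsModulusOperator ε fun G s => Φ.toFun (fun y => G (t y)) (Φ.point (γ s)) := by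
  have hG : ∀ {G : ℝ → ℂ}, ContDiff ℝ ∞ G → ContMDiff (𝓡 n) 𝓘(ℝ, ℂ) k fun y => G (t y) :=
    fun h => (h.of_le (by exact_mod_cast le_top)).contMDiff.comp hγ.contMDiff
  refine ⟨hγ.pos, fun {G H} h1 h2 y _ => ?_, fun {G} h y hy => ?_, fun {G H} h1 h2 y hy h => ?_,
    fun {G} h => ?_⟩
  · exact congrFun (Φ.map_mul (hG h1) (hG h2)) _
  · rw [Φ.norm_toFun hn hk (hG h), hγ.apply_curve y hy]
  · refine (Φ.map_congr (hG h1) (hG h2) ?_).self_of_nhds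
    have h3 := hγ.contMDiff.continuous.continuousAt (x := γ y)
    rw [ContinuousAt, hγ.apply_curve y hy] at h3
    exact h3.eventually h
  · exact (Φ.contDiffOn_toFun_curve hn hγ (hG h)).of_le (by exact_mod_cast hk)

/-- When `φ` has nonzero derivative along a coordinate curve it can serve as the parameter, and the
one-dimensional result applies. Otherwise both `φ + t` and `t` can serve, and multiplicativity
divides out `exp (ζ t)`. -/
theorem toFun_exp_mul_eq_one (Φ : CkIso n k M) (hn : 1 ≤ n) (hk : 1 ≤ k) {φ : M → ℝ}
    (hφ : ContMDiff (𝓡 n) 𝓘(ℝ, ℝ) k φ) {x : M} (h0 : φ x = 0) (ζ : ℂ) :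
    Φ.toFun (fun y => Complex.exp (ζ * φ y)) (Φ.point x) = 1 := by
  have key : ∀ {φ : M → ℝ} {ε γ}, IsLevelCurve n k x ε φ γ →
      Φ.toFun (fun y => Complex.exp (ζ * φ y)) (Φ.point x) = 1 := by
    intro φ ε γ hγ
    have h := (Φ.isModulusOperator hn hk hγ).map_exp_mul_and_const.1 ζ
    rwa [hγ.apply_zero] at h
  have hexp : ∀ {φ : M → ℝ}, ContMDiff (𝓡 n) 𝓘(ℝ, ℝ) k φ →
      ContMDiff (𝓡 n) 𝓘(ℝ, ℂ) k fun y => Complex.exp (ζ * φ y) := fun h => by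
    have h1 : ContDiff ℝ k fun r : ℝ => Complex.exp (ζ * r) :=
      (contDiff_const.mul Complex.ofRealCLM.contDiff).cexp
    exact h1.contMDiff.comp h
  obtain ⟨ε, t, γ, hγ⟩ := exists_isLevelCurve hn k x
  by_cases hd : deriv (fun s => φ (γ s)) 0 = 0
  swap
  · obtain ⟨ε', γ', hγ'⟩ := hγ.exists_reparametrization hk hφ h0 hd
    exact key hγ'
  have h0ε : (0 : ℝ) ∈ Ioo (-ε) ε := ⟨by linarith [hγ.pos], hγ.pos⟩
  have hnhds : Ioo (-ε) ε ∈ 𝓝 (0 : ℝ) := isOpen_Ioo.mem_nhds h0ε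
  have hk0 : (k : WithTop ℕ∞) ≠ 0 := by
    have : (1 : WithTop ℕ∞) ≤ k := by exact_mod_cast hk
    exact (zero_lt_one.trans_le this).ne'
  have ht0 : t x = 0 := by rw [← hγ.apply_zero, hγ.apply_curve 0 h0ε]
  have hφt : ContMDiff (𝓡 n) 𝓘(ℝ, ℝ) k fun y => φ y + t y := hφ.add hγ.contMDiff
  have hdt : deriv (fun s => φ (γ s) + t (γ s)) 0 ≠ 0 := by
    have h1 : HasDerivAt (fun s => φ (γ s)) 0 0 := by
      have := (((hφ.comp_contMDiffOn hγ.contMDiffOn).contDiffOn.contDiffAt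
        hnhds).differentiableAt hk0).hasDerivAt
      rwa [show deriv (φ ∘ γ) 0 = 0 from hd] at this
    have h2 : HasDerivAt (fun s => t (γ s)) 1 0 :=
      (hasDerivAt_id (0 : ℝ)).congr_of_eventuallyEq (by
        filter_upwards [hnhds] with s hs
        exact hγ.apply_curve s hs)
    rw [(h1.fun_add h2).deriv]
    norm_num
  obtain ⟨ε', γ', hγ'⟩ := hγ.exists_reparametrization hk hφt (by simp [h0, ht0]) hdt
  have h3 := key hγ'
  have h4 : (fun y => Complex.exp (ζ * (φ y + t y : ℝ))) =
      (fun y => Complex.exp (ζ * φ y)) * fun y => Complex.exp (ζ * t y) := by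
    funext y
    rw [Pi.mul_apply, ← Complex.exp_add, Complex.ofReal_add, mul_add]
  rwa [h4, Φ.map_mul (hexp hφ) (hexp hγ.contMDiff), Pi.mul_apply, key hγ, mul_one] at h3

theorem exists_toFun_const (Φ : CkIso n k M) (hn : 1 ≤ n) (hk : 1 ≤ k) (x : M) :
    ∃ ν : ℤ, ∀ c : ℂ, Φ.toFun (fun _ => c) (Φ.point x) =
      ‖c‖ * Complex.exp (ν * c.arg * Complex.I) := by
  obtain ⟨ε, t, γ, hγ⟩ := exists_isLevelCurve hn k x
  have h := (Φ.isModulusOperator hn hk hγ).map_exp_mul_and_const.2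
  rwa [hγ.apply_zero] at h

/-- The value of the image of a function depends only on the value of the function. -/
theorem toFun_eq_toFun_const (Φ : CkIso n k M) (hn : 1 ≤ n) (hk : 1 ≤ k) {f : M → ℂ}
    (hf : ContMDiff (𝓡 n) 𝓘(ℝ, ℂ) k f) (x : M) :
    Φ.toFun f (Φ.point x) = Φ.toFun (fun _ => f x) (Φ.point x) := by
  have hconst : ContMDiff (𝓡 n) 𝓘(ℝ, ℂ) k fun _ : M => f x := contMDiff_const
  by_cases hx : f x = 0
  · rw [(Φ.toFun_eq_zero_iff hf).2 hx, (Φ.toFun_eq_zero_iff hconst).2 hx]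
  -- On `V` the principal logarithm writes `f` as `f x * exp φ * exp (iψ)`, where `φ` and `ψ` are
  -- real and vanish at `x`; both exponentials have image `1` at `u x`.
  let V : Set M := {y | f y / f x ∈ Complex.slitPlane}
  have hV : IsOpen V := Complex.isOpen_slitPlane.preimage (hf.continuous.div_const _)
  have hxV : x ∈ V := by
    change f x / f x ∈ Complex.slitPlane
    rw [div_self hx]
    exact Complex.one_mem_slitPlane
  have hlog : ∀ L : ℂ →L[ℝ] ℝ,
      ContMDiffOn (𝓡 n) 𝓘(ℝ, ℝ) k (fun y => L (Complex.log (f y / f x))) V := by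
    intro L y hy
    have h1 : ContDiffAt ℝ k (fun z : ℂ => L (Complex.log (z / f x))) (f y) := by
      have h2 : ContDiffAt ℝ k Complex.log (f y / f x) :=
        (Complex.contDiffAt_log hy).restrict_scalars ℝ
      exact L.contDiff.contDiffAt.comp _ (h2.comp (f := fun z => z / f x) (f y)
        (contDiffAt_id.div_const _))
    exact (ContMDiffAt.comp (g := fun z : ℂ => L (Complex.log (z / f x))) y h1.contMDiffAt
      hf.contMDiffAt).contMDiffWithinAt
  obtain ⟨φ, hφ, -, -, hφe⟩ := exists_contMDiff_eventuallyEq hV hxV (hlog Complex.reCLM)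
    (univ_mem (f := 𝓝 x))
  obtain ⟨ψ, hψ, -, -, hψe⟩ := exists_contMDiff_eventuallyEq hV hxV (hlog Complex.imCLM)
    (univ_mem (f := 𝓝 x))
  have hφ0 : φ x = 0 := by simpa [div_self hx] using hφe.self_of_nhds
  have hψ0 : ψ x = 0 := by simpa [div_self hx] using hψe.self_of_nhds
  have hexp : ∀ (ζ : ℂ) {φ : M → ℝ}, ContMDiff (𝓡 n) 𝓘(ℝ, ℝ) k φ →
      ContMDiff (𝓡 n) 𝓘(ℝ, ℂ) k fun y => Complex.exp (ζ * φ y) := fun ζ φ h => by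
    have h1 : ContDiff ℝ k fun r : ℝ => Complex.exp (ζ * r) :=
      (contDiff_const.mul Complex.ofRealCLM.contDiff).cexp
    exact h1.contMDiff.comp h
  have hm := (hexp 1 hφ).mul_complex (hexp Complex.I hψ)
  have hloc : f =ᶠ[𝓝 x] (fun _ => f x) * ((fun y => Complex.exp (1 * φ y)) *
      fun y => Complex.exp (Complex.I * ψ y)) := by
    filter_upwards [hφe, hψe, hV.mem_nhds hxV] with y h1 h2 h3
    rw [Pi.mul_apply, Pi.mul_apply, h1, h2, ← Complex.exp_add, one_mul, mul_comm Complex.I]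
    simp only [Complex.reCLM_apply, Complex.imCLM_apply]
    rw [Complex.re_add_im, Complex.exp_log (Complex.slitPlane_ne_zero h3), mul_div_cancel₀ _ hx]
  rw [(Φ.map_congr hf (hconst.mul_complex hm) hloc).self_of_nhds, Φ.map_mul hconst hm,
    Φ.map_mul (hexp 1 hφ) (hexp Complex.I hψ)]
  simp only [Pi.mul_apply]
  rw [Φ.toFun_exp_mul_eq_one hn hk hφ hφ0, Φ.toFun_exp_mul_eq_one hn hk hψ hψ0, mul_one, mul_one]

/-- Applying `Φ` and then its inverse multiplies the argument of a constant by `ν` and then by `μ`,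
so `μ * ν = 1` and `ν = ±1`. The image of a constant need not be known to be constant: for `Φ.symm`
only its value at `u x` matters. -/
theorem toFun_const_eq_or (Φ : CkIso n k M) (hn : 1 ≤ n) (hk : 1 ≤ k) (x : M) :
    (∀ c : ℂ, Φ.toFun (fun _ => c) (Φ.point x) = c) ∨
      ∀ c : ℂ, Φ.toFun (fun _ => c) (Φ.point x) = starRingEnd ℂ c := by
  obtain ⟨ν, hν⟩ := Φ.exists_toFun_const hn hk x
  obtain ⟨μ, hμ⟩ := Φ.symm.exists_toFun_const hn hk (Φ.point x)
  have hpi := Real.pi_gt_three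
  have hlog : ∀ θ : ℝ, |θ| ≤ 1 → (Complex.exp (θ * Complex.I)).arg = θ := by
    intro θ hθ
    have h1 := abs_le.1 hθ
    have := Complex.log_exp (x := θ * Complex.I) (by simp; linarith) (by simp; linarith)
    rw [← Complex.log_im, this]
    simp
  have hprod : μ * ν = 1 := by
    -- The test constant has argument `1 / D`, so small that its multiples by `ν` and `μ * ν` stay
    -- in `[-1, 1]` and no argument wraps around.
    let D : ℝ := |(ν : ℝ)| + |((μ * ν : ℤ) : ℝ)| + 1
    have hD : 0 < D := by positivity
    have hle : ∀ m : ℤ, |(m : ℝ)| ≤ D → |(m : ℝ) * D⁻¹| ≤ 1 := fun m hm => by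
      rw [abs_mul, abs_inv, abs_of_pos hD, ← div_eq_mul_inv, div_le_one hD]
      exact hm
    have hD1 : |D⁻¹| ≤ 1 := by
      have := hle 1 (by simp only [D, Int.cast_one, abs_one]; linarith [abs_nonneg (ν : ℝ), abs_nonneg ((μ * ν : ℤ) : ℝ)])
      simpa using this
    have hν1 := hle ν (by simp only [D]; linarith [abs_nonneg ((μ * ν : ℤ) : ℝ)])
    have hμ1 := hle (μ * ν) (by simp only [D]; linarith [abs_nonneg (ν : ℝ)])
    let c : ℂ := Complex.exp ((D⁻¹ : ℝ) * Complex.I)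
    have hc : ContMDiff (𝓡 n) 𝓘(ℝ, ℂ) k (fun _ : M => c) := contMDiff_const
    have h1 : Φ.toFun (fun _ => c) (Φ.point x) =
        Complex.exp (((ν : ℝ) * D⁻¹ : ℝ) * Complex.I) := by
      rw [hν, hlog _ hD1, Complex.norm_exp_ofReal_mul_I]
      push_cast
      ring_nf
    have h2 : c = Complex.exp ((((μ * ν : ℤ) : ℝ) * D⁻¹ : ℝ) * Complex.I) := by
      have e1 : Φ.symm.toFun (Φ.toFun fun _ => c) = fun _ => c := Φ.inv_toFun hc
      have e2 : Φ.symm.point (Φ.point x) = x := Φ.point.symm_apply_apply x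
      have h3 := Φ.symm.toFun_eq_toFun_const hn hk (Φ.contMDiff_toFun hc) (Φ.point x)
      rw [e1, hμ, h1, hlog _ hν1, Complex.norm_exp_ofReal_mul_I] at h3
      change c = _ at h3
      rw [h3]
      push_cast
      ring_nf
    have h3 := congrArg Complex.arg h2
    rw [hlog _ hD1, hlog _ hμ1] at h3
    have h4 : ((μ * ν : ℤ) : ℝ) = 1 := by
      have := (mul_eq_right₀ (inv_ne_zero hD.ne')).1 h3.symm
      exact this
    exact_mod_cast h4
  rcases Int.eq_one_or_neg_one_of_mul_eq_one (mul_comm μ ν ▸ hprod) with h | h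
  · left
    intro c
    rw [hν, h, Int.cast_one, one_mul, Complex.norm_mul_exp_arg_mul_I]
  · right
    intro c
    rw [hν, h]
    conv_rhs => rw [← Complex.norm_mul_exp_arg_mul_I c]
    rw [_root_.map_mul, ← Complex.exp_conj, _root_.map_mul, Complex.conj_ofReal, Complex.conj_ofReal,
      Complex.conj_I]
    push_cast
    ring_nf

/-- The constant `i` detects the sign: its image is `i` or `-i`, and each alternative defines a
closed set. -/
theorem exists_isClopen (Φ : CkIso n k M) (hn : 1 ≤ n) (hk : 1 ≤ k) :
    ∃ U : Set M, IsClopen U ∧ ∀ f, ContMDiff (𝓡 n) 𝓘(ℝ, ℂ) k f →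
      (∀ x ∈ U, Φ.toFun f (Φ.point x) = f x) ∧
      ∀ x ∉ U, Φ.toFun f (Φ.point x) = starRingEnd ℂ (f x) := by
  have hI : ContMDiff (𝓡 n) 𝓘(ℝ, ℂ) k (fun _ : M => Complex.I) := contMDiff_const
  have hc : Continuous fun x => Φ.toFun (fun _ => Complex.I) (Φ.point x) :=
    (Φ.contMDiff_toFun hI).continuous.comp Φ.point.continuous
  have hne : -Complex.I ≠ Complex.I := fun h => by
    have := congrArg Complex.im h
    norm_num at this
  have hU : {x | Φ.toFun (fun _ => Complex.I) (Φ.point x) = Complex.I} =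
      {x | Φ.toFun (fun _ => Complex.I) (Φ.point x) = -Complex.I}ᶜ := by
    ext x
    simp only [mem_ofPred_eq, mem_compl_iff]
    rcases Φ.toFun_const_eq_or hn hk x with h | h
    · rw [h]
      exact ⟨fun _ => hne.symm, fun _ => rfl⟩
    · rw [h, Complex.conj_I]
      exact ⟨fun h => absurd h hne, fun h => absurd rfl h⟩
  refine ⟨{x | Φ.toFun (fun _ => Complex.I) (Φ.point x) = Complex.I},
    ⟨isClosed_eq hc continuous_const, ?_⟩, fun f hf => ⟨fun x hx => ?_, fun x hx => ?_⟩⟩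
  · rw [hU]
    exact (isClosed_eq hc continuous_const).isOpen_compl
  · rw [Φ.toFun_eq_toFun_const hn hk hf]
    rcases Φ.toFun_const_eq_or hn hk x with h | h
    · exact h _
    · rw [mem_ofPred_eq, h, Complex.conj_I] at hx
      exact absurd hx hne
  · rw [Φ.toFun_eq_toFun_const hn hk hf]
    rcases Φ.toFun_const_eq_or hn hk x with h | h
    · exact absurd (h _) hx
    · exact h _

end CkIso

/-! ### Admissibility of the three function algebras. -/

variable {n : ℕ} {k : ℕ∞} {M : Type*} [TopologicalSpace M]
  [ChartedSpace (EuclideanSpace ℝ (Fin n)) M]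

section

variable {B : NonUnitalSubalgebra ℝ (M → ℂ)} (hB : ∀ f ∈ B, ContMDiff (𝓡 n) 𝓘(ℝ, ℂ) k f)
include hB

theorem IsCharSeq.eq_one_of_mem_tsupport {f : ℕ → B} (hf : IsCharSeq f) {i : ℕ} {x : M}
    (hx : x ∈ tsupport (f (i + 1) : M → ℂ)) : (f i : M → ℂ) x = 1 := by
  have hc : IsClosed {x | (f i : M → ℂ) x = 1} :=
    isClosed_eq (hB _ (f i).2).continuous continuous_const
  refine closure_minimal (fun y hy => ?_) hc hx
  exact IsAdmissible.mul_eq_iff.1 ((mul_comm _ _).trans (hf.mul_succ i)) y hy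

theorem IsCharSeq.tsupport_antitone {f : ℕ → B} (hf : IsCharSeq f) :
    Antitone fun i => tsupport (f i : M → ℂ) := by
  refine antitone_nat_of_succ_le fun i x hx => subset_tsupport _ ?_
  rw [Function.mem_support, hf.eq_one_of_mem_tsupport hB hx]
  exact one_ne_zero

theorem IsCharSeq.exists_mem_tsupport_of_isCompact {f : ℕ → B} (hf : IsCharSeq f)
    (hc : HasCompactSupport (f 1 : M → ℂ)) : ∃ x, ∀ i, x ∈ tsupport (f i : M → ℂ) := by
  have hanti := hf.tsupport_antitone hB
  obtain ⟨x, hx⟩ := IsCompact.nonempty_iInter_of_sequence_nonempty_isCompact_isClosed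
    (fun i => tsupport (f (i + 1) : M → ℂ)) (fun i => hanti (Nat.le_succ _))
    (fun i => by
      have h0 : (f (i + 1) : M → ℂ) ≠ 0 := fun h => hf.ne_zero (i + 1) (Subtype.ext h)
      exact (Function.support_nonempty_iff.2 h0).mono (subset_tsupport _))
    hc (fun i => isClosed_tsupport _)
  exact ⟨x, fun i => hanti (Nat.le_succ i) (mem_iInter.1 hx i)⟩

end

theorem isAdmissible_compactCkFunctions : IsAdmissible n k (compactCkFunctions n k M) :=
  ⟨fun _ hf => hf.1, fun _ hf hc => ⟨hf, hc⟩, fun f hf =>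
    hf.exists_mem_tsupport_of_isCompact (k := k) (n := n) (fun _ h => And.left h) (f 1).2.2⟩

/-- Compactness comes from decay: `f 0 = 1` on the closed support of `f 1`, whereas a Schwartz
function has modulus below `1` outside a compact set. -/
theorem isAdmissible_schwartzFunctions : IsAdmissible n ⊤ (schwartzFunctions n) := by
  have hsm : ∀ f ∈ schwartzFunctions n, ContMDiff (𝓡 n) 𝓘(ℝ, ℂ) (⊤ : ℕ∞) f := by
    rintro _ ⟨φ, rfl⟩
    exact (φ.smooth ⊤).contMDiff
  refine ⟨hsm, fun f hf hc => ⟨hc.toSchwartzMap hf.contDiff, rfl⟩, fun f hf =>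
    hf.exists_mem_tsupport_of_isCompact hsm ?_⟩
  obtain ⟨φ, hφ⟩ := (f 0).2
  have h1 : Tendsto φ (cocompact _) (𝓝 0) := φ.toZeroAtInfty.zero_at_infty'
  have h2 : ∀ᶠ x in cocompact (EuclideanSpace ℝ (Fin n)), ‖φ x‖ < 1 :=
    h1.norm.eventually (gt_mem_nhds (by rw [norm_zero]; exact one_pos))
  obtain ⟨K, hK, hKs⟩ := mem_cocompact.1 h2
  refine hK.of_isClosed_subset (isClosed_tsupport _) fun x hx => ?_
  by_contra hxK
  have h3 : ‖φ x‖ < 1 := hKs hxK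
  rw [hφ, hf.eq_one_of_mem_tsupport hsm hx, norm_one] at h3
  exact lt_irrefl _ h3

section Rings

/-- Adding up the even members of a family of functions with disjoint supports. -/
theorem finsum_even_eq {R : ℕ → Set M} (hR : Pairwise fun i j => Disjoint (R i) (R j))
    {b : ℕ → M → ℂ} (hb : ∀ j, tsupport (b j) ⊆ R j) {j : ℕ} {x : M} (hx : x ∈ R j) :
    (∑ᶠ i, b (2 * i) x) = if Even j then b j x else 0 := by
  have h0 : ∀ i, i ≠ j → b i x = 0 := fun i hij => by
    by_contra h
    exact (hR hij).notMem_of_mem_left (hb i (subset_tsupport _ h)) hx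
  split_ifs with hj
  · obtain ⟨l, rfl⟩ := hj
    rw [finsum_eq_single _ l fun i hi => h0 _ (by omega), two_mul]
  · refine finsum_eq_zero_of_forall_eq_zero fun i => h0 _ ?_
    rintro rfl
    exact hj (even_two_mul i)

theorem exists_mem_of_finsum_even_ne_zero {R : ℕ → Set M} {b : ℕ → M → ℂ} (hb : ∀ j, tsupport (b j) ⊆ R j) {x : M} (hx : (∑ᶠ i, b (2 * i) x) ≠ 0) :
    ∃ j, Even j ∧ x ∈ R j ∧ b j x ≠ 0 := by
  obtain ⟨i, hi⟩ : ∃ i, b (2 * i) x ≠ 0 := by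
    by_contra! h
    exact hx (finsum_eq_zero_of_forall_eq_zero h)
  exact ⟨2 * i, even_two_mul i, hb _ (subset_tsupport _ hi), hi⟩

end Rings

variable [IsManifold (𝓡 n) k M] [T2Space M]

/-- If the closed supports had no common point, they would escape through a locally finite sequence
of disjoint open rings `R j`. Bumps placed in the even rings only give a triple `h, g', g` that the
sequence cannot decide: every `f i` is nonzero at points of even rings where `h = 1`, and at points
of odd rings where `g = 0`. -/
theorem isAdmissible_ckFunctions : IsAdmissible n k (ckFunctions n k M) := by
  refine ⟨fun _ hf => hf, fun _ hf _ => hf, fun f hf => ?_⟩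
  by_contra! hemp
  have hsm : ∀ f ∈ ckFunctions n k M, ContMDiff (𝓡 n) 𝓘(ℝ, ℂ) k f := fun _ hf => hf
  have hanti := hf.tsupport_antitone hsm
  have hstep : ∀ i, ∃ (p : M) (i' : ℕ), i < i' ∧ (f i : M → ℂ) p ≠ 0 ∧
      p ∉ tsupport (f i' : M → ℂ) := by
    intro i
    have h0 : (f i : M → ℂ) ≠ 0 := fun h => hf.ne_zero i (Subtype.ext h)
    obtain ⟨p, hp⟩ := Function.ne_iff.1 h0
    obtain ⟨i', hi'⟩ := hemp p
    refine ⟨p, max i' (i + 1), by omega, hp, fun h => hi' (hanti (le_max_left _ _) h)⟩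
  choose p s hs hp hps using hstep
  let idx : ℕ → ℕ := fun j => s^[j] 0
  have hidx : ∀ j, idx (j + 1) = s (idx j) := fun j => Function.iterate_succ_apply' s j 0
  have hmono : StrictMono idx := strictMono_nat_of_lt_succ fun j => by rw [hidx]; exact hs _
  let R : ℕ → Set M := fun j => Function.support (f (idx j) : M → ℂ) \
    tsupport (f (idx (j + 1)) : M → ℂ)
  have hRo : ∀ j, IsOpen (R j) := fun j =>
    ((hsm _ (f (idx j)).2).continuous.isOpen_support).sdiff (isClosed_tsupport _)
  have hRp : ∀ j, p (idx j) ∈ R j := fun j => ⟨hp _, by rw [hidx]; exact hps _⟩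
  have hRlt : ∀ i j, i < j → Disjoint (R i) (R j) := fun i j hij =>
    disjoint_left.2 fun x hxi hxj => hxi.2 (hanti (hmono.monotone hij) (subset_tsupport _ hxj.1))
  have hR : Pairwise fun i j => Disjoint (R i) (R j) := fun i j hij => by
    rcases hij.lt_or_gt with h | h
    · exact hRlt i j h
    · exact (hRlt j i h).symm
  have hRlf : LocallyFinite R := by
    intro x
    obtain ⟨i, hi⟩ := hemp x
    refine ⟨(tsupport (f i : M → ℂ))ᶜ, (isClosed_tsupport _).isOpen_compl.mem_nhds hi,
      (finite_Iio i).subset ?_⟩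
    rintro j ⟨y, hy1, hy2⟩
    by_contra hij
    exact hy2 (hanti ((not_lt.1 hij).trans (hmono.id_le j)) (subset_tsupport _ hy1.1))
  have hsum : ∀ b : ℕ → M → ℂ, (∀ j, ContMDiff (𝓡 n) 𝓘(ℝ, ℂ) k (b j)) →
      (∀ j, tsupport (b j) ⊆ R j) → ContMDiff (𝓡 n) 𝓘(ℝ, ℂ) k fun x => ∑ᶠ i, b (2 * i) x := by
    intro b hb hbR
    refine contMDiff_finsum (fun i => hb _) ?_
    exact (hRlf.comp_injective (mul_right_injective₀ two_ne_zero)).subset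
      fun i => (subset_tsupport _).trans (hbR _)
  choose b₂ hb₂ _ hb₂R hb₂1 using fun j => exists_contMDiff_bump_complex (n := n) (k := k)
    ((hRo j).mem_nhds (hRp j))
  choose b₁ hb₁ _ hb₁R hb₁1 using fun j => exists_contMDiff_bump_complex (n := n) (k := k)
    (inter_mem ((hRo j).mem_nhds (hRp j)) (hb₂1 j))
  choose b₀ hb₀ _ hb₀R hb₀1 using fun j => exists_contMDiff_bump_complex (n := n) (k := k)
    (inter_mem ((hRo j).mem_nhds (hRp j)) (hb₁1 j))
  have hb₁R' := fun j => (hb₁R j).trans inter_subset_left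
  have hb₀R' := fun j => (hb₀R j).trans inter_subset_left
  have hmul : ∀ {b b' : ℕ → M → ℂ}, (∀ j, tsupport (b j) ⊆ R j) → (∀ j, tsupport (b' j) ⊆ R j) →
      (∀ j x, b j x ≠ 0 → b' j x = 1) → ∀ x, (∑ᶠ i, b (2 * i) x) ≠ 0 →
        (∑ᶠ i, b' (2 * i) x) = 1 := by
    intro b b' hb hb' hbb' x hx
    obtain ⟨j, hj, hxj, hbj⟩ := exists_mem_of_finsum_even_ne_zero hb hx
    rw [finsum_even_eq hR hb' hxj, if_pos hj, hbb' j x hbj]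
  -- Every `f i` is still nonzero at the marked points of all later rings, of either parity.
  have hne : ∀ i j, i ≤ j → (f i : M → ℂ) (p (idx j)) ≠ 0 := by
    intro i j hij
    have h1 : p (idx j) ∈ tsupport (f (idx j) : M → ℂ) := subset_tsupport _ (hp _)
    rcases (hij.trans (hmono.id_le j)).eq_or_lt with h | h
    · rw [h]
      exact hp _
    · rw [hf.eq_one_of_mem_tsupport hsm (hanti h h1)]
      exact one_ne_zero
  rcases hf.decide ⟨_, hsum b₀ hb₀ hb₀R'⟩ ⟨_, hsum b₁ hb₁ hb₁R'⟩ ⟨_, hsum b₂ hb₂ hb₂R⟩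
    (IsAdmissible.mul_eq_iff.2 (hmul hb₀R' hb₁R' fun j x hx => (hb₀R j (subset_tsupport _ hx)).2))
    (IsAdmissible.mul_eq_iff.2 (hmul hb₁R' hb₂R fun j x hx => (hb₁R j (subset_tsupport _ hx)).2))
    with ⟨i, hi⟩ | ⟨i, hi⟩
  · have h1 := congrFun (congrArg Subtype.val hi) (p (idx (2 * i)))
    simp only [NonUnitalSubalgebra.coe_mul, Pi.mul_apply, ZeroMemClass.coe_zero, Pi.zero_apply]
      at h1
    rw [finsum_even_eq hR hb₀R' (hRp _), if_pos (even_two_mul i), (hb₀1 _).self_of_nhds,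
      Pi.one_apply, one_mul] at h1
    exact hne i _ (by omega) h1
  · have h1 := congrFun (congrArg Subtype.val hi) (p (idx (2 * i + 1)))
    simp only [NonUnitalSubalgebra.coe_mul, Pi.mul_apply] at h1
    rw [finsum_even_eq hR hb₂R (hRp _), if_neg (by simp), zero_mul] at h1
    exact hne i _ (by omega) h1.symm

/-! ### Conclusion for admissible algebras and for the three cases. -/

/-- Multiplicative bijections of an admissible algebra. -/
theorem IsAdmissible.exists_diffeomorph [FirstCountableTopology M] (hn : 1 ≤ n) (hk : 1 ≤ k)
    {B : NonUnitalSubalgebra ℝ (M → ℂ)} (hB : IsAdmissible n k B) {T : B → B}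
    (hT : Function.Bijective T) (hmul : ∀ f g, T (f * g) = T f * T g) :
    (∃ u : M ≃ₘ^k⟮𝓡 n, 𝓡 n⟯ M,
      (∃ U : Set M, IsClopen U ∧ ∀ f : B,
        (∀ x ∈ U, (T f : M → ℂ) (u x) = (f : M → ℂ) x) ∧
        (∀ x ∉ U, (T f : M → ℂ) (u x) = starRingEnd ℂ ((f : M → ℂ) x))) ∧
      (PreconnectedSpace M →
        (∀ (f : B) (x : M), (T f : M → ℂ) (u x) = (f : M → ℂ) x) ∨
        (∀ (f : B) (x : M), (T f : M → ℂ) (u x) = starRingEnd ℂ ((f : M → ℂ) x)))) ∧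
    IsLinearMap ℝ T := by
  obtain ⟨Φ, hΦ⟩ := hB.exists_ckIso (MulEquiv.ofBijective (⟨T, hmul⟩ : B →ₙ* B) hT)
  have hΦT : ∀ f : B, Φ.toFun f = T f := hΦ
  obtain ⟨U, hU, hUf⟩ := Φ.exists_isClopen hn hk
  have hUT : ∀ f : B, (∀ x ∈ U, (T f : M → ℂ) (Φ.point x) = (f : M → ℂ) x) ∧
      ∀ x ∉ U, (T f : M → ℂ) (Φ.point x) = starRingEnd ℂ ((f : M → ℂ) x) := fun f => by
    rw [← hΦT]
    exact hUf f (hB.contMDiff f f.2)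
  refine ⟨⟨⟨Φ.point.toEquiv, Φ.contMDiff_point hn, Φ.contMDiff_symm_point hn⟩, ⟨U, hU, hUT⟩,
    fun hM => ?_⟩, ⟨fun f g => Subtype.ext (funext fun y => ?_),
      fun r f => Subtype.ext (funext fun y => ?_)⟩⟩
  · rcases isClopen_iff.1 hU with rfl | rfl
    · exact Or.inr fun f x => (hUT f).2 x (notMem_empty x)
    · exact Or.inl fun f x => (hUT f).1 x (mem_univ x)
  · obtain ⟨x, rfl⟩ := Φ.point.surjective y
    simp only [NonUnitalSubalgebra.coe_add, Pi.add_apply]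
    by_cases hx : x ∈ U
    · simp [(hUT _).1 x hx]
    · simp [(hUT _).2 x hx]
  · obtain ⟨x, rfl⟩ := Φ.point.surjective y
    simp only [NonUnitalSubalgebra.coe_smul, Pi.smul_apply]
    by_cases hx : x ∈ U
    · simp [(hUT _).1 x hx]
    · simp [(hUT _).2 x hx]

end

theorem mainTheorem1 (n : ℕ) (hn : 1 ≤ n) :
    -- the cases `B = C^k(M, ℂ)` and `B = C^k_c(M, ℂ)`
    (∀ (k : ℕ∞) (_ : 1 ≤ k) (M : Type*) [TopologicalSpace M] [T2Space M]
        [SecondCountableTopology M] [ChartedSpace (EuclideanSpace ℝ (Fin n)) M]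
        [IsManifold (𝓡 n) k M]
        (B : NonUnitalSubalgebra ℝ (M → ℂ))
        (_ : B = ckFunctions n k M ∨ B = compactCkFunctions n k M)
        (T : B → B) (_ : Function.Bijective T) (_ : ∀ f g : B, T (f * g) = T f * T g),
      (∃ u : M ≃ₘ^k⟮𝓡 n, 𝓡 n⟯ M,
        (∃ U : Set M, IsClopen U ∧ ∀ f : B,
          (∀ x ∈ U, (T f : M → ℂ) (u x) = (f : M → ℂ) x) ∧
          (∀ x ∉ U, (T f : M → ℂ) (u x) = starRingEnd ℂ ((f : M → ℂ) x))) ∧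
        (PreconnectedSpace M →
          (∀ (f : B) (x : M), (T f : M → ℂ) (u x) = (f : M → ℂ) x) ∨
          (∀ (f : B) (x : M), (T f : M → ℂ) (u x) = starRingEnd ℂ ((f : M → ℂ) x)))) ∧
      IsLinearMap ℝ T) ∧
    -- the case of the Schwartz space, where `M = ℝⁿ` and `k = ∞`
    (∀ (T : schwartzFunctions n → schwartzFunctions n) (_ : Function.Bijective T)
        (_ : ∀ f g : schwartzFunctions n, T (f * g) = T f * T g),
      (∃ u : EuclideanSpace ℝ (Fin n) ≃ₘ^∞⟮𝓡 n, 𝓡 n⟯ EuclideanSpace ℝ (Fin n),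
        (∀ (f : schwartzFunctions n) (x : EuclideanSpace ℝ (Fin n)),
          (T f : EuclideanSpace ℝ (Fin n) → ℂ) (u x) =
            (f : EuclideanSpace ℝ (Fin n) → ℂ) x) ∨
        (∀ (f : schwartzFunctions n) (x : EuclideanSpace ℝ (Fin n)),
          (T f : EuclideanSpace ℝ (Fin n) → ℂ) (u x) =
            starRingEnd ℂ ((f : EuclideanSpace ℝ (Fin n) → ℂ) x))) ∧
      IsLinearMap ℝ T) := by
  refine ⟨fun k hk M _ _ _ _ _ B hB T hT hmul => ?_, fun T hT hmul => ?_⟩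
  · rcases hB with rfl | rfl
    · exact isAdmissible_ckFunctions.exists_diffeomorph hn hk hT hmul
    · exact isAdmissible_compactCkFunctions.exists_diffeomorph hn hk hT hmul
  · obtain ⟨⟨u, -, hu⟩, hlin⟩ :=
      isAdmissible_schwartzFunctions.exists_diffeomorph hn le_top hT hmul
    exact ⟨⟨u, hu inferInstance⟩, hlin⟩
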